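/- Fix a constraint theory $\mathcal{CT}$ (a complete first-order theory with equality, integer constants, $+$ and $-$) and an infinite set of variables. **CHR.** A state is $\sigma=\langle\mathbb G;\mathbb B;\mathbb V\rangle$ with $\mathbb G$ a multiset of user-defined constraints, $\mathbb B$ a conjunction of built-in constraints and $\mathbb V$ a finite set of (global) variables; variables outside $\mathbb V\cup\mathrm{vars}(\mathbb G)$ are strictly local. Equivalence $\equiv$ is the smallest equivalence relation on states such that 1. $\langle\mathbb G;x\doteq t\wedge\mathbb B;\mathbb V\rangle\equiv\langle\mathbb G[x/t];x\doteq t\wedge\mathbb B;\mathbb V\rangle$; 2. $\langle\mathbb G;\mathbb B;\mathbb V\rangle\equiv\langle\mathbb G;\mathbb B';\mathbb V\rangle$ if $\mathcal{CT}\models\exists\bar s.\mathbb B\leftrightarrow\exists\bar s'.\mathbb B'$, where $\bar s,\bar s'$ are the strictly local variables of $\mathbb B,\mathbb B'$; 3. $\langle\mathbb G;\mathbb B;\{X\}\cup\mathbb V\rangle\equiv\langle\mathbb G;\mathbb B;\mathbb V\rangle$ if $X$ does not occur in $\mathbb G$ or $\mathbb B$; 4. $\langle\mathbb G;\bot;\mathbb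 V\rangle\equiv\langle\mathbb G';\bot;\mathbb V\rangle$. A program $\mathcal P$ is a set of simplification rules $H\Leftrightarrow B^u,B^b$, with $H,B^u$ multisets of user-defined constraints and $B^b$ a conjunction of built-in constraints. Its transitions are $[\langle H\uplus\mathbb G;\mathbb B;\mathbb V\rangle]\rightarrowtail[\langle B^u\uplus\mathbb G;B^b\wedge\mathbb B;\mathbb V\rangle]$ on $\equiv$-classes, for fresh copies of rules of $\mathcal P$. Two classes are joinable if they have a common $\rightarrowtail^*$-successor. For a predicate $\mathcal I$ on states, $\mathcal P$ is $\mathcal I$-local-confluent if for every $\sigma$ with $\mathcal I(\sigma)$ any $\sigma_1,\sigma_2$ with $\sigma_1\leftarrowtail\sigma\rightarrowtail\sigma_2$ are joinable. Let $H_i\uplus A_i\Leftrightarrow B_i^u,B_i^b$ ($i=1,2$) be copies, renamed apart, of two (possibly equal) rules of $\mathcal P$, where $A_1,A_2$ are non-empty and $A_1=A_2$ denotes a conjunction of argument equations that pairs the constraints of $A_1$ with those of $A_2$, such that $\mathcal{CT}\models\exists(A_1=A_2)$. With $\mathbb V=\mathrm{vars}(H_1\uplus A_1\uplus H_2\uplus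 A_2)$, the state $\sigma_{\mathcal{CP}}=\langle H_1\uplus A_1\uplus H_2;A_1=A_2;\mathbb V\rangle$ is an overlap, and the pair of $\sigma_1=\langle B_1^u\uplus H_2;B_1^b\wedge(A_1=A_2);\mathbb V\rangle$ and $\sigma_2=\langle B_2^u\uplus H_1;B_2^b\wedge(A_1=A_2);\mathbb V\rangle$ is a critical CHR pair with overlap $\sigma_{\mathcal{CP}}$. **Encoding.** A GTS is a finite type graph $TG$ with a set of rules $L\leftarrow K\rightarrow R$, where $L,K,R$ are finite graphs typed over $TG$ and $K$ is included in $L$ and $R$. Nodes and edges $x$ are assigned distinct variables $X_x$ and, for nodes, degree variables $D_x$. An edge $e$ of type $t$ is encoded as $t(X_e,X_{\mathrm{src}(e)},X_{\mathrm{tgt}(e)})$, and a node $v$ of type $t$ as $t(X_v,d)$ with degree argument $d$. For a graph $G$, $\mathrm{chr}(\mathrm{gnd},G)$ is the multiset of these constraints with $d=\deg_G(v)$. A rule is encoded as the simplification rule with head: all edges of $L$, the nodes $v$ of $K$ with $d=D_v$ and the nodes $v$ of $L\setminus K$ with $d=\deg_L(v)$; user-defined body: all edges of $R$, the nodes $v$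 of $R\setminus K$ with $d=\deg_R(v)$ and, for $v$ in $K$, the constraint $t(X_{v'},D_{v'})$ with fresh variables $X_{v'},D_{v'}$; built-in body: $X_v=X_{v'}\wedge D_{v'}=D_v-\deg_L(v)+\deg_R(v)$ for $v$ in $K$. The set of the encoded rules is the GTS-CHR program of the GTS. **Graph invariant.** $\mathcal G(\sigma)$ holds if $\sigma$ is equivalent to a state $\langle\mathbb G;\mathbb B_c\wedge\mathbb B_a;\mathbb V\rangle$, with $\mathbb B_c$ consisting of constraints $X=c$ and $\mathbb B_a$ of constraints $X=Y+c_1-c_2$ (also written $X=Y-c_2+c_1$, or $X=Y$), for which there are a graph $G$ typed over $TG$ and a conjunction $B$ of equations $X=c$ such that $\langle\mathbb G;\mathbb B_c\wedge\mathbb B_a\wedge B;\emptyset\rangle\equiv\langle\mathrm{chr}(\mathrm{gnd},G);\top;\emptyset\rangle$. Here $X,Y$ are variables and $c,c_1,c_2$ constants. **Corollary (Deciding $\mathcal G$-local-confluence).** A GTS-CHR program $\mathcal P$ is $\mathcal G$-local-confluent if and only if every critical CHR pair $(\sigma_1,\sigma_2)$ of $\mathcal P$ whose overlap $\sigma_{\mathcal{CP}}$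 satisfies $\mathcal G(\sigma_{\mathcal{CP}})$ is joinable. -/

import Mathlib

universe u v w z

noncomputable section

/-! ## Constraint theories and terms -/

/-- The constraint theory `CT` on built-in constraints: a complete theory, given as the set of
first-order sentences that hold in a structure `carrier` over an arbitrary signature `L`.
It has syntactic equality and the integer constants with the operations `+` and `-`.
Nothing is required of the further symbols of `L`, nor of `+` and `-` on non-numerals. -/
structure ConstraintTheory (L : FirstOrder.Language.{u, v}) where
  carrier : Type w
  [str : L.Structure carrier]
  num : ℤ → L.Constants
  add : L.Functions 2
  sub : L.Functions 2
  num_injective : Function.Injective (fun n : ℤ => (num n : carrier))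
  add_num : ∀ m n : ℤ,
    FirstOrder.Language.Structure.funMap add ![(num m : carrier), (num n : carrier)] = (num (m + n) : carrier)
  sub_num : ∀ m n : ℤ,
    FirstOrder.Language.Structure.funMap sub ![(num m : carrier), (num n : carrier)] = (num (m - n) : carrier)

attribute [instance] ConstraintTheory.str

/-- The set of variables of a term. -/
def termVars {L : FirstOrder.Language.{u, v}} {Var : Type z} [DecidableEq Var] (t : L.Term Var) : Set Var :=
  {x | x ∈ t.varFinset}

/-- The term `t[x/s]`. -/
def termSubst {L : FirstOrder.Language.{u, v}} {Var : Type z} [DecidableEq Var] (x : Var) (s : L.Term Var)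
    (t : L.Term Var) : L.Term Var :=
  t.subst (Function.update FirstOrder.Language.Term.var x s)

/-- The constant term `n`. -/
def ConstraintTheory.numT {L : FirstOrder.Language.{u, v}} (CT : ConstraintTheory.{u, v, w} L) {Var : Type z}
    (n : ℤ) : L.Term Var :=
  (CT.num n).term

/-- The term `s + t`. -/
def ConstraintTheory.addT {L : FirstOrder.Language.{u, v}} (CT : ConstraintTheory.{u, v, w} L) {Var : Type z}
    (s t : L.Term Var) : L.Term Var :=
  CT.add.apply₂ s t

/-- The term `s - t`. -/
def ConstraintTheory.subT {L : FirstOrder.Language.{u, v}} (CT : ConstraintTheory.{u, v, w} L) {Var : Type z}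
    (s t : L.Term Var) : L.Term Var :=
  CT.sub.apply₂ s t

/-! ## Constraints -/

/-- Built-in constraints: `⊤`, `⊥`, equations, and predicates of the constraint theory. -/
inductive Builtin (L : FirstOrder.Language.{u, v}) (Var : Type z) where
  | top : Builtin L Var
  | bot : Builtin L Var
  | eq (s t : L.Term Var) : Builtin L Var
  | rel {n : ℕ} (R : L.Relations n) (ts : Fin n → L.Term Var) : Builtin L Var

/-- Truth of a built-in constraint under a valuation. -/
def Builtin.Holds {L : FirstOrder.Language.{u, v}} {Var : Type z} (CT : ConstraintTheory.{u, v, w} L)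
    (ν : Var → CT.carrier) : Builtin L Var → Prop
  | .top => True
  | .bot => False
  | .eq s t => s.realize ν = t.realize ν
  | .rel R ts => FirstOrder.Language.Structure.RelMap R (fun i => (ts i).realize ν)

/-- The variables of a built-in constraint. -/
def Builtin.vars {L : FirstOrder.Language.{u, v}} {Var : Type z} [DecidableEq Var] :
    Builtin L Var → Set Var
  | .top => ∅
  | .bot => ∅
  | .eq s t => termVars s ∪ termVars t
  | .rel _ ts => ⋃ i, termVars (ts i)

/-- Renaming of the variables of a built-in constraint. -/
def Builtin.rename {L : FirstOrder.Language.{u, v}} {Var : Type z} (f : Var → Var) :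
    Builtin L Var → Builtin L Var
  | .top => .top
  | .bot => .bot
  | .eq s t => .eq (s.relabel f) (t.relabel f)
  | .rel R ts => .rel R (fun i => (ts i).relabel f)

/-- A conjunction of built-in constraints; the empty conjunction is `⊤`, and `++` is `∧`. -/
abbrev Store (L : FirstOrder.Language.{u, v}) (Var : Type z) := List (Builtin L Var)

def Store.Holds {L : FirstOrder.Language.{u, v}} {Var : Type z} (CT : ConstraintTheory.{u, v, w} L)
    (ν : Var → CT.carrier) (B : Store L Var) : Prop :=
  ∀ b ∈ B, b.Holds CT ν

def Store.vars {L : FirstOrder.Language.{u, v}} {Var : Type z} [DecidableEq Var] (B : Store L Var) : Set Var :=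
  {x | ∃ b ∈ B, x ∈ b.vars}

/-- Symbols of user-defined constraints with their arities. -/
structure UserSignature where
  Sym : Type
  arity : Sym → ℕ

/-- User-defined constraints `c(t₁, …, tₙ)` with `c/n` in the signature. -/
structure UserConstraint (S : UserSignature) (L : FirstOrder.Language.{u, v}) (Var : Type z) where
  sym : S.Sym
  args : Fin (S.arity sym) → L.Term Var

/-- Apply a map on terms to all arguments. -/
def UserConstraint.mapArgs {S : UserSignature} {L : FirstOrder.Language.{u, v}} {Var : Type z}
    (g : L.Term Var → L.Term Var) (c : UserConstraint S L Var) : UserConstraint S L Var :=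
  ⟨c.sym, fun i => g (c.args i)⟩

/-- A multiset of user-defined constraints. -/
abbrev Goal (S : UserSignature) (L : FirstOrder.Language.{u, v}) (Var : Type z) :=
  Multiset (UserConstraint S L Var)

def Goal.vars {S : UserSignature} {L : FirstOrder.Language.{u, v}} {Var : Type z} [DecidableEq Var]
    (G : Goal S L Var) : Set Var :=
  {x | ∃ c ∈ G, ∃ i, x ∈ termVars (c.args i)}

/-- The goal `G[x/t]`. -/
def Goal.subst {S : UserSignature} {L : FirstOrder.Language.{u, v}} {Var : Type z} [DecidableEq Var]
    (x : Var) (t : L.Term Var) (G : Goal S L Var) : Goal S L Var :=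
  G.map (UserConstraint.mapArgs (termSubst x t))

def Goal.rename {S : UserSignature} {L : FirstOrder.Language.{u, v}} {Var : Type z} (f : Var → Var)
    (G : Goal S L Var) : Goal S L Var :=
  G.map (UserConstraint.mapArgs (FirstOrder.Language.Term.relabel f))

open Classical in
/-- The equation `c = d` of user-defined constraints: the conjunction of the equations of their
arguments, and `⊥` if the symbols differ. -/
def UserConstraint.equate {S : UserSignature} {L : FirstOrder.Language.{u, v}} {Var : Type z}
    (c d : UserConstraint S L Var) : Store L Var :=
  if h : c.sym = d.sym then
    List.ofFn (fun i => Builtin.eq (c.args i) (d.args (Fin.cast (congrArg S.arity h) i)))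
  else [Builtin.bot]

/-! ## CHR states and their equivalence -/

/-- A CHR state `⟨goal; store; globals⟩`. -/
structure CHRState (S : UserSignature) (L : FirstOrder.Language.{u, v}) (Var : Type z) where
  goal : Goal S L Var
  store : Store L Var
  globals : Finset Var

/-- The four conditions that generate state equivalence. In `ct` the strictly local variables,
those outside `V ∪ vars(G)`, are quantified existentially on either side. -/
inductive EquivStep {S : UserSignature} {L : FirstOrder.Language.{u, v}} {Var : Type z} [DecidableEq Var]
    (CT : ConstraintTheory.{u, v, w} L) : CHRState S L Var → CHRState S L Var → Prop
  | subst (G : Goal S L Var) (x : Var) (t : L.Term Var) (B : Store L Var) (V : Finset Var) :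
      EquivStep CT ⟨G, Builtin.eq (FirstOrder.Language.Term.var x) t :: B, V⟩
        ⟨G.subst x t, Builtin.eq (FirstOrder.Language.Term.var x) t :: B, V⟩
  | ct (G : Goal S L Var) (B B' : Store L Var) (V : Finset Var)
      (h : ∀ ν : Var → CT.carrier,
        (∃ ν' : Var → CT.carrier, (∀ x, x ∈ V ∨ x ∈ G.vars → ν' x = ν x) ∧ B.Holds CT ν') ↔
        (∃ ν' : Var → CT.carrier, (∀ x, x ∈ V ∨ x ∈ G.vars → ν' x = ν x) ∧ B'.Holds CT ν')) :
      EquivStep CT ⟨G, B, V⟩ ⟨G, B', V⟩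
  | omit_global (G : Goal S L Var) (B : Store L Var) (V : Finset Var) (X : Var)
      (hG : X ∉ G.vars) (hB : X ∉ B.vars) :
      EquivStep CT ⟨G, B, insert X V⟩ ⟨G, B, V⟩
  | fail (G G' : Goal S L Var) (V : Finset Var) :
      EquivStep CT ⟨G, [Builtin.bot], V⟩ ⟨G', [Builtin.bot], V⟩

/-- State equivalence `≡`: the smallest equivalence relation with the four conditions. -/
def StateEquiv {S : UserSignature} {L : FirstOrder.Language.{u, v}} {Var : Type z} [DecidableEq Var]
    (CT : ConstraintTheory.{u, v, w} L) : CHRState S L Var → CHRState S L Var → Prop :=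
  Relation.EqvGen (EquivStep CT)

def stateSetoid (S : UserSignature) {L : FirstOrder.Language.{u, v}} (Var : Type z) [DecidableEq Var]
    (CT : ConstraintTheory.{u, v, w} L) : Setoid (CHRState S L Var) :=
  Relation.EqvGen.setoid (EquivStep CT)

/-- Equivalence classes of CHR states. -/
abbrev StateClass (S : UserSignature) {L : FirstOrder.Language.{u, v}} (Var : Type z) [DecidableEq Var]
    (CT : ConstraintTheory.{u, v, w} L) :=
  Quotient (stateSetoid S Var CT)

/-- The class `[σ]`. -/
def CHRState.cls {S : UserSignature} {L : FirstOrder.Language.{u, v}} {Var : Type z} [DecidableEq Var]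
    (CT : ConstraintTheory.{u, v, w} L) (σ : CHRState S L Var) : StateClass S Var CT :=
  Quotient.mk (stateSetoid S Var CT) σ

/-! ## CHR rules and operational semantics -/

/-- A CHR simplification rule `head ⇔ bodyU, bodyB` without guard. -/
structure CHRRule (S : UserSignature) (L : FirstOrder.Language.{u, v}) (Var : Type z) where
  head : Goal S L Var
  bodyU : Goal S L Var
  bodyB : Store L Var

def CHRRule.rename {S : UserSignature} {L : FirstOrder.Language.{u, v}} {Var : Type z} (f : Var → Var)
    (r : CHRRule S L Var) : CHRRule S L Var :=
  ⟨r.head.rename f, r.bodyU.rename f, r.bodyB.map (Builtin.rename f)⟩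

def CHRRule.vars {S : UserSignature} {L : FirstOrder.Language.{u, v}} {Var : Type z} [DecidableEq Var]
    (r : CHRRule S L Var) : Set Var :=
  r.head.vars ∪ r.bodyU.vars ∪ r.bodyB.vars

/-- `r'` is a copy of `r` with renamed variables. -/
def CHRRule.IsCopy {S : UserSignature} {L : FirstOrder.Language.{u, v}} {Var : Type z}
    (r' r : CHRRule S L Var) : Prop :=
  ∃ f : Var → Var, Function.Injective f ∧ r' = r.rename f

/-- The transition relation on classes of states. The copy `r'` of the rule is fresh: none of its
variables is global, and the variables of its body that are not in its head do not occur in the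
rest of the state. (Its head variables have to occur in the store, which links them to the
matched constraints.) -/
def CHRStep {S : UserSignature} {L : FirstOrder.Language.{u, v}} {Var : Type z} [DecidableEq Var]
    (CT : ConstraintTheory.{u, v, w} L) (P : Set (CHRRule S L Var))
    (a b : StateClass S Var CT) : Prop :=
  ∃ r ∈ P, ∃ r' : CHRRule S L Var, r'.IsCopy r ∧
    ∃ (G : Goal S L Var) (B : Store L Var) (V : Finset Var),
      (∀ x ∈ r'.vars, x ∉ V) ∧
      (∀ x ∈ r'.vars, x ∉ r'.head.vars → x ∉ G.vars ∧ x ∉ B.vars) ∧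
      a = CHRState.cls CT ⟨r'.head + G, B, V⟩ ∧
      b = CHRState.cls CT ⟨r'.bodyU + G, r'.bodyB ++ B, V⟩

/-- Two classes are joinable if they have a common successor under `↣*`. -/
def CHRJoinable {S : UserSignature} {L : FirstOrder.Language.{u, v}} {Var : Type z} [DecidableEq Var]
    (CT : ConstraintTheory.{u, v, w} L) (P : Set (CHRRule S L Var))
    (a b : StateClass S Var CT) : Prop :=
  ∃ c, Relation.ReflTransGen (CHRStep CT P) a c ∧ Relation.ReflTransGen (CHRStep CT P) b c

/-- Local confluence restricted to the states that satisfy `I`. -/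
def LocallyConfluentOn {S : UserSignature} {L : FirstOrder.Language.{u, v}} {Var : Type z} [DecidableEq Var]
    (CT : ConstraintTheory.{u, v, w} L) (P : Set (CHRRule S L Var))
    (I : CHRState S L Var → Prop) : Prop :=
  ∀ σ, I σ → ∀ a b, CHRStep CT P (σ.cls CT) a → CHRStep CT P (σ.cls CT) b → CHRJoinable CT P a b

/-- `(σ₁, σ₂)` is a critical pair of the program `P` with overlap `σ`. The list `A` pairs the
constraints of `A₁` with those of `A₂`, so that `A₁ = A₂` is the conjunction of the equations of
the pairs. -/
def IsCriticalPair {S : UserSignature} {L : FirstOrder.Language.{u, v}} {Var : Type z} [DecidableEq Var]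
    (CT : ConstraintTheory.{u, v, w} L) (P : Set (CHRRule S L Var))
    (σ σ₁ σ₂ : CHRState S L Var) : Prop :=
  ∃ r₁ ∈ P, ∃ r₂ ∈ P, ∃ r₁' r₂' : CHRRule S L Var, r₁'.IsCopy r₁ ∧ r₂'.IsCopy r₂ ∧
    Disjoint r₁'.vars r₂'.vars ∧
    ∃ (H₁ H₂ : Goal S L Var) (A : List (UserConstraint S L Var × UserConstraint S L Var))
      (V : Finset Var),
      let A₁ : Goal S L Var := ((A.map Prod.fst : List (UserConstraint S L Var)) :
        Multiset (UserConstraint S L Var))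
      let A₂ : Goal S L Var := ((A.map Prod.snd : List (UserConstraint S L Var)) :
        Multiset (UserConstraint S L Var))
      let E : Store L Var := A.flatMap (fun q => q.1.equate q.2)
      A ≠ [] ∧
      r₁'.head = H₁ + A₁ ∧
      r₂'.head = H₂ + A₂ ∧
      (V : Set Var) = r₁'.head.vars ∪ r₂'.head.vars ∧
      (∃ ν : Var → CT.carrier, E.Holds CT ν) ∧
      σ = ⟨H₁ + A₁ + H₂, E, V⟩ ∧
      σ₁ = ⟨r₁'.bodyU + H₂, r₁'.bodyB ++ E, V⟩ ∧
      σ₂ = ⟨r₂'.bodyU + H₁, r₂'.bodyB ++ E, V⟩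

/-! ## Graph transformation systems -/

/-- Finite directed multigraphs. -/
structure FGraph where
  V : Type
  E : Type
  [finV : Fintype V]
  [finE : Fintype E]
  src : E → V
  tgt : E → V

attribute [instance] FGraph.finV FGraph.finE

/-- Graphs typed over the type graph `TG`. -/
structure TypedGraph (TG : FGraph) extends FGraph where
  typeV : V → TG.V
  typeE : E → TG.E
  type_src : ∀ e, typeV (src e) = TG.src (typeE e)
  type_tgt : ∀ e, typeV (tgt e) = TG.tgt (typeE e)

/-- The degree of a node: a loop counts twice. -/
def FGraph.deg (G : FGraph) (x : G.V) : ℕ :=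
  {e | G.src e = x}.ncard + {e | G.tgt e = x}.ncard

/-- Morphisms of typed graphs. -/
structure TypedHom {TG : FGraph} (G H : TypedGraph TG) where
  onV : G.V → H.V
  onE : G.E → H.E
  map_src : ∀ e, onV (G.src e) = H.src (onE e)
  map_tgt : ∀ e, onV (G.tgt e) = H.tgt (onE e)
  map_typeV : ∀ x, H.typeV (onV x) = G.typeV x
  map_typeE : ∀ e, H.typeE (onE e) = G.typeE e

/-- Graph production rules `L ← K → R`, with `K` included in `L` and in `R`. -/
structure GTSRule (TG : FGraph) where
  L : TypedGraph TG
  K : TypedGraph TG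
  R : TypedGraph TG
  l : TypedHom K L
  r : TypedHom K R
  l_injV : Function.Injective l.onV
  l_injE : Function.Injective l.onE
  r_injV : Function.Injective r.onV
  r_injE : Function.Injective r.onE

/-- Graph transformation systems. -/
structure GTS where
  TG : FGraph
  rules : Set (GTSRule TG)

/-! ## The encoding in CHR -/

/-- The constraint symbols for a type graph: `x/2` for nodes and `e/3` for edges. -/
def FGraph.signature (TG : FGraph) : UserSignature where
  Sym := TG.V ⊕ TG.E
  arity := Sum.elim (fun _ => 2) (fun _ => 3)

/-- The node constraint `t(x, d)`. -/
def nodeConstraint {TG : FGraph} {L : FirstOrder.Language.{u, v}} {Var : Type z} (t : TG.V) (x : Var)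
    (d : L.Term Var) : UserConstraint TG.signature L Var :=
  ⟨Sum.inl t, (![FirstOrder.Language.Term.var x, d] : Fin 2 → L.Term Var)⟩

/-- The edge constraint `t(x, y, y')`. -/
def edgeConstraint {TG : FGraph} {L : FirstOrder.Language.{u, v}} {Var : Type z} (t : TG.E) (x y y' : Var) :
    UserConstraint TG.signature L Var :=
  ⟨Sum.inr t, (![FirstOrder.Language.Term.var x, FirstOrder.Language.Term.var y, FirstOrder.Language.Term.var y'] :
    Fin 3 → L.Term Var)⟩

/-- The constraint of a node `x` of `G` with degree argument `d x`, for all nodes in `s`. -/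
def encodeNodes {TG : FGraph} {L : FirstOrder.Language.{u, v}} {Var : Type z} (G : TypedGraph TG)
    (varV : G.V → Var) (d : G.V → L.Term Var) (s : Finset G.V) : Goal TG.signature L Var :=
  s.val.map (fun x => nodeConstraint (G.typeV x) (varV x) (d x))

/-- The constraints of all edges of `G`. -/
def encodeEdges {TG : FGraph} (L : FirstOrder.Language.{u, v}) {Var : Type z} (G : TypedGraph TG)
    (varV : G.V → Var) (varE : G.E → Var) : Goal TG.signature L Var :=
  (Finset.univ : Finset G.E).val.map
    (fun e => edgeConstraint (G.typeE e) (varE e) (varV (G.src e)) (varV (G.tgt e)))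

/-- `chr(gnd, G)`, with the variable `nm x` for the node or edge `x`. -/
def chrGnd {TG : FGraph} {L : FirstOrder.Language.{u, v}} (CT : ConstraintTheory.{u, v, w} L) {Var : Type z}
    (G : TypedGraph TG) (nm : G.V ⊕ G.E → Var) : Goal TG.signature L Var :=
  encodeNodes G (fun x => nm (Sum.inl x)) (fun x => CT.numT (G.deg x)) Finset.univ
    + encodeEdges L G (fun x => nm (Sum.inl x)) (fun e => nm (Sum.inr e))

/-- The variables for encoding a rule: `var` on `L`, `var` on `R ∖ K`, the degree variables
`dvar`, and, for the fresh copy `x'` of each node `x` of `K`, `var x'` and `dvar x'`. -/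
inductive RuleVar {TG : FGraph} (p : GTSRule TG) : Type where
  | nodeL (x : p.L.V)
  | edgeL (e : p.L.E)
  | nodeR (x : p.R.V) (hx : x ∉ Set.range p.r.onV)
  | edgeR (e : p.R.E) (he : e ∉ Set.range p.r.onE)
  | dvar (x : p.L.V)
  | nodeK' (x : p.K.V)
  | dvarK' (x : p.K.V)

open Classical in
/-- `var` on the nodes of `R`; on `K` it agrees with `var` on `L`. -/
def GTSRule.varNodeR {TG : FGraph} (p : GTSRule TG) (x : p.R.V) : RuleVar p :=
  if h : x ∈ Set.range p.r.onV then .nodeL (p.l.onV h.choose) else .nodeR x h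

open Classical in
/-- `var` on the edges of `R`; on `K` it agrees with `var` on `L`. -/
def GTSRule.varEdgeR {TG : FGraph} (p : GTSRule TG) (e : p.R.E) : RuleVar p :=
  if h : e ∈ Set.range p.r.onE then .edgeL (p.l.onE h.choose) else .edgeR e h

open Classical in
/-- The head `C_L`: nodes of `K` have a variable degree, other nodes of `L` their degree in `L`. -/
def GTSRule.chrHead {TG : FGraph} {L : FirstOrder.Language.{u, v}} (CT : ConstraintTheory.{u, v, w} L)
    {Var : Type z} (p : GTSRule TG) (nm : RuleVar p → Var) : Goal TG.signature L Var :=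
  encodeNodes p.L (fun x => nm (.nodeL x))
      (fun x => if x ∈ Set.range p.l.onV then FirstOrder.Language.Term.var (nm (.dvar x))
        else CT.numT (p.L.deg x)) Finset.univ
    + encodeEdges L p.L (fun x => nm (.nodeL x)) (fun e => nm (.edgeL e))

open Classical in
/-- The user-defined part `C_R^u` of the body: the nodes of `R ∖ K` with their degree in `R`, the
copies `x'` of the nodes of `K`, and the edges of `R`. -/
def GTSRule.chrBodyU {TG : FGraph} {L : FirstOrder.Language.{u, v}} (CT : ConstraintTheory.{u, v, w} L)
    {Var : Type z} (p : GTSRule TG) (nm : RuleVar p → Var) : Goal TG.signature L Var :=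
  encodeNodes p.R (fun x => nm (p.varNodeR x)) (fun x => CT.numT (p.R.deg x))
      (Finset.univ.filter (fun x => x ∉ Set.range p.r.onV))
    + encodeNodes p.K (fun x => nm (.nodeK' x)) (fun x => FirstOrder.Language.Term.var (nm (.dvarK' x)))
        Finset.univ
    + encodeEdges L p.R (fun x => nm (p.varNodeR x)) (fun e => nm (p.varEdgeR e))

/-- The built-in part `C_R^b` of the body: `var x = var x'` and
`dvar x' = dvar x - deg_L x + deg_R x` for all nodes `x` of `K`. -/
def GTSRule.chrBodyB {TG : FGraph} {L : FirstOrder.Language.{u, v}} (CT : ConstraintTheory.{u, v, w} L)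
    {Var : Type z} (p : GTSRule TG) (nm : RuleVar p → Var) : Store L Var :=
  (Finset.univ : Finset p.K.V).toList.flatMap (fun x =>
    [Builtin.eq (FirstOrder.Language.Term.var (nm (.nodeL (p.l.onV x))))
        (FirstOrder.Language.Term.var (nm (.nodeK' x))),
     Builtin.eq (FirstOrder.Language.Term.var (nm (.dvarK' x)))
        (CT.addT
          (CT.subT (FirstOrder.Language.Term.var (nm (.dvar (p.l.onV x)))) (CT.numT (p.L.deg (p.l.onV x))))
          (CT.numT (p.R.deg (p.r.onV x))))])

/-- The CHR rule `ϱ(p)`. -/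
def GTSRule.toCHR {TG : FGraph} {L : FirstOrder.Language.{u, v}} (CT : ConstraintTheory.{u, v, w} L)
    {Var : Type z} (p : GTSRule TG) (nm : RuleVar p → Var) : CHRRule TG.signature L Var :=
  ⟨p.chrHead CT nm, p.chrBodyU CT nm, p.chrBodyB CT nm⟩

/-- The GTS-CHR program of a GTS, for a choice of variable names in every rule. -/
def GTS.toCHR {L : FirstOrder.Language.{u, v}} (CT : ConstraintTheory.{u, v, w} L) {Var : Type z} (𝒮 : GTS)
    (nm : ∀ p : GTSRule 𝒮.TG, RuleVar p ↪ Var) : Set (CHRRule 𝒮.TG.signature L Var) :=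
  {r | ∃ p ∈ 𝒮.rules, r = p.toCHR CT (nm p)}

/-! ## The graph invariant -/

/-- Constraints `X = c`. -/
inductive IsConstEq {L : FirstOrder.Language.{u, v}} {Var : Type z} : Builtin L Var → Prop
  | const (X : Var) (c : L.Constants) : IsConstEq (Builtin.eq (FirstOrder.Language.Term.var X) c.term)

/-- Constraints `X = Y + c₁ - c₂`, including the forms `X = Y` (as produced by overlaps) and
`X = Y - c₂ + c₁` (as produced by rule bodies). -/
inductive IsAdjustment {L : FirstOrder.Language.{u, v}} (CT : ConstraintTheory.{u, v, w} L) {Var : Type z} :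
    Builtin L Var → Prop
  | var (X Y : Var) : IsAdjustment CT (Builtin.eq (FirstOrder.Language.Term.var X) (FirstOrder.Language.Term.var Y))
  | addSub (X Y : Var) (c₁ c₂ : ℤ) : IsAdjustment CT (Builtin.eq (FirstOrder.Language.Term.var X)
      (CT.subT (CT.addT (FirstOrder.Language.Term.var Y) (CT.numT c₁)) (CT.numT c₂)))
  | subAdd (X Y : Var) (c₁ c₂ : ℤ) : IsAdjustment CT (Builtin.eq (FirstOrder.Language.Term.var X)
      (CT.addT (CT.subT (FirstOrder.Language.Term.var Y) (CT.numT c₂)) (CT.numT c₁)))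

/-- The graph invariant. States are taken up to equivalence: some state `τ ≡ σ` has a store of
constraints `X = c` and `X = Y + c₁ - c₂`, and becomes the encoding of a graph `Γ` when
equations `X = c` are added and the global variables are disregarded. -/
def GraphInvariant {TG : FGraph} {L : FirstOrder.Language.{u, v}} (CT : ConstraintTheory.{u, v, w} L)
    {Var : Type z} [DecidableEq Var] (σ : CHRState TG.signature L Var) : Prop :=
  ∃ τ : CHRState TG.signature L Var, StateEquiv CT σ τ ∧
    (∀ b ∈ τ.store, IsConstEq b ∨ IsAdjustment CT b) ∧
    ∃ (Γ : TypedGraph TG) (nm : Γ.V ⊕ Γ.E ↪ Var) (B : Store L Var),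
      (∀ b ∈ B, IsConstEq b) ∧
      StateEquiv CT ⟨τ.goal, τ.store ++ B, ∅⟩ ⟨chrGnd CT Γ nm, [], ∅⟩

end

/-! State equivalence is generated by syntactic conditions, so it is first made semantic. Two states
are equivalent exactly when both stores are unsatisfiable, or when their goals can be listed over
one index type such that the solutions of the two stores relate the same values of the global
variables to the same families of ground constraints (`stateEquiv_iff_semEquiv`). Soundness is
checked on the four generators. For completeness both states are brought into a flat form with a
common goal of distinct fresh variables and common globals; only the stores differ then, and the
condition on the constraint theory applies. From there on, equality of classes is a matter of
transporting solutions.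

The "only if" direction holds because an overlap has transitions to both members of its critical
pair (`IsCriticalPair.chrStep`).

For "if", take two transitions from one state. Since the listing of the goal is carried along
equivalences, the heads of both rules become sets `s₁`, `s₂` of positions in one index type
(`exists_peak`). If these are disjoint, the transitions commute (`Peak.joinable_of_disjoint`).
Otherwise the common positions determine a critical pair, the two targets are its members in a
common context, and joinability survives contexts (`CHRJoinable.extend`,
`Peak.joinable_of_left_right`).

It remains to see that the overlap satisfies the graph invariant, and only here graphs matter. The
state has an instance that encodes a graph `Γ` with pairwise distinct names
(`GraphInvariant.exists_ground`), so positions are nodes and edges of `Γ` and the heads are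
injective matches (`GTSRule.exists_match`). The union of their images is a subgraph `Δ`. A matched
node outside `K` has the same degree in `L` and in `Γ`, hence also in `Δ`, which lies in between; so
its numeral is right for `Δ`. The degree variables of the nodes of `K` can be set to the degrees in
`Δ`. With these equations the overlap encodes `Δ` (`Peak.graphInvariant_overlap`). Preservation of
the invariant by transitions plays no role. -/

/-! ### Variables, values and substitution in terms. -/

section Terms

open FirstOrder.Language

variable {L : FirstOrder.Language.{u, v}} {Var : Type z} [DecidableEq Var]

theorem termVars_var (x : Var) : termVars (Term.var x : L.Term Var) = {x} := by
  ext y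
  simp [termVars, Term.varFinset]

theorem mem_termVars_func {n : ℕ} {f : L.Functions n} {ts : Fin n → L.Term Var} {x : Var} :
    x ∈ termVars (Term.func f ts) ↔ ∃ i, x ∈ termVars (ts i) := by
  simp [termVars, Term.varFinset]

theorem termVars_finite (t : L.Term Var) : (termVars t).Finite :=
  t.varFinset.finite_toSet

theorem realize_congr {M : Type w} [L.Structure M] {t : L.Term Var} {ν ν' : Var → M}
    (h : ∀ x ∈ termVars t, ν x = ν' x) : t.realize ν = t.realize ν' := by
  induction t with
  | var x => exact h x (by simp [termVars_var])
  | func f ts ih =>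
    simp only [Term.realize]
    congr 1
    funext i
    exact ih i fun x hx => h x (mem_termVars_func.2 ⟨i, hx⟩)

theorem mem_termVars_relabel {f : Var → Var} {t : L.Term Var} {x : Var} :
    x ∈ termVars (t.relabel f) ↔ ∃ y ∈ termVars t, f y = x := by
  induction t with
  | var y => simp [Term.relabel, termVars_var, eq_comm]
  | func g ts ih =>
    simp only [Term.relabel, mem_termVars_func, ih]
    tauto

theorem termSubst_of_notMem {x : Var} {s t : L.Term Var} (h : x ∉ termVars t) :
    termSubst x s t = t := by
  unfold termSubst
  induction t with
  | var y =>
    have : y ≠ x := fun e => h (by simp [termVars_var, e])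
    simp [Term.subst, Function.update_of_ne this]
  | func g ts ih =>
    simp only [Term.subst]
    congr 1
    funext i
    exact ih i fun hx => h (mem_termVars_func.2 ⟨i, hx⟩)

theorem realize_termSubst {M : Type w} [L.Structure M] {x : Var} {s t : L.Term Var} {ν : Var → M}
    (h : ν x = s.realize ν) : (termSubst x s t).realize ν = t.realize ν := by
  unfold termSubst
  rw [Term.realize_subst]
  congr 1
  funext y
  by_cases hy : y = x
  · subst hy
    simp [h]
  · simp [Function.update_of_ne hy]

end Terms

/-! ### Truth, instances and variables of constraints. -/

section Constraints

open FirstOrder.Language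

variable {L : FirstOrder.Language.{u, v}} {Var : Type z} {CT : ConstraintTheory.{u, v, w} L}
  {S : UserSignature}

theorem ConstraintTheory.realize_numT (n : ℤ) (ν : Var → CT.carrier) :
    (CT.numT n : L.Term Var).realize ν = (CT.num n : CT.carrier) := by
  simp [ConstraintTheory.numT]

theorem Builtin.holds_rename {f : Var → Var} {b : Builtin L Var} {ν : Var → CT.carrier} :
    (b.rename f).Holds CT ν ↔ b.Holds CT (ν ∘ f) := by
  cases b <;> simp [Builtin.rename, Builtin.Holds, Term.realize_relabel]

theorem Store.holds_rename {f : Var → Var} {B : Store L Var} {ν : Var → CT.carrier} :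
    Store.Holds CT ν (B.map (Builtin.rename f)) ↔ B.Holds CT (ν ∘ f) := by
  simp [Store.Holds, Builtin.holds_rename]

@[simp] theorem Store.holds_nil {ν : Var → CT.carrier} : Store.Holds CT ν ([] : Store L Var) := by
  simp [Store.Holds]

@[simp] theorem Store.holds_append {B B' : Store L Var} {ν : Var → CT.carrier} :
    Store.Holds CT ν (B ++ B') ↔ B.Holds CT ν ∧ B'.Holds CT ν := by
  simp [Store.Holds, or_imp, forall_and]

@[simp] theorem Store.holds_cons {b : Builtin L Var} {B : Store L Var} {ν : Var → CT.carrier} :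
    Store.Holds CT ν (b :: B) ↔ b.Holds CT ν ∧ B.Holds CT ν := by
  simp [Store.Holds]

/-- Ground user-defined constraints over a domain `M`. -/
abbrev GroundConstraint (S : UserSignature) (M : Type w) := Σ s : S.Sym, (Fin (S.arity s) → M)

/-- The instance of a user-defined constraint under a valuation. -/
def UserConstraint.inst {M : Type w} [L.Structure M] (ν : Var → M) (c : UserConstraint S L Var) :
    GroundConstraint S M :=
  ⟨c.sym, fun i => (c.args i).realize ν⟩

theorem UserConstraint.inst_mapArgs_relabel {M : Type w} [L.Structure M] {ν : Var → M} {f : Var → Var}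
    {c : UserConstraint S L Var} :
    (c.mapArgs (Term.relabel f)).inst ν = c.inst (ν ∘ f) := by
  simp [UserConstraint.inst, UserConstraint.mapArgs, Term.realize_relabel]

/-- This turns the equations of an overlap into equality of ground instances; the case of different
symbols is covered, as `⊥` matches the differing first components. -/
theorem UserConstraint.holds_equate {c d : UserConstraint S L Var} {ν : Var → CT.carrier} :
    (c.equate d).Holds CT ν ↔ c.inst ν = d.inst ν := by
  obtain ⟨s, a⟩ := c
  obtain ⟨s', a'⟩ := d
  unfold UserConstraint.equate UserConstraint.inst
  by_cases h : s = s'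
  · subst h
    simp [Store.Holds, List.mem_ofFn, Builtin.Holds, funext_iff]
  · simp [h, Store.Holds, Builtin.Holds]

theorem Goal.rename_add {f : Var → Var} {G G' : Goal S L Var} :
    Goal.rename f (G + G') = G.rename f + G'.rename f :=
  Multiset.map_add _ _ _

section Vars

variable [DecidableEq Var]

/-- The variables of a user-defined constraint. -/
def UserConstraint.vars (c : UserConstraint S L Var) : Set Var :=
  {x | ∃ i, x ∈ termVars (c.args i)}

theorem Goal.mem_vars {G : Goal S L Var} {x : Var} : x ∈ G.vars ↔ ∃ c ∈ G, x ∈ c.vars :=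
  Iff.rfl

theorem UserConstraint.vars_finite (c : UserConstraint S L Var) : c.vars.Finite := by
  have : c.vars = ⋃ i, termVars (c.args i) := by
    ext
    simp [UserConstraint.vars]
  rw [this]
  exact Set.finite_iUnion fun i => termVars_finite _

theorem Goal.vars_finite (G : Goal S L Var) : G.vars.Finite := by
  have : G.vars = ⋃ c ∈ {c | c ∈ G}, c.vars := by
    ext
    simp [Goal.mem_vars]
  rw [this]
  classical
  refine Set.Finite.biUnion ?_ fun c _ => c.vars_finite
  exact (G.toFinset.finite_toSet).subset fun c hc => by simpa using hc

theorem Builtin.vars_finite (b : Builtin L Var) : b.vars.Finite := by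
  cases b with
  | top => exact Set.finite_empty
  | bot => exact Set.finite_empty
  | eq s t => exact (termVars_finite s).union (termVars_finite t)
  | rel R ts => exact Set.finite_iUnion fun i => termVars_finite _

theorem Store.vars_finite (B : Store L Var) : B.vars.Finite := by
  have : B.vars = ⋃ b ∈ {b | b ∈ B}, b.vars := by
    ext
    simp [Store.vars]
  rw [this]
  classical
  refine Set.Finite.biUnion ?_ fun b _ => b.vars_finite
  exact (B.toFinset.finite_toSet).subset fun c hc => by simpa using hc

theorem Builtin.holds_congr {b : Builtin L Var} {ν ν' : Var → CT.carrier}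
    (h : ∀ x ∈ b.vars, ν x = ν' x) : b.Holds CT ν ↔ b.Holds CT ν' := by
  cases b with
  | top => rfl
  | bot => rfl
  | eq s t =>
    simp only [Builtin.Holds]
    rw [realize_congr fun x hx => h x (Or.inl hx), realize_congr (t := t) fun x hx => h x (Or.inr hx)]
  | rel R ts =>
    simp only [Builtin.Holds]
    have : ∀ i, (ts i).realize ν = (ts i).realize ν' := fun i =>
      realize_congr fun x hx => h x (Set.mem_iUnion.2 ⟨i, hx⟩)
    simp [this]

theorem Store.holds_congr {B : Store L Var} {ν ν' : Var → CT.carrier}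
    (h : ∀ x ∈ B.vars, ν x = ν' x) : B.Holds CT ν ↔ B.Holds CT ν' :=
  forall₂_congr fun b hb => Builtin.holds_congr fun x hx => h x ⟨b, hb, hx⟩

theorem UserConstraint.inst_congr {M : Type w} [L.Structure M] {c : UserConstraint S L Var}
    {ν ν' : Var → M} (h : ∀ x ∈ c.vars, ν x = ν' x) : c.inst ν = c.inst ν' := by
  unfold UserConstraint.inst
  congr 1
  funext i
  exact realize_congr fun x hx => h x ⟨i, hx⟩

theorem UserConstraint.inst_mapArgs_termSubst {M : Type w} [L.Structure M] {c : UserConstraint S L Var}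
    {x : Var} {s : L.Term Var} {ν : Var → M} (h : ν x = s.realize ν) :
    (c.mapArgs (termSubst x s)).inst ν = c.inst ν := by
  simp [UserConstraint.inst, UserConstraint.mapArgs, realize_termSubst h]

theorem Goal.vars_add {G G' : Goal S L Var} : Goal.vars (G + G') = G.vars ∪ G'.vars := by
  ext x
  simp [Goal.mem_vars, or_and_right, exists_or]

theorem Store.vars_append {B B' : Store L Var} : Store.vars (B ++ B') = B.vars ∪ B'.vars := by
  ext x
  simp [Store.vars, or_and_right, exists_or]

theorem UserConstraint.mem_vars_mapArgs_relabel {f : Var → Var} {c : UserConstraint S L Var} {x : Var} :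
    x ∈ (c.mapArgs (Term.relabel f)).vars ↔ ∃ y ∈ c.vars, f y = x := by
  simp only [UserConstraint.vars, UserConstraint.mapArgs, Set.mem_ofPred_eq, mem_termVars_relabel]
  constructor
  · rintro ⟨i, y, hy, rfl⟩
    exact ⟨y, ⟨i, hy⟩, rfl⟩
  · rintro ⟨y, ⟨i, hy⟩, rfl⟩
    exact ⟨i, y, hy, rfl⟩

theorem Goal.vars_rename {f : Var → Var} {G : Goal S L Var} : (G.rename f).vars = f '' G.vars := by
  ext x
  simp only [Goal.mem_vars, Goal.rename, Multiset.mem_map, Set.mem_image]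
  constructor
  · rintro ⟨_, ⟨c, hc, rfl⟩, hx⟩
    obtain ⟨y, hy, rfl⟩ := UserConstraint.mem_vars_mapArgs_relabel.1 hx
    exact ⟨y, ⟨c, hc, hy⟩, rfl⟩
  · rintro ⟨y, ⟨c, hc, hy⟩, rfl⟩
    exact ⟨_, ⟨c, hc, rfl⟩, UserConstraint.mem_vars_mapArgs_relabel.2 ⟨y, hy, rfl⟩⟩

theorem Builtin.vars_rename {f : Var → Var} {b : Builtin L Var} : (b.rename f).vars = f '' b.vars := by
  ext x
  cases b with
  | top => simp [Builtin.rename, Builtin.vars]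
  | bot => simp [Builtin.rename, Builtin.vars]
  | eq s t =>
    simp only [Builtin.rename, Builtin.vars, Set.mem_union, mem_termVars_relabel, Set.mem_image]
    constructor
    · rintro (⟨y, h, e⟩ | ⟨y, h, e⟩)
      exacts [⟨y, Or.inl h, e⟩, ⟨y, Or.inr h, e⟩]
    · rintro ⟨y, h | h, e⟩
      exacts [Or.inl ⟨y, h, e⟩, Or.inr ⟨y, h, e⟩]
  | rel R ts =>
    simp only [Builtin.rename, Builtin.vars, Set.mem_iUnion, mem_termVars_relabel, Set.mem_image]
    constructor
    · rintro ⟨i, y, h, e⟩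
      exact ⟨y, ⟨i, h⟩, e⟩
    · rintro ⟨y, ⟨i, h⟩, e⟩
      exact ⟨i, y, h, e⟩

theorem Store.vars_rename {f : Var → Var} {B : Store L Var} :
    Store.vars (B.map (Builtin.rename f)) = f '' B.vars := by
  ext x
  simp only [Store.vars, List.mem_map, Set.mem_image, Set.mem_ofPred_eq]
  constructor
  · rintro ⟨_, ⟨b, hb, rfl⟩, hx⟩
    rw [Builtin.vars_rename] at hx
    obtain ⟨y, hy, rfl⟩ := hx
    exact ⟨y, ⟨b, hb, hy⟩, rfl⟩
  · rintro ⟨y, ⟨b, hb, hy⟩, rfl⟩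
    exact ⟨_, ⟨b, hb, rfl⟩, by rw [Builtin.vars_rename]; exact ⟨y, hy, rfl⟩⟩

theorem UserConstraint.vars_equate {c d : UserConstraint S L Var} :
    (c.equate d).vars ⊆ c.vars ∪ d.vars := by
  intro x
  unfold UserConstraint.equate
  split
  · rintro ⟨b, hb, hx⟩
    obtain ⟨i, rfl⟩ := List.mem_ofFn.1 hb
    rcases hx with hx | hx
    exacts [Or.inl ⟨_, hx⟩, Or.inr ⟨_, hx⟩]
  · rintro ⟨b, hb, hx⟩
    simp only [List.mem_singleton] at hb
    subst hb
    exact hx.elim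

end Vars

end Constraints

/-! ### Multisets as finite families. -/

section Families

variable {α : Type*}

/-- The multiset of the members of a finite family. -/
def ofFamily {ι : Type*} [Fintype ι] (g : ι → α) : Multiset α :=
  (Finset.univ : Finset ι).val.map g

theorem mem_ofFamily {ι : Type*} [Fintype ι] {g : ι → α} {a : α} : a ∈ ofFamily g ↔ ∃ i, g i = a := by
  simp [ofFamily]

theorem exists_ofFamily_eq (m : Multiset α) : ∃ (n : ℕ) (g : Fin n → α), ofFamily g = m := by
  induction m using Quotient.inductionOn with
  | h l =>
    refine ⟨l.length, l.get, ?_⟩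
    simp [ofFamily, Fin.univ_def]

theorem ofFamily_sumElim {ι κ : Type*} [Fintype ι] [Fintype κ] (g : ι → α) (h : κ → α) :
    ofFamily (Sum.elim g h) = ofFamily g + ofFamily h := by
  unfold ofFamily
  rw [← Finset.univ_disjSum_univ, Finset.val_disjSum, Multiset.disjSum, Multiset.map_add,
    Multiset.map_map, Multiset.map_map]
  rfl

theorem ofFamily_comp_equiv {ι κ : Type*} [Fintype ι] [Fintype κ] (e : κ ≃ ι) (g : ι → α) :
    ofFamily (g ∘ e) = ofFamily g := by
  unfold ofFamily
  rw [← Multiset.map_map, Multiset.map_univ_val_equiv]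

theorem map_ofFamily {β : Type*} {ι : Type*} [Fintype ι] (f : α → β) (g : ι → α) :
    (ofFamily g).map f = ofFamily (f ∘ g) := by
  simp [ofFamily]

/-- For each value the fibres of both families have the multiplicity of that value as cardinality;
bijections of the fibres are glued. -/
theorem exists_equiv_of_ofFamily_eq {ι κ : Type*} [Fintype ι] [Fintype κ] {g : ι → α} {h : κ → α}
    (hgh : ofFamily g = ofFamily h) : ∃ e : ι ≃ κ, h ∘ e = g := by
  classical
  have key : ∀ a, Nonempty ({i // g i = a} ≃ {k // h k = a}) := fun a => by
    rw [← Fintype.card_eq]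
    have := congrArg (Multiset.count a) hgh
    simp only [ofFamily, Multiset.count_map] at this
    rw [Fintype.card_subtype, Fintype.card_subtype]
    simpa [Finset.card, eq_comm] using this
  exact ⟨Equiv.ofFiberEquiv fun a => (key a).some, funext fun i => Equiv.ofFiberEquiv_map _ i⟩

/-- A submultiset of a family is carried by an injection of index types. -/
theorem exists_embedding_of_ofFamily_eq_add {ι κ : Type*} [Fintype ι] [Fintype κ] {g : ι → α}
    {h : κ → α} {m : Multiset α} (hgh : ofFamily g = ofFamily h + m) :
    ∃ e : κ ↪ ι, ∀ k, g (e k) = h k := by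
  obtain ⟨n, h', rfl⟩ := exists_ofFamily_eq m
  rw [← ofFamily_sumElim] at hgh
  obtain ⟨e, he⟩ := exists_equiv_of_ofFamily_eq hgh.symm
  exact ⟨Function.Embedding.inl.trans e.toEmbedding, fun k => congrFun he (Sum.inl k)⟩

end Families

/-! ### Semantic equivalence of states and soundness. -/

section Semantics

open FirstOrder.Language

variable {L : FirstOrder.Language.{u, v}} {Var : Type z} {CT : ConstraintTheory.{u, v, w} L}
  {S : UserSignature}

/-- The family of ground instances `x` and the valuation `μ` of the variables `V` are realized by
a solution of the store `B`. -/
def Denotes (CT : ConstraintTheory.{u, v, w} L) {ι : Type*} (g : ι → UserConstraint S L Var)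
    (B : Store L Var) (V : Finset Var) (μ : Var → CT.carrier)
    (x : ι → GroundConstraint S CT.carrier) : Prop :=
  ∃ ν : Var → CT.carrier, B.Holds CT ν ∧ (∀ y ∈ V, ν y = μ y) ∧ ∀ i, (g i).inst ν = x i

/-- A satisfiable conjunction of built-in constraints. -/
def Store.Sat (CT : ConstraintTheory.{u, v, w} L) (B : Store L Var) : Prop :=
  ∃ ν : Var → CT.carrier, B.Holds CT ν

/-- Semantic equivalence of states: the stores of both are unsatisfiable, or the goals can be
listed such that both states have the same ground instances. -/
def SemEquiv (CT : ConstraintTheory.{u, v, w} L) (σ τ : CHRState S L Var) : Prop :=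
  (¬ σ.store.Sat CT ∧ ¬ τ.store.Sat CT) ∨
    ∃ (ι : Type) (_ : Fintype ι) (g g' : ι → UserConstraint S L Var),
      ofFamily g = σ.goal ∧ ofFamily g' = τ.goal ∧
        ∀ μ x, Denotes CT g σ.store σ.globals μ x ↔ Denotes CT g' τ.store τ.globals μ x

theorem Denotes.sat {ι : Type*} {g : ι → UserConstraint S L Var} {B : Store L Var} {V : Finset Var}
    {μ : Var → CT.carrier} {x : ι → GroundConstraint S CT.carrier} (h : Denotes CT g B V μ x) :
    B.Sat CT :=
  h.imp fun _ hν => hν.1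

theorem denotes_self {ι : Type*} {g : ι → UserConstraint S L Var} {B : Store L Var} {V : Finset Var}
    {ν : Var → CT.carrier} (h : B.Holds CT ν) : Denotes CT g B V ν fun i => (g i).inst ν :=
  ⟨ν, h, fun _ _ => rfl, fun _ => rfl⟩

theorem denotes_comp_equiv {ι κ : Type*} (e : κ ≃ ι) {g : ι → UserConstraint S L Var}
    {B : Store L Var} {V : Finset Var} {μ : Var → CT.carrier} {x : κ → GroundConstraint S CT.carrier} :
    Denotes CT (g ∘ e) B V μ x ↔ Denotes CT g B V μ (x ∘ e.symm) := by
  refine exists_congr fun ν => and_congr_right fun _ => and_congr_right fun _ => ?_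
  constructor
  · intro h i
    simpa using h (e.symm i)
  · intro h k
    simpa using h (e k)

theorem SemEquiv.refl (σ : CHRState S L Var) : SemEquiv CT σ σ := by
  obtain ⟨n, g, hg⟩ := exists_ofFamily_eq σ.goal
  exact Or.inr ⟨Fin n, inferInstance, g, g, hg, hg, fun _ _ => Iff.rfl⟩

theorem SemEquiv.symm {σ τ : CHRState S L Var} (h : SemEquiv CT σ τ) : SemEquiv CT τ σ := by
  rcases h with h | ⟨ι, hι, g, g', hg, hg', h⟩
  · exact Or.inl h.symm
  · exact Or.inr ⟨ι, hι, g', g, hg', hg, fun μ x => (h μ x).symm⟩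

theorem SemEquiv.sat_iff {σ τ : CHRState S L Var} (h : SemEquiv CT σ τ) :
    σ.store.Sat CT ↔ τ.store.Sat CT := by
  rcases h with ⟨h, h'⟩ | ⟨ι, hι, g, g', hg, hg', h⟩
  · exact iff_of_false h h'
  · exact ⟨fun ⟨ν, hν⟩ => ((h _ _).1 (denotes_self hν)).sat,
      fun ⟨ν, hν⟩ => ((h _ _).2 (denotes_self hν)).sat⟩

/-- The listing of the goal of the left state can be chosen. -/
theorem SemEquiv.exists_family {σ τ : CHRState S L Var} (h : SemEquiv CT σ τ) (hσ : σ.store.Sat CT)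
    {ι : Type*} [Fintype ι] {g : ι → UserConstraint S L Var} (hg : ofFamily g = σ.goal) :
    ∃ g' : ι → UserConstraint S L Var, ofFamily g' = τ.goal ∧
      ∀ μ x, Denotes CT g σ.store σ.globals μ x ↔ Denotes CT g' τ.store τ.globals μ x := by
  rcases h with ⟨h, _⟩ | ⟨κ, hκ, k, k', hk, hk', h⟩
  · exact absurd hσ h
  · obtain ⟨e, rfl⟩ := exists_equiv_of_ofFamily_eq (hg.trans hk.symm)
    exact ⟨k' ∘ e, (ofFamily_comp_equiv e k').trans hk', fun μ x => by
      rw [denotes_comp_equiv, denotes_comp_equiv, h]⟩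

theorem SemEquiv.of_denotes {ι : Type} [Fintype ι] {g g' : ι → UserConstraint S L Var}
    {B B' : Store L Var} {V V' : Finset Var}
    (h : ∀ μ x, Denotes CT g B V μ x ↔ Denotes CT g' B' V' μ x) :
    SemEquiv CT ⟨ofFamily g, B, V⟩ ⟨ofFamily g', B', V'⟩ :=
  Or.inr ⟨ι, inferInstance, g, g', rfl, rfl, h⟩

/-- The two equivalences may list the middle goal differently; `SemEquiv.exists_family` realigns the
second one with the first. -/
theorem SemEquiv.trans {σ τ ρ : CHRState S L Var} (h : SemEquiv CT σ τ) (h' : SemEquiv CT τ ρ) :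
    SemEquiv CT σ ρ := by
  by_cases hσ : σ.store.Sat CT
  · obtain ⟨n, g, hg⟩ := exists_ofFamily_eq σ.goal
    obtain ⟨g', hg', e⟩ := h.exists_family hσ hg
    obtain ⟨g'', hg'', e'⟩ := h'.exists_family (h.sat_iff.1 hσ) hg'
    exact Or.inr ⟨Fin n, inferInstance, g, g'', hg, hg'', fun μ x => (e μ x).trans (e' μ x)⟩
  · exact Or.inl ⟨hσ, by rwa [← h'.sat_iff, ← h.sat_iff]⟩

variable [DecidableEq Var]

theorem mem_vars_ofFamily {ι : Type*} [Fintype ι] {g : ι → UserConstraint S L Var} {x : Var} :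
    x ∈ Goal.vars (ofFamily g) ↔ ∃ i, x ∈ (g i).vars := by
  simp only [Goal.mem_vars, mem_ofFamily]
  constructor
  · rintro ⟨_, ⟨i, rfl⟩, h⟩
    exact ⟨i, h⟩
  · rintro ⟨i, h⟩
    exact ⟨_, ⟨i, rfl⟩, h⟩

/-- Under `x = t` a substitution does not change values. In `ct`, a solution that agrees on the
globals and on the variables of the goal gives the same instances. An omitted global occurs nowhere,
so its value can be reset at will. In `fail` both stores are unsatisfiable. -/
theorem EquivStep.semEquiv {σ τ : CHRState S L Var} (h : EquivStep CT σ τ) : SemEquiv CT σ τ := by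
  cases h with
  | subst G x t B V =>
    obtain ⟨n, g, rfl⟩ := exists_ofFamily_eq G
    rw [Goal.subst, map_ofFamily]
    refine .of_denotes fun μ y => exists_congr fun ν => and_congr_right fun hν =>
      and_congr_right fun _ => forall_congr' fun i => ?_
    rw [Function.comp, UserConstraint.inst_mapArgs_termSubst]
    simpa [Builtin.Holds] using (Store.holds_cons.1 hν).1
  | ct G B B' V h =>
    obtain ⟨n, g, rfl⟩ := exists_ofFamily_eq G
    have key : ∀ B B' : Store L Var, (∀ ν : Var → CT.carrier,
        (∃ ν' : Var → CT.carrier, (∀ x, x ∈ V ∨ x ∈ Goal.vars (ofFamily g) → ν' x = ν x) ∧ B.Holds CT ν') →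
        (∃ ν' : Var → CT.carrier, (∀ x, x ∈ V ∨ x ∈ Goal.vars (ofFamily g) → ν' x = ν x) ∧ B'.Holds CT ν')) →
        ∀ μ x, Denotes CT g B V μ x → Denotes CT g B' V μ x := by
      rintro B B' h μ x ⟨ν, hB, hV, hg⟩
      obtain ⟨ν', h1, h2⟩ := h ν ⟨ν, fun _ _ => rfl, hB⟩
      refine ⟨ν', h2, fun y hy => (h1 y (Or.inl hy)).trans (hV y hy), fun i => ?_⟩
      rw [← hg i]
      exact UserConstraint.inst_congr fun y hy => h1 y (Or.inr (mem_vars_ofFamily.2 ⟨i, hy⟩))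
    exact .of_denotes fun μ x => ⟨key B B' (fun ν => (h ν).1) μ x, key B' B (fun ν => (h ν).2) μ x⟩
  | omit_global G B V X hG hB =>
    obtain ⟨n, g, rfl⟩ := exists_ofFamily_eq G
    refine .of_denotes fun μ x => ⟨fun ⟨ν, h1, h2, h3⟩ =>
      ⟨ν, h1, fun y hy => h2 y (Finset.mem_insert_of_mem hy), h3⟩, fun ⟨ν, h1, h2, h3⟩ =>
      ⟨Function.update ν X (μ X), ?_, fun y hy => ?_, fun i => ?_⟩⟩
    · refine (Store.holds_congr fun y hy => ?_).1 h1
      rw [Function.update_of_ne]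
      rintro rfl
      exact hB hy
    · by_cases hyX : y = X
      · simp [hyX]
      · rw [Function.update_of_ne hyX]
        exact h2 y (Finset.mem_of_mem_insert_of_ne hy hyX)
    · rw [← h3 i]
      refine UserConstraint.inst_congr fun y hy => ?_
      rw [Function.update_of_ne]
      rintro rfl
      exact hG (mem_vars_ofFamily.2 ⟨i, hy⟩)
  | fail G G' V =>
    exact Or.inl ⟨fun ⟨ν, hν⟩ => hν _ (List.mem_singleton_self _),
      fun ⟨ν, hν⟩ => hν _ (List.mem_singleton_self _)⟩

theorem StateEquiv.semEquiv {σ τ : CHRState S L Var} (h : StateEquiv CT σ τ) : SemEquiv CT σ τ := by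
  induction h with
  | rel _ _ h => exact h.semEquiv
  | refl _ => exact .refl _
  | symm _ _ _ ih => exact ih.symm
  | trans _ _ _ _ _ ih ih' => exact ih.trans ih'

end Semantics

/-! ### Fresh variables. -/

section FreshVariables

/-- A permutation, rather than a mere renaming of `S`, is needed: it maps copies of rules to copies,
and its inverse transports solutions back. -/
theorem exists_perm_avoiding {Var : Type z} [Infinite Var] {S F V : Set Var} (hS : S.Finite)
    (hF : F.Finite) (hV : V.Finite) :
    ∃ f : Equiv.Perm Var, (∀ x ∈ S, x ∉ V → f x ∉ F) ∧ ∀ x ∈ V, f x = x := by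
  classical
  suffices key : ∀ S F V : Finset Var, Disjoint S V →
      ∃ f : Equiv.Perm Var, (∀ x ∈ S, f x ∉ F) ∧ ∀ x ∈ V, f x = x by
    obtain ⟨f, hf, hf'⟩ := key (hS.toFinset \ hV.toFinset) hF.toFinset hV.toFinset
      Finset.sdiff_disjoint
    exact ⟨f, fun x hx hxV => by simpa using hf x (by simp [hx, hxV]), fun x hx => hf' x (by simpa)⟩
  intro S
  induction S using Finset.induction_on with
  | empty => exact fun F V _ => ⟨1, by simp, by simp⟩
  | insert a S ha ih =>
    intro F V hd
    rw [Finset.disjoint_insert_left] at hd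
    obtain ⟨b, hb⟩ := Infinite.exists_notMem_finset (insert a (S ∪ F ∪ V))
    simp only [Finset.mem_insert, Finset.mem_union, not_or] at hb
    -- With `b` among the fixed variables, `a` goes to `b` under the swap and then stays there.
    obtain ⟨f, hf, hf'⟩ := ih F (insert b V) (Finset.disjoint_insert_right.2 ⟨hb.2.1.1, hd.2⟩)
    refine ⟨(Equiv.swap a b).trans f, fun x hx => ?_, fun x hx => ?_⟩
    · rcases Finset.mem_insert.1 hx with rfl | hx
      · simpa [hf' b (Finset.mem_insert_self _ _)] using hb.2.1.2
      · have h1 : x ≠ a := fun e => ha (e ▸ hx)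
        have h2 : x ≠ b := fun e => hb.2.1.1 (e ▸ hx)
        simpa [Equiv.swap_apply_of_ne_of_ne h1 h2] using hf x hx
    · have h1 : x ≠ a := fun e => hd.1 (e ▸ hx)
      have h2 : x ≠ b := fun e => hb.2.2 (e ▸ hx)
      simpa [Equiv.swap_apply_of_ne_of_ne h1 h2] using hf' x (Finset.mem_insert_of_mem hx)

theorem exists_embedding_avoiding {Var : Type z} [Infinite Var] (P : Type*) [Finite P] {F : Set Var}
    (hF : F.Finite) : ∃ y : P ↪ Var, ∀ p, y p ∉ F := by
  have : Infinite ↥(Fᶜ) := hF.infinite_compl.to_subtype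
  obtain ⟨e⟩ : Nonempty (P ↪ ↥(Fᶜ)) := by
    cases nonempty_fintype P
    exact ⟨(Fintype.equivFin P).toEmbedding.trans (Fin.valEmbedding.trans (Infinite.natEmbedding _))⟩
  exact ⟨e.trans (Function.Embedding.subtype _), fun p => (e p).2⟩

end FreshVariables

/-! ### Semantic equivalence implies state equivalence. -/

section Completeness

open FirstOrder.Language

variable {L : FirstOrder.Language.{u, v}} {Var : Type z} [DecidableEq Var]
  {CT : ConstraintTheory.{u, v, w} L} {S : UserSignature}

theorem StateEquiv.refl (σ : CHRState S L Var) : StateEquiv CT σ σ :=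
  Relation.EqvGen.refl σ

theorem StateEquiv.symm {σ τ : CHRState S L Var} (h : StateEquiv CT σ τ) : StateEquiv CT τ σ :=
  Relation.EqvGen.symm _ _ h

theorem StateEquiv.trans {σ τ ρ : CHRState S L Var} (h : StateEquiv CT σ τ) (h' : StateEquiv CT τ ρ) :
    StateEquiv CT σ ρ :=
  Relation.EqvGen.trans _ _ _ h h'

theorem EquivStep.stateEquiv {σ τ : CHRState S L Var} (h : EquivStep CT σ τ) : StateEquiv CT σ τ :=
  Relation.EqvGen.rel _ _ h

theorem StateEquiv.of_store {G : Goal S L Var} {B B' : Store L Var} {V : Finset Var}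
    (h : ∀ ν : Var → CT.carrier, B.Holds CT ν ↔ B'.Holds CT ν) :
    StateEquiv CT (⟨G, B, V⟩ : CHRState S L Var) ⟨G, B', V⟩ :=
  EquivStep.stateEquiv (.ct _ _ _ _ fun ν => by simp only [h])

/-- An entailed equation can be added to the store, used for the substitution, and removed again. -/
theorem StateEquiv.subst_of_entails {G : Goal S L Var} {B : Store L Var} {V : Finset Var} {x : Var}
    {t : L.Term Var} (h : ∀ ν : Var → CT.carrier, B.Holds CT ν → ν x = t.realize ν) :
    StateEquiv CT (⟨G, B, V⟩ : CHRState S L Var) ⟨G.subst x t, B, V⟩ := by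
  have hB : ∀ ν : Var → CT.carrier,
      B.Holds CT ν ↔ Store.Holds CT ν (Builtin.eq (Term.var x) t :: B) := fun ν => by
    simpa [Builtin.Holds] using h ν
  exact (StateEquiv.of_store hB).trans ((EquivStep.stateEquiv (.subst _ _ _ _ _)).trans
    (StateEquiv.of_store fun ν => (hB ν).symm))

/-- Every unsatisfiable state reduces to the empty goal with store `⊥` and no globals: `fail`
discards the goal, after which every global is redundant. -/
theorem StateEquiv.of_not_sat {σ τ : CHRState S L Var} (hσ : ¬ σ.store.Sat CT) (hτ : ¬ τ.store.Sat CT) :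
    StateEquiv CT σ τ := by
  have bot : ∀ ν : Var → CT.carrier, ¬ Store.Holds CT ν ([Builtin.bot] : Store L Var) :=
    fun ν hν => hν _ (List.mem_singleton_self _)
  have key : ∀ σ : CHRState S L Var, ¬ σ.store.Sat CT → StateEquiv CT σ ⟨0, [Builtin.bot], ∅⟩ := by
    rintro ⟨G, B, V⟩ h
    refine (StateEquiv.of_store fun ν => iff_of_false (fun hν => h ⟨ν, hν⟩) (bot ν)).trans ?_
    refine (EquivStep.stateEquiv (.fail G 0 V)).trans ?_
    clear h
    induction V using Finset.induction_on with
    | empty => exact .refl _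
    | insert X V _ ih =>
      refine (EquivStep.stateEquiv (.omit_global _ _ _ X ?_ ?_)).trans ih
      · rintro ⟨c, hc, _⟩
        simp at hc
      · rintro ⟨b, hb, hx⟩
        rw [List.mem_singleton] at hb
        subst hb
        exact hx
  exact (key σ hσ).trans ((key τ hτ).symm)

theorem StateEquiv.union_globals {G : Goal S L Var} {B : Store L Var} {V : Finset Var} (W : Finset Var)
    (h : ∀ x ∈ W, x ∉ V → x ∉ G.vars ∧ x ∉ B.vars) :
    StateEquiv CT (⟨G, B, V⟩ : CHRState S L Var) ⟨G, B, V ∪ W⟩ := by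
  induction W using Finset.induction_on with
  | empty => simpa using StateEquiv.refl (CT := CT) _
  | insert X W _ ih =>
    refine (ih fun x hx => h x (Finset.mem_insert_of_mem hx)).trans ?_
    by_cases hX : X ∈ V
    · rw [show V ∪ insert X W = V ∪ W by ext; simp; aesop]
      exact .refl _
    · have := h X (Finset.mem_insert_self _ _) hX
      rw [Finset.union_insert]
      exact (EquivStep.stateEquiv (.omit_global _ _ _ X this.1 this.2)).symm

/-- The argument terms of the positions in a finite set are abstracted to variables. -/
theorem StateEquiv.abstract_args {ι : Type} [Fintype ι] (s : ι → S.Sym)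
    (a : ∀ i, Fin (S.arity (s i)) → L.Term Var) (y : (Σ i, Fin (S.arity (s i))) ↪ Var)
    {B : Store L Var} {V : Finset Var} (hy : ∀ p i k, y p ∉ termVars (a i k))
    (hB : ∀ ν : Var → CT.carrier, B.Holds CT ν → ∀ i k, ν (y ⟨i, k⟩) = (a i k).realize ν) :
    StateEquiv CT
      (⟨ofFamily fun i => ⟨s i, fun k => Term.var (y ⟨i, k⟩)⟩, B, V⟩ : CHRState S L Var)
      ⟨ofFamily fun i => ⟨s i, a i⟩, B, V⟩ := by
  classical
  suffices key : ∀ T : Finset (Σ i, Fin (S.arity (s i))), StateEquiv CT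
      (⟨ofFamily fun i => ⟨s i, fun k => Term.var (y ⟨i, k⟩)⟩, B, V⟩ : CHRState S L Var)
      ⟨ofFamily fun i => ⟨s i, fun k => if ⟨i, k⟩ ∈ T then a i k else Term.var (y ⟨i, k⟩)⟩, B, V⟩ by
    simpa using key Finset.univ
  intro T
  induction T using Finset.induction_on with
  | empty => simpa using StateEquiv.refl (CT := CT) _
  | insert q T hq ih =>
    refine ih.trans ?_
    -- Each position costs one substitution for `y q`. By `hy` the arguments inserted earlier do not
    -- contain `y q`, and by injectivity of `y` no other position does.
    convert StateEquiv.subst_of_entails (x := y q) (t := a q.1 q.2) (V := V)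
      (G := ofFamily fun i => ⟨s i, fun k => if ⟨i, k⟩ ∈ T then a i k else Term.var (y ⟨i, k⟩)⟩)
      fun ν hν => hB ν hν q.1 q.2 using 2
    rw [Goal.subst, map_ofFamily]
    congr 1
    funext i
    simp only [Function.comp, UserConstraint.mapArgs]
    congr 1
    funext k
    by_cases hT : (⟨i, k⟩ : Σ i, Fin (S.arity (s i))) ∈ T
    · simp [hT, termSubst_of_notMem (hy q i k)]
    · by_cases hiq : (⟨i, k⟩ : Σ i, Fin (S.arity (s i))) = q
      · subst hiq
        simp [hT, termSubst, Term.subst]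
      · have : y q ∉ termVars (Term.var (y ⟨i, k⟩) : L.Term Var) := by
          rw [termVars_var]
          exact fun e => hiq (y.injective (Eq.symm e))
        simp [hT, hiq, termSubst_of_notMem this]

variable [Infinite Var]

/-- The canonical form of a state: the goal has distinct variables as arguments, and the store
expresses the ground instances of the state. -/
theorem StateEquiv.exists_flat {ι : Type} [Fintype ι] (s : ι → S.Sym)
    (a : ∀ i, Fin (S.arity (s i)) → L.Term Var) (y : (Σ i, Fin (S.arity (s i))) ↪ Var)
    (B : Store L Var) (V W : Finset Var) (hyV : ∀ p, y p ∉ V) (hyW : ∀ p, y p ∉ W)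
    (hyB : ∀ p, y p ∉ B.vars) (hya : ∀ p i k, y p ∉ termVars (a i k)) :
    ∃ B' : Store L Var, StateEquiv CT (⟨ofFamily fun i => ⟨s i, a i⟩, B, V⟩ : CHRState S L Var)
        ⟨ofFamily fun i => ⟨s i, fun k => Term.var (y ⟨i, k⟩)⟩, B', V ∪ W⟩ ∧
      ∀ ν : Var → CT.carrier,
        (∃ ν' : Var → CT.carrier, (∀ x, x ∈ V ∪ W ∨ x ∈ Set.range y → ν' x = ν x) ∧ B'.Holds CT ν') ↔
          Denotes CT (fun i => (⟨s i, a i⟩ : UserConstraint S L Var)) B V ν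
            fun i => ⟨s i, fun k => ν (y ⟨i, k⟩)⟩ := by
  classical
  -- `Q` defines the new argument variables. The rename `f` below moves the store's local variables
  -- away from `W`, so that `W` can afterwards be made global without capture.
  set Q : Store L Var := (Finset.univ : Finset (Σ i, Fin (S.arity (s i)))).toList.map
    (fun p => Builtin.eq (Term.var (y p)) (a p.1 p.2)) with hQ
  have hQh : ∀ ν : Var → CT.carrier, Q.Holds CT ν ↔ ∀ i k, ν (y ⟨i, k⟩) = (a i k).realize ν := by
    intro ν
    simp only [hQ, Store.Holds, List.forall_mem_map, Finset.mem_toList, Finset.mem_univ, true_imp_iff,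
      Sigma.forall]
    rfl
  set Y : Goal S L Var := ofFamily fun i => ⟨s i, fun k => Term.var (y ⟨i, k⟩)⟩ with hY
  have hYv : ∀ x, x ∈ Y.vars ↔ x ∈ Set.range y := by
    intro x
    simp only [hY, mem_vars_ofFamily, UserConstraint.vars, Set.mem_ofPred_eq, termVars_var,
      Set.mem_singleton_iff, Set.mem_range, Sigma.exists, eq_comm]
  obtain ⟨f, hf, hf'⟩ := exists_perm_avoiding (S := Store.vars (Q ++ B)) (F := ↑(V ∪ W) ∪ Set.range y)
    (V := ↑V ∪ Set.range y) (Store.vars_finite _) ((Finset.finite_toSet _).union (Set.finite_range _))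
    ((Finset.finite_toSet _).union (Set.finite_range _))
  have hfV : ∀ x ∈ V, f x = x := fun x hx => hf' x (Or.inl hx)
  have hfy : ∀ p, f (y p) = y p := fun p => hf' _ (Or.inr ⟨p, rfl⟩)
  refine ⟨(Q ++ B).map (Builtin.rename f), ?_, fun ν => ⟨?_, ?_⟩⟩
  · have h1 : StateEquiv CT (⟨ofFamily fun i => ⟨s i, a i⟩, B, V⟩ : CHRState S L Var)
        ⟨ofFamily fun i => ⟨s i, a i⟩, Q ++ B, V⟩ := by
      -- The variables `y p` are still strictly local here, so `Q` can always be satisfied by giving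
      -- each of them the value of its term.
      refine EquivStep.stateEquiv (.ct _ _ _ _ fun ν => ⟨?_, ?_⟩)
      · rintro ⟨ν', h, hB⟩
        have hext : ∀ x, (∀ p, y p ≠ x) →
            (fun x => if h : ∃ p, y p = x then (a h.choose.1 h.choose.2).realize ν' else ν' x) x = ν' x :=
          fun x hx => dif_neg fun ⟨p, hp⟩ => hx p hp
        refine ⟨fun x => if h : ∃ p, y p = x then (a h.choose.1 h.choose.2).realize ν' else ν' x,
          fun x hx => ?_, ?_⟩
        · rw [hext, h x hx]
          rintro p rfl
          rcases hx with hx | hx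
          · exact hyV p hx
          · obtain ⟨i, k, hk⟩ := mem_vars_ofFamily.1 hx
            exact hya p i k hk
        · rw [Store.holds_append, hQh]
          constructor
          · intro i k
            have hex : ∃ p, y p = y ⟨i, k⟩ := ⟨_, rfl⟩
            have hch : hex.choose = ⟨i, k⟩ := y.injective hex.choose_spec
            rw [dif_pos hex, hch]
            refine realize_congr fun x hx => (hext x ?_).symm
            rintro p rfl
            exact hya _ _ _ hx
          · refine (Store.holds_congr fun x hx => (hext x ?_).symm).1 hB
            rintro p rfl
            exact hyB _ hx
      · rintro ⟨ν', h, hB⟩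
        exact ⟨ν', h, (Store.holds_append.1 hB).2⟩
    have h2 : StateEquiv CT (⟨Y, Q ++ B, V⟩ : CHRState S L Var)
        ⟨ofFamily fun i => ⟨s i, a i⟩, Q ++ B, V⟩ :=
      StateEquiv.abstract_args s a y hya fun ν hν => (hQh ν).1 (Store.holds_append.1 hν).1
    have h3 : StateEquiv CT (⟨Y, Q ++ B, V⟩ : CHRState S L Var)
        ⟨Y, (Q ++ B).map (Builtin.rename f), V⟩ := by
      have hfix : ∀ x, x ∈ V ∨ x ∈ Y.vars → f x = x := fun x hx =>
        hf' x (hx.imp id (hYv x).1)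
      refine EquivStep.stateEquiv (.ct _ _ _ _ fun ν => ⟨?_, ?_⟩)
      · rintro ⟨ν', h, hB⟩
        refine ⟨ν' ∘ f.symm, fun x hx => ?_, ?_⟩
        · rw [← h x hx, Function.comp, f.symm_apply_eq.2 (hfix x hx).symm]
        · rw [Store.holds_rename]
          simpa [Function.comp_def] using hB
      · rintro ⟨ν', h, hB⟩
        refine ⟨ν' ∘ f, fun x hx => ?_, Store.holds_rename.1 hB⟩
        rw [← h x hx, Function.comp, hfix x hx]
    refine h1.trans ((h2.symm).trans (h3.trans (.union_globals W ?_)))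
    intro x hxW hxV
    have hxy : x ∉ Set.range y := by
      rintro ⟨p, rfl⟩
      exact hyW p hxW
    refine ⟨fun h => hxy ((hYv x).1 h), ?_⟩
    rw [Store.vars_rename]
    rintro ⟨z, hz, rfl⟩
    by_cases hzV : z ∈ (↑V ∪ Set.range y : Set Var)
    · rw [hf' z hzV] at hxV hxy
      rcases hzV with h | h
      exacts [hxV h, hxy h]
    · exact hf z hz hzV (Or.inl (by simp [hxW]))
  · rintro ⟨ν', h, hB⟩
    rw [Store.holds_rename, Store.holds_append, hQh] at hB
    refine ⟨ν' ∘ f, hB.2, fun x hx => ?_, fun i => ?_⟩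
    · rw [Function.comp, hfV x hx, h x (Or.inl (Finset.mem_union_left _ hx))]
    · simp only [UserConstraint.inst]
      congr 1
      funext k
      rw [← hB.1, Function.comp, hfy, h _ (Or.inr ⟨_, rfl⟩)]
  · rintro ⟨ν₁, hB, hV, hi⟩
    have hi' : ∀ i k, (a i k).realize ν₁ = ν (y ⟨i, k⟩) := fun i k => by
      have := hi i
      simp only [UserConstraint.inst, Sigma.mk.injEq, heq_eq_eq, true_and] at this
      exact congrFun this k
    -- Visible variables take their prescribed values, and renamed local ones the values they had in
    -- `ν₁` before renaming.
    set ν' : Var → CT.carrier := fun x => if x ∈ V ∪ W ∨ x ∈ Set.range y then ν x else ν₁ (f.symm x)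
      with hν'
    have hy' : ∀ p, ν' (f (y p)) = ν (y p) := fun p => by
      rw [hfy]
      exact if_pos (Or.inr ⟨p, rfl⟩)
    have hagree : ∀ x, x ∈ Store.vars (Q ++ B) → x ∉ Set.range y → ν' (f x) = ν₁ x := by
      intro x hx hxy
      by_cases hxV : x ∈ V
      · rw [hfV x hxV, hV x hxV]
        exact if_pos (Or.inl (Finset.mem_union_left _ hxV))
      · have hn := hf x hx (by rintro (h | h); exacts [hxV h, hxy h])
        have : ¬ (f x ∈ V ∪ W ∨ f x ∈ Set.range y) := hn
        rw [hν']
        simp only [if_neg this, f.symm_apply_apply]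
    refine ⟨ν', fun x hx => if_pos hx, ?_⟩
    rw [Store.holds_rename, Store.holds_append, hQh]
    constructor
    · intro i k
      rw [Function.comp, hy', ← hi' i k]
      refine realize_congr fun x hx => (hagree x ?_ ?_).symm
      · rw [Store.vars_append]
        refine Or.inl ⟨_, List.mem_map.2 ⟨⟨i, k⟩, by simp, rfl⟩, Or.inr hx⟩
      · rintro ⟨p, rfl⟩
        exact hya _ _ _ hx
    · refine (Store.holds_congr fun x hx => (hagree x ?_ ?_).symm).1 hB
      · rw [Store.vars_append]
        exact Or.inr hx
      · rintro ⟨p, rfl⟩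
        exact hyB _ hx

/-- Both states have flat forms over the same fresh `y` and with globals `V ∪ V'`. The stores of
these forms have equal projections to the visible variables, because both projections describe the
common denotation; so one `ct` step connects them. -/
theorem SemEquiv.stateEquiv {σ τ : CHRState S L Var} (h : SemEquiv CT σ τ) : StateEquiv CT σ τ := by
  by_cases hσ : σ.store.Sat CT
  · rcases h with ⟨h, _⟩ | ⟨ι, hι, g, g', hg, hg', h⟩
    · exact absurd hσ h
    obtain ⟨G, B, V⟩ := σ
    obtain ⟨G', B', V'⟩ := τ
    dsimp only at hg hg' h hσ
    subst hg hg'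
    obtain ⟨ν, hν⟩ := hσ
    -- Parallel constraints share an instance because there is a solution; hence their symbols agree
    -- and one flat goal serves both states.
    have hsym : ∀ i, (g' i).sym = (g i).sym := fun i => by
      obtain ⟨ν', _, _, hi⟩ := (h _ _).1 (denotes_self hν)
      exact congrArg Sigma.fst (hi i)
    have hex : ∀ i, ∃ a : Fin (S.arity (g i).sym) → L.Term Var, g' i = ⟨(g i).sym, a⟩ := by
      intro i
      rw [← hsym i]
      exact ⟨_, rfl⟩
    choose a' ha' using hex
    obtain rfl : g' = fun i => ⟨(g i).sym, a' i⟩ := funext ha'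
    obtain ⟨y, hy⟩ := exists_embedding_avoiding (Σ i, Fin (S.arity (g i).sym))
      (F := ↑(V ∪ V') ∪ (B.vars ∪ B'.vars) ∪ (Goal.vars (ofFamily g) ∪
        Goal.vars (ofFamily fun i => (⟨(g i).sym, a' i⟩ : UserConstraint S L Var))))
      (((Finset.finite_toSet _).union ((Store.vars_finite _).union (Store.vars_finite _))).union
        ((Goal.vars_finite _).union (Goal.vars_finite _)))
    simp only [Set.mem_union, Finset.mem_coe, Finset.mem_union, not_or, mem_vars_ofFamily, not_exists,
      UserConstraint.vars, Set.mem_ofPred_eq] at hy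
    obtain ⟨C, hC, hC'⟩ := StateEquiv.exists_flat (CT := CT) (fun i => (g i).sym) (fun i => (g i).args) y B V V'
      (fun p => (hy p).1.1.1) (fun p => (hy p).1.1.2) (fun p => (hy p).1.2.1) (fun p => (hy p).2.1)
    obtain ⟨D, hD, hD'⟩ := StateEquiv.exists_flat (CT := CT) (fun i => (g i).sym) a' y B' V' V
      (fun p => (hy p).1.1.2) (fun p => (hy p).1.1.1) (fun p => (hy p).1.2.2) (fun p => (hy p).2.2)
    rw [Finset.union_comm] at hD
    refine hC.trans (StateEquiv.trans (EquivStep.stateEquiv (.ct _ _ _ _ fun ν => ?_)) (hD.symm))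
    have hv : ∀ x, x ∈ Goal.vars (ofFamily fun i => (⟨(g i).sym, fun k => Term.var (y ⟨i, k⟩)⟩ :
        UserConstraint S L Var)) ↔ x ∈ Set.range y := by
      intro x
      simp only [mem_vars_ofFamily, UserConstraint.vars, Set.mem_ofPred_eq, termVars_var,
        Set.mem_singleton_iff, Set.mem_range, Sigma.exists, eq_comm]
    simp only [hv]
    rw [hC', h, ← hD', Finset.union_comm]
  · exact .of_not_sat hσ (by rwa [← h.sat_iff])

theorem stateEquiv_iff_semEquiv {σ τ : CHRState S L Var} : StateEquiv CT σ τ ↔ SemEquiv CT σ τ :=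
  ⟨StateEquiv.semEquiv, SemEquiv.stateEquiv⟩

theorem cls_eq_cls_iff {σ τ : CHRState S L Var} : σ.cls CT = τ.cls CT ↔ SemEquiv CT σ τ := by
  rw [← stateEquiv_iff_semEquiv]
  exact Quotient.eq (r := stateSetoid S Var CT)

end Completeness

/-! ### Renaming of rules. -/

section Renaming

open FirstOrder.Language

variable {L : FirstOrder.Language.{u, v}} {Var : Type z} {S : UserSignature}

theorem Goal.rename_rename {f g : Var → Var} {G : Goal S L Var} :
    Goal.rename g (G.rename f) = G.rename (g ∘ f) := by
  simp only [Goal.rename, Multiset.map_map, Function.comp_def, UserConstraint.mapArgs,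
    Term.relabel_relabel]
  rfl

theorem Builtin.rename_rename {f g : Var → Var} {b : Builtin L Var} :
    (b.rename f).rename g = b.rename (g ∘ f) := by
  cases b <;> simp [Builtin.rename, Term.relabel_relabel]

theorem CHRRule.IsCopy.rename {r r' : CHRRule S L Var} (h : r'.IsCopy r) {f : Var → Var}
    (hf : Function.Injective f) : (r'.rename f).IsCopy r := by
  obtain ⟨g, hg, rfl⟩ := h
  refine ⟨f ∘ g, hf.comp hg, ?_⟩
  simp [CHRRule.rename, Goal.rename_rename, Builtin.rename_rename, Function.comp_def]

variable [DecidableEq Var]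

theorem CHRRule.vars_rename {f : Var → Var} {r : CHRRule S L Var} : (r.rename f).vars = f '' r.vars := by
  simp [CHRRule.vars, CHRRule.rename, Goal.vars_rename, Store.vars_rename, Set.image_union]

theorem CHRRule.vars_finite (r : CHRRule S L Var) : r.vars.Finite :=
  ((Goal.vars_finite _).union (Goal.vars_finite _)).union (Store.vars_finite _)

theorem CHRRule.head_vars_subset (r : CHRRule S L Var) : r.head.vars ⊆ r.vars :=
  fun _ h => Or.inl (Or.inl h)

theorem CHRRule.bodyU_vars_subset (r : CHRRule S L Var) : r.bodyU.vars ⊆ r.vars :=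
  fun _ h => Or.inl (Or.inr h)

theorem CHRRule.bodyB_vars_subset (r : CHRRule S L Var) : r.bodyB.vars ⊆ r.vars :=
  fun _ h => Or.inr h

end Renaming

/-! ### Transitions at chosen representatives. -/

section Steps

open FirstOrder.Language

variable {L : FirstOrder.Language.{u, v}} {Var : Type z}
  {CT : ConstraintTheory.{u, v, w} L} {S : UserSignature} {P : Set (CHRRule S L Var)}

/-- States are equivalent if every solution of either store has a counterpart for the other one
with the same global values and the same instances of the goal. -/
theorem SemEquiv.of_simulation {ι : Type} [Fintype ι] {g g' : ι → UserConstraint S L Var}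
    {B B' : Store L Var} {V : Finset Var}
    (h : ∀ ν : Var → CT.carrier, B.Holds CT ν →
      ∃ ν' : Var → CT.carrier, B'.Holds CT ν' ∧ (∀ x ∈ V, ν' x = ν x) ∧ ∀ i, (g' i).inst ν' = (g i).inst ν)
    (h' : ∀ ν : Var → CT.carrier, B'.Holds CT ν →
      ∃ ν' : Var → CT.carrier, B.Holds CT ν' ∧ (∀ x ∈ V, ν' x = ν x) ∧ ∀ i, (g i).inst ν' = (g' i).inst ν) :
    SemEquiv CT ⟨ofFamily g, B, V⟩ ⟨ofFamily g', B', V⟩ := by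
  refine .of_denotes fun μ x => ⟨?_, ?_⟩
  · rintro ⟨ν, hB, hV, hi⟩
    obtain ⟨ν', h1, h2, h3⟩ := h ν hB
    exact ⟨ν', h1, fun y hy => (h2 y hy).trans (hV y hy), fun i => (h3 i).trans (hi i)⟩
  · rintro ⟨ν, hB, hV, hi⟩
    obtain ⟨ν', h1, h2, h3⟩ := h' ν hB
    exact ⟨ν', h1, fun y hy => (h2 y hy).trans (hV y hy), fun i => (h3 i).trans (hi i)⟩

theorem SemEquiv.rename {G : Goal S L Var} {B : Store L Var} {V : Finset Var} (f : Equiv.Perm Var)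
    (hf : ∀ x ∈ V, f x = x) :
    SemEquiv CT (⟨G, B, V⟩ : CHRState S L Var) ⟨G.rename f, B.map (Builtin.rename f), V⟩ := by
  obtain ⟨n, g, rfl⟩ := exists_ofFamily_eq G
  rw [Goal.rename, map_ofFamily]
  refine .of_simulation (fun ν hν => ⟨ν ∘ f.symm, ?_, fun x hx => ?_, fun i => ?_⟩)
    (fun ν hν => ⟨ν ∘ f, Store.holds_rename.1 hν, fun x hx => ?_, fun i => ?_⟩)
  · rw [Store.holds_rename]
    simpa [Function.comp_def] using hν
  · rw [Function.comp, f.symm_apply_eq.2 (hf x hx).symm]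
  · rw [Function.comp, UserConstraint.inst_mapArgs_relabel]
    simp [Function.comp_def]
  · rw [Function.comp, hf x hx]
  · rw [Function.comp, UserConstraint.inst_mapArgs_relabel]

theorem SemEquiv.of_store {G : Goal S L Var} {B B' : Store L Var} {V : Finset Var}
    (h : ∀ ν : Var → CT.carrier, B.Holds CT ν ↔ B'.Holds CT ν) :
    SemEquiv CT (⟨G, B, V⟩ : CHRState S L Var) ⟨G, B', V⟩ := by
  obtain ⟨n, g, rfl⟩ := exists_ofFamily_eq G
  exact .of_simulation (fun ν hν => ⟨ν, (h ν).1 hν, fun _ _ => rfl, fun _ => rfl⟩)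
    (fun ν hν => ⟨ν, (h ν).2 hν, fun _ _ => rfl, fun _ => rfl⟩)

variable [DecidableEq Var]

/-- The goal, store and global variables of a representative at which a transition takes place. -/
def StepAt (CT : ConstraintTheory.{u, v, w} L) (P : Set (CHRRule S L Var)) (a b : StateClass S Var CT)
    (r : CHRRule S L Var) (G : Goal S L Var) (B : Store L Var) (V : Finset Var) : Prop :=
  (∃ r₀ ∈ P, r.IsCopy r₀) ∧ (∀ x ∈ r.vars, x ∉ V) ∧
    (∀ x ∈ r.vars, x ∉ r.head.vars → x ∉ G.vars ∧ x ∉ B.vars) ∧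
    a = CHRState.cls CT ⟨r.head + G, B, V⟩ ∧ b = CHRState.cls CT ⟨r.bodyU + G, r.bodyB ++ B, V⟩

theorem chrStep_iff_exists_stepAt {a b : StateClass S Var CT} :
    CHRStep CT P a b ↔ ∃ r G B V, StepAt CT P a b r G B V := by
  constructor
  · rintro ⟨r₀, h₀, r, hr, G, B, V, h⟩
    exact ⟨r, G, B, V, ⟨r₀, h₀, hr⟩, h⟩
  · rintro ⟨r, G, B, V, ⟨r₀, h₀, hr⟩, h⟩
    exact ⟨r₀, h₀, r, hr, G, B, V, h⟩

variable [Infinite Var]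

theorem SemEquiv.cls_eq {σ τ : CHRState S L Var} (h : SemEquiv CT σ τ) : σ.cls CT = τ.cls CT :=
  cls_eq_cls_iff.2 h

/-- The local variables at a transition can be renamed. -/
theorem StepAt.exists_avoiding {a b : StateClass S Var CT} {r : CHRRule S L Var} {G : Goal S L Var}
    {B : Store L Var} {V : Finset Var} (h : StepAt CT P a b r G B V) {F : Set Var} (hF : F.Finite) :
    ∃ r' G' B', StepAt CT P a b r' G' B' V ∧
      ∀ x, x ∈ r'.vars ∨ x ∈ Goal.vars G' ∨ x ∈ Store.vars B' → x ∉ V → x ∉ F := by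
  obtain ⟨⟨r₀, h₀, hr⟩, h1, h2, rfl, rfl⟩ := h
  obtain ⟨f, hf, hf'⟩ := exists_perm_avoiding (S := r.vars ∪ (G.vars ∪ B.vars)) (F := F) (V := ↑V)
    (r.vars_finite.union (G.vars_finite.union B.vars_finite)) hF V.finite_toSet
  have hV : ∀ x ∈ V, f x = x := hf'
  refine ⟨r.rename f, G.rename f, B.map (Builtin.rename f), ⟨⟨r₀, h₀, hr.rename f.injective⟩, ?_, ?_, ?_, ?_⟩, ?_⟩
  · rw [CHRRule.vars_rename]
    rintro _ ⟨x, hx, rfl⟩ hxV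
    have := f.injective (hV _ hxV)
    exact h1 x hx (this ▸ hxV)
  · rw [CHRRule.vars_rename]
    rintro _ ⟨x, hx, rfl⟩ hxh
    have hxh' : x ∉ r.head.vars := fun h => hxh (by
      simp only [CHRRule.rename, Goal.vars_rename]
      exact ⟨x, h, rfl⟩)
    rw [Goal.vars_rename, Store.vars_rename, f.injective.mem_set_image, f.injective.mem_set_image]
    exact h2 x hx hxh'
  · rw [CHRRule.rename, ← Goal.rename_add]
    exact (SemEquiv.rename f hV).cls_eq
  · simp only [CHRRule.rename]
    rw [← Goal.rename_add, ← List.map_append]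
    exact (SemEquiv.rename f hV).cls_eq
  · rw [CHRRule.vars_rename, Goal.vars_rename, Store.vars_rename]
    have : ∀ x ∈ r.vars ∪ (G.vars ∪ B.vars), f x ∉ V → f x ∉ F := fun x hx hxV =>
      hf x hx fun h => hxV (by rw [hV x h]; exact h)
    rintro _ (⟨x, hx, rfl⟩ | ⟨x, hx, rfl⟩ | ⟨x, hx, rfl⟩)
    exacts [this x (Or.inl hx), this x (Or.inr (Or.inl hx)), this x (Or.inr (Or.inr hx))]

/-- A rule whose head occurs in the goal applies as soon as its further variables are fresh. -/
theorem CHRStep.of_fresh {r₀ r : CHRRule S L Var} (h₀ : r₀ ∈ P) (hr : r.IsCopy r₀) {G : Goal S L Var}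
    {B : Store L Var} {V : Finset Var}
    (h : ∀ x ∈ r.vars, x ∉ r.head.vars → x ∉ G.vars ∧ x ∉ B.vars ∧ x ∉ V) :
    CHRStep CT P (CHRState.cls CT ⟨r.head + G, B, V⟩) (CHRState.cls CT ⟨r.bodyU + G, r.bodyB ++ B, V⟩) := by
  classical
  obtain ⟨f, hf, -⟩ := exists_perm_avoiding (S := r.vars) (F := ↑V ∪ r.vars ∪ (G.vars ∪ B.vars)) (V := ∅)
    r.vars_finite ((V.finite_toSet.union r.vars_finite).union (G.vars_finite.union B.vars_finite))
    Set.finite_empty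
  replace hf := fun x hx => hf x hx (Set.notMem_empty x)
  -- The definition of a transition forbids global rule variables, so a renamed copy is used and `Q`
  -- links its head variables to those in the goal.
  set Q : Store L Var := r.head.vars_finite.toFinset.toList.map
    (fun x => Builtin.eq (Term.var (f x)) (Term.var x)) with hQ
  have hQh : ∀ ν : Var → CT.carrier, Q.Holds CT ν ↔ ∀ x ∈ r.head.vars, ν (f x) = ν x := by
    intro ν
    simp only [hQ, Store.Holds, List.forall_mem_map, Finset.mem_toList, Set.Finite.mem_toFinset]
    rfl
  -- The images under `f` are new, so they can copy the values of the rule variables without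
  -- disturbing the state.
  have hfresh : ∀ ν : Var → CT.carrier, ∃ ν' : Var → CT.carrier,
      (∀ x ∈ (↑V ∪ r.vars ∪ (G.vars ∪ B.vars) : Set Var), ν' x = ν x) ∧ ∀ x ∈ r.vars, ν' (f x) = ν x := by
    refine fun ν => ⟨fun x => if f.symm x ∈ r.vars then ν (f.symm x) else ν x, fun x hx => ?_,
      fun x hx => by simp [hx]⟩
    refine if_neg fun h => ?_
    have := hf _ h
    rw [f.apply_symm_apply] at this
    exact this hx
  obtain ⟨n, g, hg⟩ := exists_ofFamily_eq G
  subst hg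
  refine chrStep_iff_exists_stepAt.2 ⟨r.rename f, ofFamily g, Q ++ B, V, ⟨r₀, h₀, hr.rename f.injective⟩,
    ?_, ?_, SemEquiv.cls_eq ?_, SemEquiv.cls_eq ?_⟩
  · rw [CHRRule.vars_rename]
    rintro _ ⟨x, hx, rfl⟩ hxV
    exact hf x hx (Or.inl (Or.inl hxV))
  · rw [CHRRule.vars_rename]
    rintro _ ⟨x, hx, rfl⟩ hxh
    have hxh' : x ∉ r.head.vars := fun h => hxh (by
      simp only [CHRRule.rename, Goal.vars_rename]
      exact ⟨x, h, rfl⟩)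
    refine ⟨fun h => hf x hx (Or.inr (Or.inl h)), ?_⟩
    rw [Store.vars_append]
    rintro (⟨b, hb, hxb⟩ | hxB)
    · obtain ⟨y, hy, rfl⟩ := List.mem_map.1 hb
      rw [Finset.mem_toList, Set.Finite.mem_toFinset] at hy
      simp only [Builtin.vars, termVars_var, Set.mem_union, Set.mem_singleton_iff] at hxb
      rcases hxb with e | e
      · exact hxh' (f.injective e ▸ hy)
      · exact hf x hx (Or.inl (Or.inr (e ▸ r.head_vars_subset hy)))
    · exact hf x hx (Or.inr (Or.inr hxB))
  · obtain ⟨m, k, hk⟩ := exists_ofFamily_eq r.head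
    have hkv : ∀ i, ∀ x ∈ (k i).vars, x ∈ r.head.vars := fun i x hx => by
      rw [← hk]
      exact mem_vars_ofFamily.2 ⟨i, hx⟩
    simp only [CHRRule.rename]
    rw [← hk, Goal.rename, map_ofFamily, ← ofFamily_sumElim, ← ofFamily_sumElim]
    refine .of_simulation (fun ν hν => ?_) (fun ν hν => ⟨ν, (Store.holds_append.1 hν).2, fun _ _ => rfl, ?_⟩)
    · obtain ⟨ν', h1, h2⟩ := hfresh ν
      refine ⟨ν', Store.holds_append.2 ⟨(hQh _).2 fun x hx => ?_, ?_⟩, fun x hx => h1 x (Or.inl (Or.inl hx)), ?_⟩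
      · have := r.head_vars_subset hx
        rw [h2 x this, h1 x (Or.inl (Or.inr this))]
      · exact (Store.holds_congr fun x hx => (h1 x (Or.inr (Or.inr hx))).symm).1 hν
      · rintro (i | i)
        · simp only [Sum.elim_inl, Function.comp, UserConstraint.inst_mapArgs_relabel]
          exact UserConstraint.inst_congr fun x hx => h2 x (r.head_vars_subset (hkv i x hx))
        · exact UserConstraint.inst_congr fun x hx =>
            h1 x (Or.inr (Or.inl (mem_vars_ofFamily.2 ⟨i, hx⟩)))
    · rintro (i | i)
      · simp only [Sum.elim_inl, Function.comp, UserConstraint.inst_mapArgs_relabel]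
        exact UserConstraint.inst_congr fun x hx =>
          ((hQh ν).1 (Store.holds_append.1 hν).1 x (hkv i x hx)).symm
      · rfl
  · obtain ⟨m, k, hk⟩ := exists_ofFamily_eq r.bodyU
    have hkv : ∀ i, ∀ x ∈ (k i).vars, x ∈ r.vars := fun i x hx => by
      refine r.bodyU_vars_subset ?_
      rw [← hk]
      exact mem_vars_ofFamily.2 ⟨i, hx⟩
    simp only [CHRRule.rename]
    rw [← hk, Goal.rename, map_ofFamily, ← ofFamily_sumElim, ← ofFamily_sumElim]
    refine .of_simulation (fun ν hν => ?_) (fun ν hν => ?_)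
    · obtain ⟨ν', h1, h2⟩ := hfresh ν
      rw [Store.holds_append] at hν
      refine ⟨ν', Store.holds_append.2 ⟨?_, Store.holds_append.2 ⟨(hQh _).2 fun x hx => ?_, ?_⟩⟩,
        fun x hx => h1 x (Or.inl (Or.inl hx)), ?_⟩
      · rw [Store.holds_rename]
        exact (Store.holds_congr fun x hx => (h2 x (r.bodyB_vars_subset hx)).symm).1 hν.1
      · have := r.head_vars_subset hx
        rw [h2 x this, h1 x (Or.inl (Or.inr this))]
      · exact (Store.holds_congr fun x hx => (h1 x (Or.inr (Or.inr hx))).symm).1 hν.2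
      · rintro (i | i)
        · simp only [Sum.elim_inl, Function.comp, UserConstraint.inst_mapArgs_relabel]
          exact UserConstraint.inst_congr fun x hx => h2 x (hkv i x hx)
        · exact UserConstraint.inst_congr fun x hx =>
            h1 x (Or.inr (Or.inl (mem_vars_ofFamily.2 ⟨i, hx⟩)))
    · rw [Store.holds_append, Store.holds_append, Store.holds_rename, hQh] at hν
      obtain ⟨hb, hq, hB⟩ := hν
      -- Pulling values back along `f` changes nothing on the old state: head variables are equated
      -- by `Q`, and the other rule variables do not occur there.
      have hsame : ∀ x, (x ∈ r.vars → x ∈ r.head.vars) →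
          (fun x => if x ∈ r.vars then ν (f x) else ν x) x = ν x := by
        intro x hx
        by_cases hxr : x ∈ r.vars
        · simp [hxr, hq x (hx hxr)]
        · simp [hxr]
      have hren : ∀ x ∈ r.vars, (fun x => if x ∈ r.vars then ν (f x) else ν x) x = (ν ∘ f) x :=
        fun x hx => if_pos hx
      refine ⟨fun x => if x ∈ r.vars then ν (f x) else ν x, Store.holds_append.2 ⟨?_, ?_⟩,
        fun x hx => hsame x fun hxr => by_contra fun h' => (h x hxr h').2.2 hx, ?_⟩
      · exact (Store.holds_congr fun x hx => (hren x (r.bodyB_vars_subset hx)).symm).1 hb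
      · exact (Store.holds_congr fun x hx =>
          (hsame x fun hxr => by_contra fun h' => (h x hxr h').2.1 hx).symm).1 hB
      · rintro (i | i)
        · simp only [Sum.elim_inl, Function.comp, UserConstraint.inst_mapArgs_relabel]
          exact UserConstraint.inst_congr fun x hx => hren x (hkv i x hx)
        · exact UserConstraint.inst_congr fun x hx => hsame x fun hxr =>
            by_contra fun h' => (h x hxr h').1 (mem_vars_ofFamily.2 ⟨i, hx⟩)

end Steps

/-! ### Transitions and joinability in contexts. -/

section Contexts

variable {L : FirstOrder.Language.{u, v}} {Var : Type z} [DecidableEq Var]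
  {CT : ConstraintTheory.{u, v, w} L} {S : UserSignature} {P : Set (CHRRule S L Var)}

/-- The state `σ` with further constraints and other global variables. -/
def CHRState.extend (σ : CHRState S L Var) (G : Goal S L Var) (B : Store L Var) (V : Finset Var) :
    CHRState S L Var :=
  ⟨σ.goal + G, σ.store ++ B, V⟩

/-- The local variables of `σ` do not occur in the context. -/
def CHRState.Apart (σ : CHRState S L Var) (G : Goal S L Var) (B : Store L Var) (V : Finset Var) : Prop :=
  ∀ x, x ∈ σ.goal.vars ∨ x ∈ σ.store.vars → x ∉ σ.globals → x ∉ G.vars ∧ x ∉ B.vars ∧ x ∉ V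

/-- Solutions of the state and of the context merge, since by apartness they share only variables
global in `σ`. The right-hand side depends on `σ` only through its denotation, which makes
equivalence a congruence. -/
theorem denotes_extend {σ : CHRState S L Var} {B : Store L Var} {V : Finset Var}
    {ι κ : Type*} [Fintype ι] [Fintype κ] {g : ι → UserConstraint S L Var} {k : κ → UserConstraint S L Var}
    (hσ : σ.Apart (ofFamily k) B V) (hg : ofFamily g = σ.goal) {μ : Var → CT.carrier}
    {x : ι ⊕ κ → GroundConstraint S CT.carrier} :
    Denotes CT (Sum.elim g k) (σ.store ++ B) V μ x ↔
      ∃ ν : Var → CT.carrier, Denotes CT g σ.store σ.globals ν (x ∘ Sum.inl) ∧ B.Holds CT ν ∧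
        (∀ y ∈ V, ν y = μ y) ∧ ∀ i, (k i).inst ν = x (Sum.inr i) := by
  classical
  constructor
  · rintro ⟨ν, hB, hV, hi⟩
    rw [Store.holds_append] at hB
    exact ⟨ν, ⟨ν, hB.1, fun _ _ => rfl, fun i => hi (Sum.inl i)⟩, hB.2, hV, fun i => hi (Sum.inr i)⟩
  · rintro ⟨ν, ⟨ν₁, hB₁, hV₁, hi₁⟩, hB, hV, hi⟩
    set ν' : Var → CT.carrier := fun x => if x ∈ σ.goal.vars ∨ x ∈ σ.store.vars then ν₁ x else ν x with hν'
    have h1 : ∀ x, x ∈ σ.goal.vars ∨ x ∈ σ.store.vars → ν₁ x = ν' x := fun x hx => (if_pos hx).symm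
    have h2 : ∀ x, x ∈ Goal.vars (ofFamily k) ∨ x ∈ B.vars ∨ x ∈ V → ν x = ν' x := by
      intro x hx
      by_cases hxσ : x ∈ σ.goal.vars ∨ x ∈ σ.store.vars
      · have hxg : x ∈ σ.globals := by
          by_contra hxg
          have := hσ x hxσ hxg
          tauto
        rw [← h1 x hxσ, hV₁ x hxg]
      · exact (if_neg hxσ).symm
    refine ⟨ν', Store.holds_append.2 ⟨?_, ?_⟩, fun y hy => ?_, ?_⟩
    · exact (Store.holds_congr fun x hx => h1 x (Or.inr hx)).1 hB₁
    · exact (Store.holds_congr fun x hx => h2 x (Or.inr (Or.inl hx))).1 hB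
    · rw [← h2 y (Or.inr (Or.inr hy)), hV y hy]
    · rintro (i | i)
      · refine Eq.trans ?_ (hi₁ i)
        refine (UserConstraint.inst_congr fun x hx => h1 x (Or.inl ?_)).symm
        rw [← hg]
        exact mem_vars_ofFamily.2 ⟨i, hx⟩
      · refine Eq.trans ?_ (hi i)
        exact (UserConstraint.inst_congr fun x hx => h2 x (Or.inl (mem_vars_ofFamily.2 ⟨i, hx⟩))).symm

theorem SemEquiv.extend {σ τ : CHRState S L Var} (h : SemEquiv CT σ τ) {G : Goal S L Var}
    {B : Store L Var} {V : Finset Var} (hσ : σ.Apart G B V) (hτ : τ.Apart G B V) :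
    SemEquiv CT (σ.extend G B V) (τ.extend G B V) := by
  rcases h with ⟨h1, h2⟩ | ⟨ι, hι, g, g', hg, hg', h⟩
  · exact Or.inl ⟨fun ⟨ν, hν⟩ => h1 ⟨ν, (Store.holds_append.1 hν).1⟩,
      fun ⟨ν, hν⟩ => h2 ⟨ν, (Store.holds_append.1 hν).1⟩⟩
  · obtain ⟨n, k, rfl⟩ := exists_ofFamily_eq G
    unfold CHRState.extend
    rw [← hg, ← hg', ← ofFamily_sumElim, ← ofFamily_sumElim]
    refine .of_denotes fun μ x => ?_
    rw [denotes_extend hσ hg, denotes_extend hτ hg']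
    simp only [h]

variable [Infinite Var]

/-- The local variables of the transition can be renamed away from the context. The target is given
as a representative that is again apart, so that the argument iterates along `↣*`. -/
theorem CHRStep.extend {σ : CHRState S L Var} {b : StateClass S Var CT}
    (h : CHRStep CT P (σ.cls CT) b) {G : Goal S L Var} {B : Store L Var} {V : Finset Var}
    (hσ : σ.Apart G B V) :
    ∃ τ : CHRState S L Var, τ.cls CT = b ∧ τ.Apart G B V ∧
      CHRStep CT P ((σ.extend G B V).cls CT) ((τ.extend G B V).cls CT) := by
  obtain ⟨r, G₁, B₁, V₁, h⟩ := chrStep_iff_exists_stepAt.1 h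
  obtain ⟨r, G₁, B₁, h, hF⟩ := h.exists_avoiding (F := G.vars ∪ B.vars ∪ ↑V)
    ((G.vars_finite.union B.vars_finite).union V.finite_toSet)
  have hF' : ∀ x, x ∈ r.vars ∨ x ∈ Goal.vars G₁ ∨ x ∈ Store.vars B₁ → x ∉ V₁ →
      x ∉ G.vars ∧ x ∉ B.vars ∧ x ∉ V := by
    intro x hx hxV
    have := hF x hx hxV
    simp only [Set.mem_union, not_or, Finset.mem_coe] at this
    tauto
  obtain ⟨⟨r₀, h₀, hr⟩, h1, h2, ha, rfl⟩ := h
  have hapart : CHRState.Apart (⟨r.head + G₁, B₁, V₁⟩ : CHRState S L Var) G B V := by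
    rintro x hx hxV
    simp only [Goal.vars_add, Set.mem_union] at hx
    refine hF' x ?_ hxV
    rcases hx with (h | h) | h
    exacts [Or.inl (r.head_vars_subset h), Or.inr (Or.inl h), Or.inr (Or.inr h)]
  refine ⟨_, rfl, ?_, ?_⟩
  · rintro x hx hxV
    simp only [Goal.vars_add, Store.vars_append, Set.mem_union] at hx
    refine hF' x ?_ hxV
    rcases hx with (h | h) | (h | h)
    exacts [Or.inl (r.bodyU_vars_subset h), Or.inr (Or.inl h), Or.inl (r.bodyB_vars_subset h),
      Or.inr (Or.inr h)]
  · rw [((cls_eq_cls_iff.1 ha).extend hσ hapart).cls_eq]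
    simp only [CHRState.extend, add_assoc, List.append_assoc]
    refine .of_fresh h₀ hr fun x hx hxh => ?_
    have h3 := h2 x hx hxh
    have h4 := hF' x (Or.inl hx) (h1 x hx)
    simp only [Goal.vars_add, Store.vars_append, Set.mem_union]
    tauto

theorem CHRStep.reflTransGen_extend {σ : CHRState S L Var} {b : StateClass S Var CT}
    (h : Relation.ReflTransGen (CHRStep CT P) (σ.cls CT) b) {G : Goal S L Var} {B : Store L Var}
    {V : Finset Var} (hσ : σ.Apart G B V) :
    ∃ τ : CHRState S L Var, τ.cls CT = b ∧ τ.Apart G B V ∧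
      Relation.ReflTransGen (CHRStep CT P) ((σ.extend G B V).cls CT) ((τ.extend G B V).cls CT) := by
  induction h with
  | refl => exact ⟨σ, rfl, hσ, .refl⟩
  | tail _ hstep ih =>
    obtain ⟨τ, rfl, hτ, hs⟩ := ih
    obtain ⟨ρ, hρ, hρ', hs'⟩ := hstep.extend hτ
    exact ⟨ρ, hρ, hρ', hs.tail hs'⟩

/-- Joinability is preserved in every context. -/
theorem CHRJoinable.extend {σ τ : CHRState S L Var} (h : CHRJoinable CT P (σ.cls CT) (τ.cls CT))
    {G : Goal S L Var} {B : Store L Var} {V : Finset Var} (hσ : σ.Apart G B V) (hτ : τ.Apart G B V) :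
    CHRJoinable CT P ((σ.extend G B V).cls CT) ((τ.extend G B V).cls CT) := by
  obtain ⟨c, h1, h2⟩ := h
  obtain ⟨σ', rfl, hσ', h1⟩ := CHRStep.reflTransGen_extend h1 hσ
  obtain ⟨τ', he, hτ', h2⟩ := CHRStep.reflTransGen_extend h2 hτ
  refine ⟨_, h1, ?_⟩
  -- The two sequences may end in different representatives of the common successor; both are apart
  -- from the context, so their extensions are equivalent.
  rwa [((cls_eq_cls_iff.1 he).extend hτ' hσ').cls_eq] at h2

end Contexts

/-! ### Parts of a family at given positions. -/

section Subfamilies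

variable {α : Type*} {ι : Type*}

/-- The multiset of the members of a family with indices in a finite set. -/
def subfamily (g : ι → α) (s : Finset ι) : Multiset α := s.val.map g

theorem mem_subfamily {g : ι → α} {s : Finset ι} {a : α} : a ∈ subfamily g s ↔ ∃ i ∈ s, g i = a := by
  simp [subfamily]

theorem subfamily_eq_ofFamily (g : ι → α) (s : Finset ι) :
    subfamily g s = ofFamily fun i : s => g i := by
  unfold subfamily ofFamily
  conv_lhs => rw [← Finset.attach_map_val (s := s), Finset.map_val, Multiset.map_map]
  rfl

theorem subfamily_congr {g g' : ι → α} {s : Finset ι} (h : ∀ i ∈ s, g i = g' i) :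
    subfamily g s = subfamily g' s :=
  Multiset.map_congr rfl h

theorem subfamily_disjUnion [DecidableEq ι] (g : ι → α) {s t : Finset ι} (h : Disjoint s t) :
    subfamily g (s ∪ t) = subfamily g s + subfamily g t := by
  rw [← Finset.disjUnion_eq_union _ _ h]
  simp [subfamily, Finset.disjUnion]

theorem subfamily_map {κ : Type*} [Fintype κ] (g : ι → α) (e : κ ↪ ι) :
    subfamily g (Finset.univ.map e) = ofFamily (g ∘ e) := by
  simp [subfamily, ofFamily]

variable [Fintype ι]

theorem subfamily_univ (g : ι → α) : subfamily g Finset.univ = ofFamily g := rfl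

theorem exists_subfamily_eq_of_ofFamily_eq_add [DecidableEq ι] {g : ι → α} {m m' : Multiset α}
    (h : ofFamily g = m + m') : ∃ s : Finset ι, subfamily g s = m ∧ subfamily g sᶜ = m' := by
  obtain ⟨n, k, rfl⟩ := exists_ofFamily_eq m
  obtain ⟨e, he⟩ := exists_embedding_of_ofFamily_eq_add h
  have h1 : subfamily g (Finset.univ.map e) = ofFamily k := by
    rw [subfamily_map]
    congr 1
    exact funext he
  refine ⟨Finset.univ.map e, h1, ?_⟩
  have h2 := subfamily_disjUnion g (disjoint_compl_right (a := Finset.univ.map e))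
  rw [Finset.union_compl, subfamily_univ, h, h1] at h2
  exact (add_left_cancel h2).symm

end Subfamilies

/-! ### Critical pairs as peaks. -/

section CriticalPairs

variable {L : FirstOrder.Language.{u, v}} {Var : Type z}
  {CT : ConstraintTheory.{u, v, w} L} {S : UserSignature} {P : Set (CHRRule S L Var)}

/-- The conjunction of the equations between paired constraints. -/
noncomputable def pairStore (A : List (UserConstraint S L Var × UserConstraint S L Var)) : Store L Var :=
  A.flatMap fun q => q.1.equate q.2

theorem holds_pairStore {A : List (UserConstraint S L Var × UserConstraint S L Var)}
    {ν : Var → CT.carrier} : (pairStore A).Holds CT ν ↔ ∀ q ∈ A, q.1.inst ν = q.2.inst ν := by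
  simp only [← UserConstraint.holds_equate (CT := CT), pairStore, Store.Holds, List.mem_flatMap]
  constructor
  · exact fun h q hq b hb => h b ⟨q, hq, hb⟩
  · rintro h b ⟨q, hq, hb⟩
    exact h q hq b hb

variable [DecidableEq Var]

theorem vars_pairStore {A : List (UserConstraint S L Var × UserConstraint S L Var)} {x : Var}
    (h : x ∈ (pairStore A).vars) : ∃ q ∈ A, x ∈ q.1.vars ∨ x ∈ q.2.vars := by
  obtain ⟨b, hb, hx⟩ := h
  obtain ⟨q, hq, hb⟩ := List.mem_flatMap.1 hb
  exact ⟨q, hq, UserConstraint.vars_equate ⟨b, hb, hx⟩⟩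

variable [Infinite Var]

/-- The overlap of a critical pair has transitions to both members of the pair. -/
theorem IsCriticalPair.chrStep {σ σ₁ σ₂ : CHRState S L Var} (h : IsCriticalPair CT P σ σ₁ σ₂) :
    CHRStep CT P (σ.cls CT) (σ₁.cls CT) ∧ CHRStep CT P (σ.cls CT) (σ₂.cls CT) := by
  obtain ⟨r₁, hr₁, r₂, hr₂, r₁', r₂', hc₁, hc₂, hd, H₁, H₂, A, V, -, h1, h2, hV, -, rfl, rfl, rfl⟩ := h
  change CHRStep CT P (CHRState.cls CT ⟨_, pairStore A, V⟩) (CHRState.cls CT ⟨_, _ ++ pairStore A, V⟩) ∧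
    CHRStep CT P (CHRState.cls CT ⟨_, pairStore A, V⟩) (CHRState.cls CT ⟨_, _ ++ pairStore A, V⟩)
  have hV' : ∀ x, x ∈ V ↔ x ∈ r₁'.head.vars ∨ x ∈ r₂'.head.vars := fun x => by
    rw [← Finset.mem_coe, hV]
    rfl
  have hE : ∀ x ∈ (pairStore A).vars, x ∈ V := by
    intro x hx
    obtain ⟨q, hq, hx⟩ := vars_pairStore hx
    rw [hV', h1, h2, Goal.vars_add, Goal.vars_add]
    rcases hx with hx | hx
    · exact Or.inl (Or.inr ⟨_, Multiset.mem_coe.2 (List.mem_map_of_mem hq), hx⟩)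
    · exact Or.inr (Or.inr ⟨_, Multiset.mem_coe.2 (List.mem_map_of_mem hq), hx⟩)
  have hH₁ : ∀ x ∈ H₁.vars, x ∈ r₁'.head.vars := fun x hx => by
    rw [h1, Goal.vars_add]
    exact Or.inl hx
  have hH₂ : ∀ x ∈ H₂.vars, x ∈ r₂'.head.vars := fun x hx => by
    rw [h2, Goal.vars_add]
    exact Or.inl hx
  constructor
  · rw [← h1]
    -- The head variables are global in the overlap, which `CHRStep.of_fresh` permits.
    refine .of_fresh hr₁ hc₁ fun x hx hxh => ?_
    have hx2 : x ∉ r₂'.head.vars := fun h => hd.le_bot ⟨hx, r₂'.head_vars_subset h⟩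
    have hxV : x ∉ V := fun h => ((hV' x).1 h).elim hxh hx2
    exact ⟨fun h => hx2 (hH₂ x h), fun h => hxV (hE x h), hxV⟩
  -- The equations in the store allow `A₁` to be exchanged for `A₂`, which exposes the head of the
  -- second rule.
  · have hsem : SemEquiv CT (⟨H₁ + (A.map Prod.fst : List (UserConstraint S L Var)) + H₂, pairStore A, V⟩ :
        CHRState S L Var) ⟨r₂'.head + H₁, pairStore A, V⟩ := by
      rw [h2, show H₂ + (A.map Prod.snd : List (UserConstraint S L Var)) + H₁ =
        H₁ + (A.map Prod.snd : List (UserConstraint S L Var)) + H₂ by abel]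
      obtain ⟨n₁, k₁, rfl⟩ := exists_ofFamily_eq H₁
      obtain ⟨n₂, k₂, rfl⟩ := exists_ofFamily_eq H₂
      have hA : ∀ f : UserConstraint S L Var × UserConstraint S L Var → UserConstraint S L Var,
          ((A.map f : List (UserConstraint S L Var)) : Multiset (UserConstraint S L Var)) =
            ofFamily fun i : Fin A.length => f (A.get i) := fun f => by
        simp only [ofFamily, Fin.univ_val_map, List.ofFn_comp' , List.get_eq_getElem]
        congr 1
        apply List.ext_getElem <;> simp
      rw [hA, hA, ← ofFamily_sumElim, ← ofFamily_sumElim, ← ofFamily_sumElim, ← ofFamily_sumElim]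
      have hi : ∀ ν : Var → CT.carrier, (pairStore A).Holds CT ν → ∀ i : Fin A.length,
          (A.get i).1.inst ν = (A.get i).2.inst ν :=
        fun ν hν i => holds_pairStore.1 hν _ (List.get_mem _ _)
      refine .of_simulation (fun ν hν => ⟨ν, hν, fun _ _ => rfl, ?_⟩)
        (fun ν hν => ⟨ν, hν, fun _ _ => rfl, ?_⟩)
      · rintro ((i | i) | i)
        exacts [rfl, (hi ν hν i).symm, rfl]
      · rintro ((i | i) | i)
        exacts [rfl, hi ν hν i, rfl]
    rw [hsem.cls_eq]
    refine .of_fresh hr₂ hc₂ fun x hx hxh => ?_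
    have hx1 : x ∉ r₁'.head.vars := fun h => hd.le_bot ⟨r₁'.head_vars_subset h, hx⟩
    have hxV : x ∉ V := fun h => ((hV' x).1 h).elim hx1 hxh
    exact ⟨fun h => hx1 (hH₁ x h), fun h => hxV (hE x h), hxV⟩

end CriticalPairs

/-! ### Two transitions from one state. -/

section Peaks

variable {L : FirstOrder.Language.{u, v}} {Var : Type z} [DecidableEq Var]
  {CT : ConstraintTheory.{u, v, w} L} {S : UserSignature} {P : Set (CHRRule S L Var)}

theorem CHRJoinable.of_eq {a b a' b' : StateClass S Var CT} (ha : a = a') (hb : b = b')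
    (h : CHRJoinable CT P a' b') : CHRJoinable CT P a b := by
  rwa [ha, hb]

/-- Two transitions from the class `c`, with renamed representatives whose goals are listed in
parallel; the heads of the rules are the constraints at the positions `s₁` and `s₂`. -/
structure Peak (CT : ConstraintTheory.{u, v, w} L) (P : Set (CHRRule S L Var)) (ι : Type) [Fintype ι]
    [DecidableEq ι] (c a b : StateClass S Var CT) where
  r₁ : CHRRule S L Var
  r₂ : CHRRule S L Var
  g₁ : ι → UserConstraint S L Var
  g₂ : ι → UserConstraint S L Var
  s₁ : Finset ι
  s₂ : Finset ι
  B₁ : Store L Var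
  B₂ : Store L Var
  V₁ : Finset Var
  V₂ : Finset Var
  step₁ : StepAt CT P c a r₁ (subfamily g₁ s₁ᶜ) B₁ V₁
  step₂ : StepAt CT P c b r₂ (subfamily g₂ s₂ᶜ) B₂ V₂
  head₁ : r₁.head = subfamily g₁ s₁
  head₂ : r₂.head = subfamily g₂ s₂
  denotes : ∀ μ x, Denotes CT g₁ B₁ V₁ μ x ↔ Denotes CT g₂ B₂ V₂ μ x
  apart₁ : ∀ x, x ∈ r₁.vars ∨ x ∈ Goal.vars (subfamily g₁ s₁ᶜ) ∨ x ∈ B₁.vars → x ∉ V₁ → x ∉ V₂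
  apart₂ : ∀ x, x ∈ r₂.vars ∨ x ∈ Goal.vars (subfamily g₂ s₂ᶜ) ∨ x ∈ B₂.vars → x ∉ V₂ →
    x ∉ V₁ ∧ ¬ (x ∈ r₁.vars ∨ x ∈ Goal.vars (subfamily g₁ s₁ᶜ) ∨ x ∈ B₁.vars)

theorem mem_vars_subfamily {ι : Type} [Fintype ι] {g : ι → UserConstraint S L Var} {s : Finset ι}
    {x : Var} : x ∈ Goal.vars (subfamily g s) ↔ ∃ i ∈ s, x ∈ (g i).vars := by
  simp only [Goal.mem_vars, mem_subfamily]
  constructor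
  · rintro ⟨_, ⟨i, hi, rfl⟩, h⟩
    exact ⟨i, hi, h⟩
  · rintro ⟨i, hi, h⟩
    exact ⟨_, ⟨i, hi, rfl⟩, h⟩

namespace Peak

variable {ι : Type} [Fintype ι] [DecidableEq ι] {c a b : StateClass S Var CT}

/-- The peak with the roles of the transitions exchanged. -/
def swap (p : Peak CT P ι c a b) : Peak CT P ι c b a where
  r₁ := p.r₂
  r₂ := p.r₁
  g₁ := p.g₂
  g₂ := p.g₁
  s₁ := p.s₂
  s₂ := p.s₁
  B₁ := p.B₂
  B₂ := p.B₁
  V₁ := p.V₂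
  V₂ := p.V₁
  step₁ := p.step₂
  step₂ := p.step₁
  head₁ := p.head₂
  head₂ := p.head₁
  denotes := fun μ x => (p.denotes μ x).symm
  apart₁ := fun x h h' => (p.apart₂ x h h').1
  apart₂ := fun x h h' => ⟨p.apart₁ x h h', fun h2 => (p.apart₂ x h2 (p.apart₁ x h h')).2 h⟩

theorem vars_g₁ (p : Peak CT P ι c a b) {i : ι} {x : Var} (h : x ∈ (p.g₁ i).vars) :
    x ∈ p.r₁.head.vars ∨ x ∈ Goal.vars (subfamily p.g₁ p.s₁ᶜ) := by
  rw [p.head₁, mem_vars_subfamily, mem_vars_subfamily]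
  by_cases hi : i ∈ p.s₁
  · exact Or.inl ⟨i, hi, h⟩
  · exact Or.inr ⟨i, by simpa using hi, h⟩

/-- The variables of the first representative. -/
def vars₁ (p : Peak CT P ι c a b) : Set Var :=
  {x | x ∈ p.r₁.vars ∨ x ∈ Goal.vars (subfamily p.g₁ p.s₁ᶜ) ∨ x ∈ p.B₁.vars}

theorem vars_g₁' (p : Peak CT P ι c a b) {i : ι} {x : Var} (h : x ∈ (p.g₁ i).vars) : x ∈ p.vars₁ :=
  (p.vars_g₁ h).elim (fun h => Or.inl (p.r₁.head_vars_subset h)) fun h => Or.inr (Or.inl h)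

/-- The pairs of constraints at the positions in a finite set. -/
noncomputable def pairs (p : Peak CT P ι c a b) (s : Finset ι) : List (UserConstraint S L Var × UserConstraint S L Var) :=
  s.toList.map fun i => (p.g₁ i, p.g₂ i)

theorem holds_pairs (p : Peak CT P ι c a b) {s : Finset ι} {ν : Var → CT.carrier} :
    (pairStore (p.pairs s)).Holds CT ν ↔ ∀ i ∈ s, (p.g₁ i).inst ν = (p.g₂ i).inst ν := by
  simp [holds_pairStore, pairs]

theorem vars_pairs (p : Peak CT P ι c a b) {s : Finset ι} {x : Var}
    (h : x ∈ (pairStore (p.pairs s)).vars) : ∃ i ∈ s, x ∈ (p.g₁ i).vars ∨ x ∈ (p.g₂ i).vars := by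
  obtain ⟨q, hq, hx⟩ := vars_pairStore h
  obtain ⟨i, hi, rfl⟩ := List.mem_map.1 hq
  exact ⟨i, Finset.mem_toList.1 hi, hx⟩

theorem pairs_fst (p : Peak CT P ι c a b) (s : Finset ι) :
    (((p.pairs s).map Prod.fst : List (UserConstraint S L Var)) : Multiset (UserConstraint S L Var)) =
      subfamily p.g₁ s := by
  rw [pairs, List.map_map, ← Multiset.map_coe, Finset.coe_toList]
  rfl

theorem pairs_snd (p : Peak CT P ι c a b) (s : Finset ι) :
    (((p.pairs s).map Prod.snd : List (UserConstraint S L Var)) : Multiset (UserConstraint S L Var)) =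
      subfamily p.g₂ s := by
  rw [pairs, List.map_map, ← Multiset.map_coe, Finset.coe_toList]
  rfl

/-- A solution of the first representative extends to a common solution of both. -/
theorem exists_merge (p : Peak CT P ι c a b) {ν : Var → CT.carrier} {μ : Var → CT.carrier}
    (hB : p.B₁.Holds CT ν) (hμ : ∀ x ∈ p.V₁, ν x = μ x) :
    ∃ ν' : Var → CT.carrier, (∀ x ∈ p.vars₁, ν' x = ν x) ∧ (∀ x, x ∈ p.V₁ ∨ x ∈ p.V₂ → ν' x = μ x) ∧
      p.B₁.Holds CT ν' ∧ p.B₂.Holds CT ν' ∧ ∀ i, (p.g₁ i).inst ν' = (p.g₂ i).inst ν' := by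
  classical
  obtain ⟨ν₂, hB₂, hV₂, hi₂⟩ := (p.denotes μ _).1 ⟨ν, hB, hμ, fun _ => rfl⟩
  -- The apartness conditions make every variable common to both representatives global in both,
  -- where the two solutions have the value given by `μ`.
  set ν' : Var → CT.carrier := fun x => if x ∈ p.vars₁ then ν x else if x ∈ p.swap.vars₁ then ν₂ x else μ x
    with hν'
  have h1 : ∀ x ∈ p.vars₁, ν' x = ν x := fun x hx => if_pos hx
  have h2 : ∀ x ∈ p.swap.vars₁, ν' x = ν₂ x := by
    intro x hx
    by_cases hx1 : x ∈ p.vars₁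
    · have hxV2 : x ∈ p.V₂ := by_contra fun h => (p.apart₂ x hx h).2 hx1
      have hxV1 : x ∈ p.V₁ := by_contra fun h => p.apart₁ x hx1 h hxV2
      rw [h1 x hx1, hμ x hxV1, hV₂ x hxV2]
    · simp [hν', hx1, hx]
  have h3 : ∀ x, x ∈ p.V₁ ∨ x ∈ p.V₂ → ν' x = μ x := by
    intro x hx
    by_cases hx1 : x ∈ p.vars₁
    · have hxV1 : x ∈ p.V₁ := by_contra fun h => hx.elim h (p.apart₁ x hx1 h)
      rw [h1 x hx1, hμ x hxV1]
    · by_cases hx2 : x ∈ p.swap.vars₁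
      · have hxV2 : x ∈ p.V₂ := by_contra fun h => hx.elim (p.apart₂ x hx2 h).1 h
        rw [h2 x hx2, hV₂ x hxV2]
      · simp [hν', hx1, hx2]
  refine ⟨ν', h1, h3, ?_, ?_, fun i => ?_⟩
  · exact (Store.holds_congr fun x hx => (h1 x (Or.inr (Or.inr hx))).symm).1 hB
  · exact (Store.holds_congr fun x hx => (h2 x (Or.inr (Or.inr hx))).symm).1 hB₂
  · refine (UserConstraint.inst_congr fun x hx => h1 x (p.vars_g₁' hx)).trans ((hi₂ i).symm.trans ?_)
    exact (UserConstraint.inst_congr fun x hx => h2 x (p.swap.vars_g₁' hx)).symm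

/-- The context of the critical pair: its goal. -/
noncomputable def restGoal (p : Peak CT P ι c a b) : Goal S L Var := subfamily p.g₁ (p.s₁ ∪ p.s₂)ᶜ

/-- The context of the critical pair: its store. -/
noncomputable def restStore (p : Peak CT P ι c a b) : Store L Var :=
  pairStore (p.pairs Finset.univ) ++ (p.B₁ ++ p.B₂)

/-- The first member of the critical pair. -/
noncomputable def left (p : Peak CT P ι c a b) (V : Finset Var) : CHRState S L Var :=
  ⟨p.r₁.bodyU + subfamily p.g₂ (p.s₂ \ p.s₁), p.r₁.bodyB ++ pairStore (p.pairs (p.s₁ ∩ p.s₂)), V⟩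

/-- The second member of the critical pair. -/
noncomputable def right (p : Peak CT P ι c a b) (V : Finset Var) : CHRState S L Var :=
  ⟨p.r₂.bodyU + subfamily p.g₁ (p.s₁ \ p.s₂), p.r₂.bodyB ++ pairStore (p.pairs (p.s₁ ∩ p.s₂)), V⟩

/-- The overlap of the critical pair. -/
noncomputable def overlap (p : Peak CT P ι c a b) (V : Finset Var) : CHRState S L Var :=
  ⟨subfamily p.g₁ (p.s₁ \ p.s₂) + subfamily p.g₁ (p.s₁ ∩ p.s₂) + subfamily p.g₂ (p.s₂ \ p.s₁),
    pairStore (p.pairs (p.s₁ ∩ p.s₂)), V⟩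

theorem compl_eq (p : Peak CT P ι c a b) : p.s₁ᶜ = (p.s₂ \ p.s₁) ∪ (p.s₁ ∪ p.s₂)ᶜ := by
  ext i
  simp only [Finset.mem_compl, Finset.mem_union, Finset.mem_sdiff]
  tauto

theorem disjoint_compl (p : Peak CT P ι c a b) : Disjoint (p.s₂ \ p.s₁) (p.s₁ ∪ p.s₂)ᶜ := by
  rw [Finset.disjoint_left]
  intro i
  simp only [Finset.mem_compl, Finset.mem_union, Finset.mem_sdiff]
  tauto

theorem vars_restGoal (p : Peak CT P ι c a b) {x : Var} (h : x ∈ p.restGoal.vars) :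
    x ∈ Goal.vars (subfamily p.g₁ p.s₁ᶜ) := by
  obtain ⟨i, hi, hx⟩ := mem_vars_subfamily.1 h
  refine mem_vars_subfamily.2 ⟨i, ?_, hx⟩
  simp only [Finset.mem_compl, Finset.mem_union, not_or] at hi ⊢
  exact hi.1

/-- Transitions at common positions give rise to a critical pair. -/
theorem isCriticalPair (p : Peak CT P ι c a b) {V : Finset Var}
    (hV : (V : Set Var) = p.r₁.head.vars ∪ p.r₂.head.vars)
    (h : (p.s₁ ∩ p.s₂).Nonempty) (hsat : p.B₁.Sat CT) :
    IsCriticalPair CT P (p.overlap V) (p.left V) (p.right V) := by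
  obtain ⟨⟨q₁, hq₁, hc₁⟩, -⟩ := p.step₁
  obtain ⟨⟨q₂, hq₂, hc₂⟩, hf₂, -⟩ := p.step₂
  refine ⟨q₁, hq₁, q₂, hq₂, p.r₁, p.r₂, hc₁, hc₂, ?_, subfamily p.g₁ (p.s₁ \ p.s₂),
    subfamily p.g₂ (p.s₂ \ p.s₁), p.pairs (p.s₁ ∩ p.s₂), V, ?_, ?_, ?_, hV, ?_, ?_, rfl, rfl⟩
  · exact Set.disjoint_left.2 fun x hx1 hx2 => (p.apart₂ x (Or.inl hx2) (hf₂ x hx2)).2 (Or.inl hx1)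
  · simpa [pairs] using h.ne_empty
  · rw [pairs_fst, p.head₁, ← subfamily_disjUnion _ (Finset.disjoint_sdiff_inter _ _),
      Finset.sdiff_union_inter]
  · rw [pairs_snd, p.head₂, Finset.inter_comm, ← subfamily_disjUnion _ (Finset.disjoint_sdiff_inter _ _),
      Finset.sdiff_union_inter]
  · obtain ⟨ν, hν⟩ := hsat
    obtain ⟨ν', -, -, -, -, h5⟩ := p.exists_merge hν fun _ _ => rfl
    exact ⟨ν', p.holds_pairs.2 fun i _ => h5 i⟩
  · rw [pairs_fst]
    rfl

/-- The variables of the body of the first rule that are not in its head do not occur elsewhere. -/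
theorem fresh₁ (p : Peak CT P ι c a b) {x : Var} (hx : x ∈ p.r₁.vars) (hxh : x ∉ p.r₁.head.vars) :
    (∀ i, x ∉ (p.g₁ i).vars ∧ x ∉ (p.g₂ i).vars) ∧ x ∉ p.restGoal.vars ∧ x ∉ p.restStore.vars ∧
      x ∉ p.V₁ ∪ p.V₂ ∧ x ∉ p.swap.vars₁ := by
  have h1 := p.step₁.2.1 x hx
  have h2 := p.step₁.2.2.1 x hx hxh
  have h3 : x ∉ p.swap.vars₁ := (p.swap.apart₂ x (Or.inl hx) h1).2
  have hg : ∀ i, x ∉ (p.g₁ i).vars ∧ x ∉ (p.g₂ i).vars := fun i =>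
    ⟨fun h => (p.vars_g₁ h).elim hxh h2.1, fun h => h3 (p.swap.vars_g₁' h)⟩
  refine ⟨hg, fun h => h2.1 (p.vars_restGoal h), fun h => ?_, ?_, h3⟩
  · simp only [restStore, Store.vars_append] at h
    rcases h with h | h | h
    · obtain ⟨i, -, h⟩ := p.vars_pairs h
      exact h.elim (hg i).1 (hg i).2
    · exact h2.2 h
    · exact h3 (Or.inr (Or.inr h))
  · rw [Finset.mem_union, not_or]
    exact ⟨h1, p.apart₁ x (Or.inl hx) h1⟩

theorem fresh₂ (p : Peak CT P ι c a b) {x : Var} (hx : x ∈ p.r₂.vars) (hxh : x ∉ p.r₂.head.vars) :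
    (∀ i, x ∉ (p.g₁ i).vars ∧ x ∉ (p.g₂ i).vars) ∧ x ∉ p.restGoal.vars ∧ x ∉ p.restStore.vars ∧
      x ∉ p.V₁ ∪ p.V₂ ∧ x ∉ p.vars₁ := by
  obtain ⟨h1, h2, h3, h4, h5⟩ := p.swap.fresh₁ hx hxh
  have hg : ∀ i, x ∉ (p.g₁ i).vars ∧ x ∉ (p.g₂ i).vars := fun i => (h1 i).symm
  refine ⟨hg, fun h => h5 (Or.inr (Or.inl (p.vars_restGoal h))), fun h => ?_, ?_, h5⟩
  · simp only [restStore, Store.vars_append] at h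
    rcases h with h | h | h
    · obtain ⟨i, -, h⟩ := p.vars_pairs h
      exact h.elim (hg i).1 (hg i).2
    · exact h5 (Or.inr (Or.inr h))
    · refine h3 ?_
      simp only [restStore, Store.vars_append]
      exact Or.inr (Or.inl h)
  · rw [Finset.union_comm]
    exact h4

variable [Infinite Var]

/-- The target of the first transition, with the constraints of both representatives. -/
theorem target_eq (p : Peak CT P ι c a b) {g : ι → UserConstraint S L Var}
    (hg : ∀ i, g i = p.g₁ i ∨ g i = p.g₂ i) {B : Store L Var} {V : Finset Var}
    (hB : ∀ ν : Var → CT.carrier, B.Holds CT ν ↔ p.r₁.bodyB.Holds CT ν ∧ p.B₁.Holds CT ν ∧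
      p.B₂.Holds CT ν ∧ ∀ i, (p.g₁ i).inst ν = (p.g₂ i).inst ν)
    (hV : ∀ x, x ∈ V ↔ x ∈ p.V₁ ∨ x ∈ p.V₂) :
    a = CHRState.cls CT ⟨p.r₁.bodyU + subfamily g p.s₁ᶜ, B, V⟩ := by
  refine p.step₁.2.2.2.2.trans (SemEquiv.cls_eq ?_)
  obtain ⟨n, k, hk⟩ := exists_ofFamily_eq p.r₁.bodyU
  rw [← hk, subfamily_eq_ofFamily, subfamily_eq_ofFamily, ← ofFamily_sumElim, ← ofFamily_sumElim]
  have hgi : ∀ ν : Var → CT.carrier, (∀ i, (p.g₁ i).inst ν = (p.g₂ i).inst ν) →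
      ∀ i, (g i).inst ν = (p.g₁ i).inst ν := fun ν h i => by
    rcases hg i with e | e <;> rw [e]
    exact (h i).symm
  refine .of_denotes fun μ x => ⟨?_, ?_⟩
  · rintro ⟨ν, hν, hμ, hi⟩
    rw [Store.holds_append] at hν
    obtain ⟨ν', h1, h2, h3, h4, h5⟩ := p.exists_merge hν.2 hμ
    refine ⟨ν', (hB ν').2 ⟨?_, h3, h4, h5⟩, fun y hy => h2 y ((hV y).1 hy), ?_⟩
    · exact (Store.holds_congr fun x hx => (h1 x (Or.inl (p.r₁.bodyB_vars_subset hx))).symm).1 hν.1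
    · rintro (i | i)
      · rw [← hi]
        refine UserConstraint.inst_congr fun x hx => h1 x (Or.inl (p.r₁.bodyU_vars_subset ?_))
        rw [← hk]
        exact mem_vars_ofFamily.2 ⟨i, hx⟩
      · rw [← hi]
        exact (hgi ν' h5 i).trans (UserConstraint.inst_congr fun x hx => h1 x (p.vars_g₁' hx))
  · rintro ⟨ν, hν, hμ, hi⟩
    obtain ⟨h1, h2, h3, h4⟩ := (hB ν).1 hν
    refine ⟨ν, Store.holds_append.2 ⟨h1, h2⟩, fun y hy => hμ y ((hV y).2 (Or.inl hy)), ?_⟩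
    rintro (i | i)
    · exact hi (Sum.inl i)
    · exact (hgi ν h4 i).symm.trans (hi (Sum.inr i))

/-- The listing in `target_eq` is chosen with the second representative's constraints at `s₂`: what
the first rule leaves of the second head must appear there in the variables of the second rule. -/
theorem eq_left (p : Peak CT P ι c a b) (V : Finset Var) :
    a = ((p.left V).extend p.restGoal p.restStore (p.V₁ ∪ p.V₂)).cls CT := by
  have := p.target_eq (g := fun i => if i ∈ p.s₂ then p.g₂ i else p.g₁ i)
    (B := p.r₁.bodyB ++ pairStore (p.pairs (p.s₁ ∩ p.s₂)) ++ p.restStore) (V := p.V₁ ∪ p.V₂)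
    (fun i => by split <;> simp)
    (fun ν => by
      simp only [restStore, Store.holds_append, holds_pairs, Finset.mem_univ, true_imp_iff]
      tauto) (by simp)
  refine this.trans ?_
  rw [p.compl_eq, subfamily_disjUnion _ p.disjoint_compl]
  simp only [left, CHRState.extend, restGoal, add_assoc]
  rw [subfamily_congr (g' := p.g₂) (s := p.s₂ \ p.s₁) fun i hi => if_pos (Finset.mem_sdiff.1 hi).1,
    subfamily_congr (g' := p.g₁) (s := (p.s₁ ∪ p.s₂)ᶜ) fun i hi => if_neg fun h => by
      simp [h] at hi]

theorem eq_right (p : Peak CT P ι c a b) (V : Finset Var) :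
    b = ((p.right V).extend p.restGoal p.restStore (p.V₁ ∪ p.V₂)).cls CT := by
  have := p.swap.target_eq (g := p.g₁)
    (B := p.r₂.bodyB ++ pairStore (p.pairs (p.s₁ ∩ p.s₂)) ++ p.restStore) (V := p.V₁ ∪ p.V₂)
    (fun i => Or.inr rfl)
    (fun ν => by
      simp only [restStore, Store.holds_append, holds_pairs, Finset.mem_univ, true_imp_iff, swap, @eq_comm _ ((p.g₂ _).inst ν)]
      tauto) (by simp [swap, or_comm])
  refine this.trans ?_
  rw [p.swap.compl_eq, subfamily_disjUnion _ p.swap.disjoint_compl]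
  simp only [right, CHRState.extend, restGoal, add_assoc, swap, Finset.union_comm]

/-- Transitions at disjoint positions commute. -/
theorem joinable_of_disjoint (p : Peak CT P ι c a b) (h : p.s₁ ∩ p.s₂ = ∅) : CHRJoinable CT P a b := by
  have hd : Disjoint p.s₁ p.s₂ := Finset.disjoint_iff_inter_eq_empty.2 h
  have e1 : p.s₁ \ p.s₂ = p.s₁ := Finset.sdiff_eq_self_of_disjoint hd
  have e2 : p.s₂ \ p.s₁ = p.s₂ := Finset.sdiff_eq_self_of_disjoint hd.symm
  obtain ⟨⟨q₁, hq₁, hc₁⟩, -⟩ := p.step₁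
  obtain ⟨⟨q₂, hq₂, hc₂⟩, -⟩ := p.step₂
  -- The argument `∅` is immaterial, as `CHRState.extend` replaces the globals.
  have ha := p.eq_left ∅
  have hb := p.eq_right ∅
  simp only [left, right, CHRState.extend, h, e1, e2, ← p.head₁, ← p.head₂] at ha hb
  rw [show p.r₁.bodyU + p.r₂.head + p.restGoal = p.r₂.head + (p.r₁.bodyU + p.restGoal) by abel] at ha
  rw [show p.r₂.bodyU + p.r₁.head + p.restGoal = p.r₁.head + (p.r₂.bodyU + p.restGoal) by abel] at hb
  have hE : ∀ x, x ∉ (pairStore (p.pairs ∅)).vars := fun x hx => by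
    obtain ⟨i, hi, -⟩ := p.vars_pairs hx
    simp at hi
  have s1 := CHRStep.of_fresh (CT := CT) hq₂ hc₂ (G := p.r₁.bodyU + p.restGoal)
      (B := p.r₁.bodyB ++ pairStore (p.pairs ∅) ++ p.restStore) (V := p.V₁ ∪ p.V₂) fun x hx hxh => by
    obtain ⟨-, h2, h3, h4, h5⟩ := p.fresh₂ hx hxh
    simp only [Goal.vars_add, Store.vars_append, Set.mem_union, not_or]
    exact ⟨⟨fun h => h5 (Or.inl (p.r₁.bodyU_vars_subset h)), h2⟩,
      ⟨⟨fun h => h5 (Or.inl (p.r₁.bodyB_vars_subset h)), hE x⟩, h3⟩, h4⟩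
  have s2 := CHRStep.of_fresh (CT := CT) hq₁ hc₁ (G := p.r₂.bodyU + p.restGoal)
      (B := p.r₂.bodyB ++ pairStore (p.pairs ∅) ++ p.restStore) (V := p.V₁ ∪ p.V₂) fun x hx hxh => by
    obtain ⟨-, h2, h3, h4, h5⟩ := p.fresh₁ hx hxh
    simp only [Goal.vars_add, Store.vars_append, Set.mem_union, not_or]
    exact ⟨⟨fun h => h5 (Or.inl (p.r₂.bodyU_vars_subset h)), h2⟩,
      ⟨⟨fun h => h5 (Or.inl (p.r₂.bodyB_vars_subset h)), hE x⟩, h3⟩, h4⟩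
  refine .of_eq ha hb ⟨_, .single s1, ?_⟩
  convert Relation.ReflTransGen.single s2 using 1
  rw [show p.r₂.bodyU + (p.r₁.bodyU + p.restGoal) = p.r₁.bodyU + (p.r₂.bodyU + p.restGoal) by abel]
  refine SemEquiv.cls_eq (.of_store fun ν => ?_)
  simp only [Store.holds_append]
  tauto

variable {V : Finset Var}

/-- All head variables are in `V`, so the local variables of either member are body variables of its
rule. These are fresh for the context, and joinability extends to it. -/
theorem joinable_of_left_right (p : Peak CT P ι c a b)
    (hV : (V : Set Var) = p.r₁.head.vars ∪ p.r₂.head.vars)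
    (h : CHRJoinable CT P ((p.left V).cls CT) ((p.right V).cls CT)) : CHRJoinable CT P a b := by
  have hV' : ∀ x, x ∈ V ↔ x ∈ p.r₁.head.vars ∨ x ∈ p.r₂.head.vars := fun x => by
    rw [← Finset.mem_coe, hV]
    rfl
  have hE : ∀ x ∈ (pairStore (p.pairs (p.s₁ ∩ p.s₂))).vars, x ∈ V := by
    intro x hx
    obtain ⟨i, hi, hx⟩ := p.vars_pairs hx
    rw [Finset.mem_inter] at hi
    rw [hV', p.head₁, p.head₂, mem_vars_subfamily, mem_vars_subfamily]
    exact hx.imp (fun hx => ⟨i, hi.1, hx⟩) fun hx => ⟨i, hi.2, hx⟩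
  refine .of_eq (p.eq_left V) (p.eq_right V) (h.extend ?_ ?_)
  · rintro x hx hxV
    change x ∉ V at hxV
    have key : x ∈ p.r₁.vars → x ∉ p.restGoal.vars ∧ x ∉ p.restStore.vars ∧ x ∉ p.V₁ ∪ p.V₂ := fun hxr =>
      have := p.fresh₁ hxr fun h => hxV ((hV' x).2 (Or.inl h))
      ⟨this.2.1, this.2.2.1, this.2.2.2.1⟩
    simp only [left, Goal.vars_add, Store.vars_append] at hx
    rcases hx with (hx | hx) | (hx | hx)
    · exact key (p.r₁.bodyU_vars_subset hx)
    · obtain ⟨i, hi, hx⟩ := mem_vars_subfamily.1 hx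
      refine absurd ((hV' x).2 (Or.inr ?_)) hxV
      rw [p.head₂]
      exact mem_vars_subfamily.2 ⟨i, (Finset.mem_sdiff.1 hi).1, hx⟩
    · exact key (p.r₁.bodyB_vars_subset hx)
    · exact absurd (hE x hx) hxV
  · rintro x hx hxV
    change x ∉ V at hxV
    have key : x ∈ p.r₂.vars → x ∉ p.restGoal.vars ∧ x ∉ p.restStore.vars ∧ x ∉ p.V₁ ∪ p.V₂ := fun hxr =>
      have := p.fresh₂ hxr fun h => hxV ((hV' x).2 (Or.inr h))
      ⟨this.2.1, this.2.2.1, this.2.2.2.1⟩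
    simp only [right, Goal.vars_add, Store.vars_append] at hx
    rcases hx with (hx | hx) | (hx | hx)
    · exact key (p.r₂.bodyU_vars_subset hx)
    · obtain ⟨i, hi, hx⟩ := mem_vars_subfamily.1 hx
      refine absurd ((hV' x).2 (Or.inl ?_)) hxV
      rw [p.head₁]
      exact mem_vars_subfamily.2 ⟨i, (Finset.mem_sdiff.1 hi).1, hx⟩
    · exact key (p.r₂.bodyB_vars_subset hx)
    · exact absurd (hE x hx) hxV

end Peak

variable [Infinite Var]

/-- Two transitions from a satisfiable state form a peak over any listing of its goal. -/
theorem exists_peak {σ : CHRState S L Var} {ι : Type} [Fintype ι] [DecidableEq ι]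
    {g : ι → UserConstraint S L Var} (hg : ofFamily g = σ.goal) (hσ : σ.store.Sat CT)
    {a b : StateClass S Var CT} (ha : CHRStep CT P (σ.cls CT) a) (hb : CHRStep CT P (σ.cls CT) b) :
    ∃ p : Peak CT P ι (σ.cls CT) a b,
      ∀ μ x, Denotes CT g σ.store σ.globals μ x ↔ Denotes CT p.g₁ p.B₁ p.V₁ μ x := by
  obtain ⟨r₁, G₁, B₁, V₁, h₁⟩ := chrStep_iff_exists_stepAt.1 ha
  obtain ⟨r₂, G₂, B₂, V₂, h₂⟩ := chrStep_iff_exists_stepAt.1 hb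
  -- Renaming keeps the globals, so the first representative can avoid `V₂` before the second is
  -- renamed away from all of the first.
  obtain ⟨r₁, G₁, B₁, h₁, hF₁⟩ := h₁.exists_avoiding V₂.finite_toSet
  obtain ⟨r₂, G₂, B₂, h₂, hF₂⟩ := h₂.exists_avoiding (F := ↑V₁ ∪ (r₁.vars ∪ (G₁.vars ∪ B₁.vars)))
    (V₁.finite_toSet.union (r₁.vars_finite.union (G₁.vars_finite.union B₁.vars_finite)))
  obtain ⟨g₁, hg₁, hd₁⟩ := (cls_eq_cls_iff.1 h₁.2.2.2.1).exists_family hσ hg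
  obtain ⟨g₂, hg₂, hd₂⟩ := (cls_eq_cls_iff.1 h₂.2.2.2.1).exists_family hσ hg
  obtain ⟨s₁, hs₁, rfl⟩ := exists_subfamily_eq_of_ofFamily_eq_add hg₁
  obtain ⟨s₂, hs₂, rfl⟩ := exists_subfamily_eq_of_ofFamily_eq_add hg₂
  refine ⟨⟨r₁, r₂, g₁, g₂, s₁, s₂, B₁, B₂, V₁, V₂, h₁, h₂, hs₁.symm, hs₂.symm,
    fun μ x => (hd₁ μ x).symm.trans (hd₂ μ x), hF₁, fun x hx hxV => ?_⟩, hd₁⟩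
  have := hF₂ x hx hxV
  simp only [Set.mem_union, not_or, Finset.mem_coe] at this
  exact ⟨this.1, by tauto⟩

end Peaks

/-! ### Ground instances of graph and rule encodings. -/

section Ground

open FirstOrder.Language

variable {TG : FGraph} {M : Type w}

/-- The ground constraint of a node. -/
def groundNode (t : TG.V) (a b : M) : GroundConstraint TG.signature M :=
  ⟨Sum.inl t, (![a, b] : Fin 2 → M)⟩

/-- The ground constraint of an edge. -/
def groundEdge (t : TG.E) (a b c : M) : GroundConstraint TG.signature M :=
  ⟨Sum.inr t, (![a, b, c] : Fin 3 → M)⟩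

theorem groundNode_inj {t t' : TG.V} {a b a' b' : M} (h : groundNode t a b = groundNode t' a' b') :
    t = t' ∧ a = a' ∧ b = b' := by
  obtain ⟨h1, h2⟩ := Sigma.mk.inj_iff.1 h
  cases h1
  have h3 : (![a, b] : Fin 2 → M) = ![a', b'] := eq_of_heq h2
  exact ⟨rfl, congrFun h3 0, congrFun h3 1⟩

theorem groundEdge_inj {t t' : TG.E} {a b c a' b' c' : M}
    (h : groundEdge t a b c = groundEdge t' a' b' c') : t = t' ∧ a = a' ∧ b = b' ∧ c = c' := by
  obtain ⟨h1, h2⟩ := Sigma.mk.inj_iff.1 h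
  cases h1
  have h3 : (![a, b, c] : Fin 3 → M) = ![a', b', c'] := eq_of_heq h2
  exact ⟨rfl, congrFun h3 0, congrFun h3 1, congrFun h3 2⟩

theorem groundNode_ne_groundEdge {t : TG.V} {t' : TG.E} {a b a' b' c' : M} :
    groundNode t a b ≠ groundEdge t' a' b' c' := fun h => by
  cases congrArg Sigma.fst h

/-- The ground constraints of a graph whose nodes and edges `x` are represented by `w x`, with
degree arguments `d`. -/
def TypedGraph.ground (Γ : TypedGraph TG) (w : Γ.V ⊕ Γ.E → M) (d : Γ.V → M) :
    Γ.V ⊕ Γ.E → GroundConstraint TG.signature M :=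
  Sum.elim (fun x => groundNode (Γ.typeV x) (w (Sum.inl x)) (d x))
    (fun e => groundEdge (Γ.typeE e) (w (Sum.inr e)) (w (Sum.inl (Γ.src e))) (w (Sum.inl (Γ.tgt e))))

variable {L : FirstOrder.Language.{u, v}} {Var : Type z}

theorem inst_nodeConstraint [L.Structure M] {t : TG.V} {x : Var} {d : L.Term Var} {ν : Var → M} :
    (nodeConstraint t x d).inst ν = groundNode t (ν x) (d.realize ν) := by
  unfold UserConstraint.inst nodeConstraint groundNode
  congr 1
  funext i
  change Fin 2 at i
  fin_cases i <;> rfl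

theorem inst_edgeConstraint [L.Structure M] {t : TG.E} {x y y' : Var} {ν : Var → M} :
    (edgeConstraint t x y y' : UserConstraint TG.signature L Var).inst ν = groundEdge t (ν x) (ν y) (ν y') := by
  unfold UserConstraint.inst edgeConstraint groundEdge
  congr 1
  funext i
  change Fin 3 at i
  fin_cases i <;> rfl

variable (CT : ConstraintTheory.{u, v, w} L)

/-- The constraints of `chr(gnd, G)`, listed by the nodes and edges of `G`. -/
noncomputable def chrGndFamily (G : TypedGraph TG) (nm : G.V ⊕ G.E → Var) :
    G.V ⊕ G.E → UserConstraint TG.signature L Var :=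
  Sum.elim (fun x => nodeConstraint (G.typeV x) (nm (Sum.inl x)) (CT.numT (G.deg x)))
    (fun e => edgeConstraint (G.typeE e) (nm (Sum.inr e)) (nm (Sum.inl (G.src e))) (nm (Sum.inl (G.tgt e))))

theorem ofFamily_chrGndFamily (G : TypedGraph TG) (nm : G.V ⊕ G.E → Var) :
    ofFamily (chrGndFamily CT G nm) = chrGnd CT G nm :=
  ofFamily_sumElim _ _

variable {CT}

theorem inst_chrGndFamily {G : TypedGraph TG} {nm : G.V ⊕ G.E → Var} {ν : Var → CT.carrier}
    (i : G.V ⊕ G.E) :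
    (chrGndFamily CT G nm i).inst ν = G.ground (ν ∘ nm) (fun x => (CT.num (G.deg x) : CT.carrier)) i := by
  rcases i with x | e
  · simp [chrGndFamily, TypedGraph.ground, inst_nodeConstraint, ConstraintTheory.realize_numT]
  · simp [chrGndFamily, TypedGraph.ground, inst_edgeConstraint]

variable (CT)

open Classical in
/-- The constraints of the head of a rule, listed by the nodes and edges of its left-hand side. -/
noncomputable def GTSRule.headFamily (p : GTSRule TG) (nm : RuleVar p → Var) :
    p.L.V ⊕ p.L.E → UserConstraint TG.signature L Var :=
  Sum.elim (fun x => nodeConstraint (p.L.typeV x) (nm (.nodeL x))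
      (if x ∈ Set.range p.l.onV then Term.var (nm (.dvar x)) else CT.numT (p.L.deg x)))
    (fun e => edgeConstraint (p.L.typeE e) (nm (.edgeL e)) (nm (.nodeL (p.L.src e))) (nm (.nodeL (p.L.tgt e))))

theorem GTSRule.ofFamily_headFamily (p : GTSRule TG) (nm : RuleVar p → Var) :
    ofFamily (p.headFamily CT nm) = p.chrHead CT nm :=
  ofFamily_sumElim _ _

theorem nodeConstraint_mapArgs (f : Var → Var) (t : TG.V) (x : Var) (d : L.Term Var) :
    (nodeConstraint t x d).mapArgs (Term.relabel f) = nodeConstraint t (f x) (d.relabel f) := by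
  unfold UserConstraint.mapArgs nodeConstraint
  congr 1
  funext i
  change Fin 2 at i
  fin_cases i <;> rfl

theorem edgeConstraint_mapArgs (f : Var → Var) (t : TG.E) (x y y' : Var) :
    (edgeConstraint t x y y' : UserConstraint TG.signature L Var).mapArgs (Term.relabel f) =
      edgeConstraint t (f x) (f y) (f y') := by
  unfold UserConstraint.mapArgs edgeConstraint
  congr 1
  funext i
  change Fin 3 at i
  fin_cases i <;> rfl

/-- Because of this, the head of a copy of an encoded rule is the encoded head under other names,
and `headFamily` applies to it. -/
theorem GTSRule.rename_chrHead (p : GTSRule TG) (nm : RuleVar p → Var) (f : Var → Var) :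
    (p.chrHead CT nm).rename f = p.chrHead CT (f ∘ nm) := by
  rw [← ofFamily_headFamily, ← ofFamily_headFamily, Goal.rename, map_ofFamily]
  congr 1
  funext i
  rcases i with x | e
  · simp only [Function.comp, headFamily, Sum.elim_inl, nodeConstraint_mapArgs]
    split
    · rfl
    · simp only [ConstraintTheory.numT, Constants.term, Term.relabel]
      congr 2
      exact funext fun i => i.elim0
  · simp only [Function.comp, headFamily, Sum.elim_inr, edgeConstraint_mapArgs]

/-- The variables that occur in the head of a rule. -/
def RuleVar.InHead {p : GTSRule TG} : RuleVar p → Prop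
  | .nodeL _ => True
  | .edgeL _ => True
  | .dvar x => x ∈ Set.range p.l.onV
  | _ => False

theorem RuleVar.InHead.mem_vars [DecidableEq Var] {p : GTSRule TG} {nm : RuleVar p → Var} {z : RuleVar p}
    (hz : z.InHead) : nm z ∈ (p.chrHead CT nm).vars := by
  have hnode : ∀ (t : TG.V) (x : Var) (d : L.Term Var), x ∈ (nodeConstraint t x d).vars ∧
      termVars d ⊆ (nodeConstraint t x d).vars := fun t x d =>
    ⟨⟨(0 : Fin 2), (termVars_var (L := L) x).symm ▸ Set.mem_singleton x⟩, fun y hy => ⟨(1 : Fin 2), hy⟩⟩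
  have hedge : ∀ (t : TG.E) (x y y' : Var),
      x ∈ (edgeConstraint t x y y' : UserConstraint TG.signature L Var).vars := fun t x y y' =>
    ⟨(0 : Fin 3), (termVars_var (L := L) x).symm ▸ Set.mem_singleton x⟩
  rw [← GTSRule.ofFamily_headFamily, mem_vars_ofFamily]
  cases z with
  | nodeL x => exact ⟨Sum.inl x, (hnode _ _ _).1⟩
  | edgeL e => exact ⟨Sum.inr e, hedge _ _ _ _⟩
  | dvar x =>
    have hx : x ∈ Set.range p.l.onV := hz
    refine ⟨Sum.inl x, (hnode _ _ _).2 ?_⟩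
    rw [if_pos hx, termVars_var]
    exact Set.mem_singleton _
  | nodeR x hx => exact hz.elim
  | edgeR e he => exact hz.elim
  | nodeK' x => exact hz.elim
  | dvarK' x => exact hz.elim

/-- Variables and integer constants. -/
def IsAtomTerm (t : L.Term Var) : Prop :=
  (∃ x, t = Term.var x) ∨ ∃ n : ℤ, t = CT.numT n

open Classical in
theorem GTSRule.isAtomTerm_args (p : GTSRule TG) (nm : RuleVar p → Var) (i : p.L.V ⊕ p.L.E)
    (k : Fin (TG.signature.arity (p.headFamily CT nm i).sym)) :
    IsAtomTerm CT ((p.headFamily CT nm i).args k) := by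
  rcases i with x | e
  · change Fin 2 at k
    fin_cases k
    · exact Or.inl ⟨_, rfl⟩
    · change IsAtomTerm CT (if x ∈ Set.range p.l.onV then Term.var (nm (.dvar x)) else CT.numT (p.L.deg x))
      split
      exacts [Or.inl ⟨_, rfl⟩, Or.inr ⟨_, rfl⟩]
  · change Fin 3 at k
    fin_cases k
    all_goals exact Or.inl ⟨_, rfl⟩

/-- Satisfiability excludes the branch `⊥`, so only equations between arguments are left. -/
theorem UserConstraint.exists_args_of_mem_equate {S : UserSignature} {c d : UserConstraint S L Var}
    {b : Builtin L Var} (hb : b ∈ c.equate d) (h : (c.equate d).Sat CT) :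
    ∃ i j, b = .eq (c.args i) (d.args j) := by
  obtain ⟨ν, hν⟩ := h
  unfold UserConstraint.equate at hb hν
  split at hb
  · obtain ⟨i, rfl⟩ := List.mem_ofFn.1 hb
    exact ⟨_, _, rfl⟩
  · next hne =>
    rw [dif_neg hne] at hν
    exact (hν _ (List.mem_singleton_self _)).elim

/-- Satisfiable equations between variables and integer constants can be written as constraints
`X = c` and `X = Y`. -/
theorem Store.exists_adjustments {B : Store L Var} (hB : B.Sat CT)
    (h : ∀ b ∈ B, ∃ s t, b = .eq s t ∧ IsAtomTerm CT s ∧ IsAtomTerm CT t) :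
    ∃ B' : Store L Var, (∀ b ∈ B', IsConstEq b ∨ IsAdjustment CT b) ∧
      ∀ ν : Var → CT.carrier, B'.Holds CT ν ↔ B.Holds CT ν := by
  induction B with
  | nil => exact ⟨[], by simp, fun _ => Iff.rfl⟩
  | cons b B ih =>
    obtain ⟨ν₀, hν₀⟩ := hB
    rw [Store.holds_cons] at hν₀
    obtain ⟨B', h1, h2⟩ := ih ⟨ν₀, hν₀.2⟩ fun b hb => h b (List.mem_cons_of_mem _ hb)
    have key : ∀ b' : Builtin L Var, (IsConstEq b' ∨ IsAdjustment CT b') →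
        (∀ ν : Var → CT.carrier, b'.Holds CT ν ↔ b.Holds CT ν) →
        ∃ B' : Store L Var, (∀ b ∈ B', IsConstEq b ∨ IsAdjustment CT b) ∧
          ∀ ν : Var → CT.carrier, B'.Holds CT ν ↔ Store.Holds CT ν (b :: B) := fun b' hb' hiff =>
      ⟨b' :: B', by simpa using ⟨hb', h1⟩, fun ν => by
        rw [Store.holds_cons, Store.holds_cons, hiff, h2]⟩
    obtain ⟨s, t, rfl, hs, ht⟩ := h b List.mem_cons_self
    rcases hs with ⟨x, rfl⟩ | ⟨m, rfl⟩ <;> rcases ht with ⟨y, rfl⟩ | ⟨n, rfl⟩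
    · exact key _ (Or.inr (.var x y)) fun _ => Iff.rfl
    · exact key _ (Or.inl (.const x (CT.num n))) fun _ => Iff.rfl
    · exact key _ (Or.inl (.const y (CT.num m))) fun _ => ⟨Eq.symm, Eq.symm⟩
    -- An equation between numerals has neither of the admitted forms, but its truth does not depend
    -- on the valuation; being satisfiable it is true and is dropped.
    · refine ⟨B', h1, fun ν => ?_⟩
      have h0 : (CT.numT m : L.Term Var).realize ν₀ = (CT.numT n : L.Term Var).realize ν₀ := hν₀.1
      rw [ConstraintTheory.realize_numT, ConstraintTheory.realize_numT] at h0
      have : (Builtin.eq (CT.numT m) (CT.numT n) : Builtin L Var).Holds CT ν := by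
        change (CT.numT m : L.Term Var).realize ν = (CT.numT n : L.Term Var).realize ν
        rw [ConstraintTheory.realize_numT, ConstraintTheory.realize_numT, h0]
      rw [Store.holds_cons, h2]
      exact (and_iff_right this).symm

end Ground

/-! ### Matches of rules in graphs and subgraphs. -/

section Matches

open FirstOrder.Language

variable {TG : FGraph} {L : FirstOrder.Language.{u, v}} {Var : Type z}
  {CT : ConstraintTheory.{u, v, w} L}

/-- Outgoing and incoming edges are counted separately, each injected by `m`; injectivity on nodes
is not needed. -/
theorem TypedHom.deg_le {G H : TypedGraph TG} (m : TypedHom G H) (hm : Function.Injective m.onE) (x : G.V) :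
    G.deg x ≤ H.deg (m.onV x) := by
  refine add_le_add ?_ ?_
  · refine Set.ncard_le_ncard_of_injOn m.onE (fun e he => ?_) hm.injOn (Set.toFinite _)
    have he : G.src e = x := he
    exact (m.map_src e).symm.trans (congrArg m.onV he)
  · refine Set.ncard_le_ncard_of_injOn m.onE (fun e he => ?_) hm.injOn (Set.toFinite _)
    have he : G.tgt e = x := he
    exact (m.map_tgt e).symm.trans (congrArg m.onV he)

theorem GTSRule.inst_headFamily (p : GTSRule TG) {Γ : TypedGraph TG} (m : TypedHom p.L Γ)
    {nm : RuleVar p → Var} {ν : Var → CT.carrier} {w : Γ.V ⊕ Γ.E → CT.carrier} {d : Γ.V → CT.carrier}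
    (hV : ∀ x, ν (nm (.nodeL x)) = w (Sum.inl (m.onV x)))
    (hE : ∀ e, ν (nm (.edgeL e)) = w (Sum.inr (m.onE e)))
    (hK : ∀ x ∈ Set.range p.l.onV, ν (nm (.dvar x)) = d (m.onV x))
    (hL : ∀ x ∉ Set.range p.l.onV, (CT.num (p.L.deg x) : CT.carrier) = d (m.onV x)) (i : p.L.V ⊕ p.L.E) :
    (p.headFamily CT nm i).inst ν = Γ.ground w d (Sum.map m.onV m.onE i) := by
  rcases i with x | e
  · simp only [headFamily, TypedGraph.ground, Sum.elim_inl, Sum.map_inl, inst_nodeConstraint, hV, m.map_typeV]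
    congr 1
    split
    · next h => exact hK x h
    · next h => exact ConstraintTheory.realize_numT _ _ |>.trans (hL x h)
  · simp only [headFamily, TypedGraph.ground, Sum.elim_inr, Sum.map_inr, inst_edgeConstraint, hV, hE,
      m.map_typeE, m.map_src, m.map_tgt]

/-- Constraints of a graph encoding that instantiate the head of a rule form a match of the rule. -/
theorem GTSRule.exists_match (p : GTSRule TG) {Γ : TypedGraph TG} {nm : RuleVar p → Var}
    {ν : Var → CT.carrier} {w : Γ.V ⊕ Γ.E → CT.carrier} (hw : Function.Injective w) {d : Γ.V → CT.carrier}
    {j : p.L.V ⊕ p.L.E → Γ.V ⊕ Γ.E} (hj : ∀ i, (p.headFamily CT nm i).inst ν = Γ.ground w d (j i)) :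
    ∃ m : TypedHom p.L Γ, j = Sum.map m.onV m.onE ∧
      ∀ x ∉ Set.range p.l.onV, d (m.onV x) = (CT.num (p.L.deg x) : CT.carrier) := by
  have hV : ∀ x, ∃ y, j (Sum.inl x) = Sum.inl y := by
    intro x
    have h := hj (Sum.inl x)
    rcases hy : j (Sum.inl x) with y | e
    · exact ⟨y, rfl⟩
    · rw [hy] at h
      simp only [headFamily, Sum.elim_inl, inst_nodeConstraint, TypedGraph.ground, Sum.elim_inr] at h
      exact absurd h groundNode_ne_groundEdge
  have hE : ∀ e, ∃ y, j (Sum.inr e) = Sum.inr y := by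
    intro e
    have h := hj (Sum.inr e)
    rcases hy : j (Sum.inr e) with y | e
    · rw [hy] at h
      simp only [headFamily, Sum.elim_inl, inst_edgeConstraint, TypedGraph.ground, Sum.elim_inr] at h
      exact absurd h.symm groundNode_ne_groundEdge
    · exact ⟨_, rfl⟩
  choose mV hmV using hV
  choose mE hmE using hE
  have hnode := fun x => hj (Sum.inl x)
  have hedge := fun e => hj (Sum.inr e)
  simp only [hmV, hmE, headFamily, Sum.elim_inl, Sum.elim_inr, inst_nodeConstraint, inst_edgeConstraint,
    TypedGraph.ground] at hnode hedge
  refine ⟨⟨mV, mE, fun e => ?_, fun e => ?_, fun x => (groundNode_inj (hnode x)).1.symm,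
    fun e => (groundEdge_inj (hedge e)).1.symm⟩, ?_, fun x hx => ?_⟩
  -- The source of an edge and its node constraint share a head variable, so their images in `Γ`
  -- have the same name; names being distinct, the nodes coincide.
  · have h1 := (groundNode_inj (hnode (p.L.src e))).2.1
    have h2 := (groundEdge_inj (hedge e)).2.2.1
    exact Sum.inl_injective (hw (h1.symm.trans h2))
  · have h1 := (groundNode_inj (hnode (p.L.tgt e))).2.1
    have h2 := (groundEdge_inj (hedge e)).2.2.2
    exact Sum.inl_injective (hw (h1.symm.trans h2))
  · funext i
    rcases i with x | e
    exacts [hmV x, hmE e]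
  · have h := (groundNode_inj (hnode x)).2.2
    rw [if_neg hx, ConstraintTheory.realize_numT] at h
    exact h.symm

open Classical in
/-- The subgraph of the nodes and edges in a set that contains the ends of its edges. -/
noncomputable def TypedGraph.restrict (Γ : TypedGraph TG) (X : Set (Γ.V ⊕ Γ.E))
    (hX : ∀ e, Sum.inr e ∈ X → Sum.inl (Γ.src e) ∈ X ∧ Sum.inl (Γ.tgt e) ∈ X) : TypedGraph TG where
  V := {x : Γ.V // Sum.inl x ∈ X}
  E := {e : Γ.E // Sum.inr e ∈ X}
  src e := ⟨Γ.src e, (hX e e.2).1⟩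
  tgt e := ⟨Γ.tgt e, (hX e e.2).2⟩
  typeV x := Γ.typeV x
  typeE e := Γ.typeE e
  type_src e := Γ.type_src e
  type_tgt e := Γ.type_tgt e

/-- The inclusion of a subgraph. -/
noncomputable def TypedGraph.restrictIncl (Γ : TypedGraph TG) (X : Set (Γ.V ⊕ Γ.E))
    (hX : ∀ e, Sum.inr e ∈ X → Sum.inl (Γ.src e) ∈ X ∧ Sum.inl (Γ.tgt e) ∈ X) :
    TypedHom (Γ.restrict X hX) Γ where
  onV := Subtype.val
  onE := Subtype.val
  map_src _ := rfl
  map_tgt _ := rfl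
  map_typeV _ := rfl
  map_typeE _ := rfl

/-- The restriction of a morphism to a subgraph that contains its image. -/
noncomputable def TypedHom.codRestrict {G Γ : TypedGraph TG} (m : TypedHom G Γ) (X : Set (Γ.V ⊕ Γ.E))
    (hX : ∀ e, Sum.inr e ∈ X → Sum.inl (Γ.src e) ∈ X ∧ Sum.inl (Γ.tgt e) ∈ X)
    (hm : ∀ i, Sum.map m.onV m.onE i ∈ X) : TypedHom G (Γ.restrict X hX) where
  onV x := ⟨m.onV x, hm (Sum.inl x)⟩
  onE e := ⟨m.onE e, hm (Sum.inr e)⟩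
  map_src e := Subtype.ext (m.map_src e)
  map_tgt e := Subtype.ext (m.map_tgt e)
  map_typeV x := m.map_typeV x
  map_typeE e := m.map_typeE e

/-- Serves in both directions between names in a graph and values of rule variables: on overlapping
images the two prescriptions must agree, and on disjoint ones there is nothing to check. -/
theorem exists_common_extension {α β γ M : Type*} [Nonempty M] {f : α → γ} {g : β → γ}
    (hf : Function.Injective f) (hg : Function.Injective g) (a : α → M) (b : β → M)
    (h : ∀ x y, f x = g y → a x = b y) : ∃ w : γ → M, (∀ x, w (f x) = a x) ∧ ∀ y, w (g y) = b y := by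
  classical
  refine ⟨Function.extend f a (Function.extend g b fun _ => Classical.arbitrary M),
    fun x => hf.extend_apply _ _ _, fun y => ?_⟩
  by_cases hy : ∃ x, f x = g y
  · obtain ⟨x, hx⟩ := hy
    rw [← hx, hf.extend_apply, h x y hx]
  · rw [Function.extend_apply' _ _ _ hy, hg.extend_apply]

theorem exists_embedding_of_subfamily_eq {α ι κ : Type*} [Fintype κ] {g : ι → α}
    {s : Finset ι} {h : κ → α} (hs : ofFamily h = subfamily g s) :
    ∃ e : κ ↪ ι, (∀ k, g (e k) = h k) ∧ ∀ i, i ∈ s ↔ ∃ k, e k = i := by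
  rw [subfamily_eq_ofFamily] at hs
  obtain ⟨e, he⟩ := exists_equiv_of_ofFamily_eq hs
  refine ⟨e.toEmbedding.trans (Function.Embedding.subtype _), fun k => congrFun he k, fun i => ?_⟩
  constructor
  · intro hi
    exact ⟨e.symm ⟨i, hi⟩, by simp⟩
  · rintro ⟨k, rfl⟩
    exact (e k).2

end Matches

/-! ### The graph invariant of an overlap. -/

section Overlaps

open FirstOrder.Language

variable {TG : FGraph} {L : FirstOrder.Language.{u, v}} {Var : Type z} {CT : ConstraintTheory.{u, v, w} L}

open Classical in
/-- The equations that assign their degrees in `Γ` to the degree variables of a rule. -/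
noncomputable def degreeStore (CT : ConstraintTheory.{u, v, w} L) (q : GTSRule TG) (nm : RuleVar q → Var)
    {Γ : TypedGraph TG} (m : TypedHom q.L Γ) : Store L Var :=
  (Finset.univ.filter fun x => x ∈ Set.range q.l.onV).toList.map fun x =>
    Builtin.eq (Term.var (nm (.dvar x))) (CT.numT (Γ.deg (m.onV x)))

theorem isConstEq_of_mem_degreeStore {q : GTSRule TG} {nm : RuleVar q → Var} {Γ : TypedGraph TG}
    {m : TypedHom q.L Γ} {b : Builtin L Var} (hb : b ∈ degreeStore CT q nm m) : IsConstEq b := by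
  obtain ⟨x, -, rfl⟩ := List.mem_map.1 hb
  exact .const _ (CT.num _)

theorem holds_degreeStore {q : GTSRule TG} {nm : RuleVar q → Var} {Γ : TypedGraph TG}
    {m : TypedHom q.L Γ} {ν : Var → CT.carrier} : (degreeStore CT q nm m).Holds CT ν ↔
      ∀ x ∈ Set.range q.l.onV, ν (nm (.dvar x)) = (CT.num (Γ.deg (m.onV x)) : CT.carrier) := by
  classical
  simp only [degreeStore, Store.Holds, List.forall_mem_map, Finset.mem_toList, Finset.mem_filter,
    Finset.mem_univ, true_and]
  refine forall₂_congr fun x _ => ?_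
  change ν _ = (CT.numT _ : L.Term Var).realize ν ↔ _
  rw [ConstraintTheory.realize_numT]

theorem ConstraintTheory.nonempty_carrier (CT : ConstraintTheory.{u, v, w} L) : Nonempty CT.carrier :=
  ⟨(CT.num 0 : CT.carrier)⟩

/-- The valuation of the head variables of a rule given by a matched graph. -/
noncomputable def headValue {q : GTSRule TG} {Γ : TypedGraph TG} (m : TypedHom q.L Γ) (w : Γ.V ⊕ Γ.E → CT.carrier) :
    RuleVar q → CT.carrier
  | .nodeL x => w (Sum.inl (m.onV x))
  | .edgeL e => w (Sum.inr (m.onE e))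
  | .dvar x => (CT.num (Γ.deg (m.onV x)) : CT.carrier)
  | _ => (CT.num 0 : CT.carrier)

theorem GTSRule.inst_headFamily_of_headValue {q : GTSRule TG} {Γ : TypedGraph TG} {m : TypedHom q.L Γ}
    {w : Γ.V ⊕ Γ.E → CT.carrier} {nm : RuleVar q → Var} {ν : Var → CT.carrier}
    (hdeg : ∀ x ∉ Set.range q.l.onV, Γ.deg (m.onV x) = q.L.deg x)
    (h : ∀ z : RuleVar q, z.InHead → ν (nm z) = headValue m w z) (i : q.L.V ⊕ q.L.E) :
    (q.headFamily CT nm i).inst ν =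
      Γ.ground w (fun x => (CT.num (Γ.deg x) : CT.carrier)) (Sum.map m.onV m.onE i) :=
  q.inst_headFamily m (fun x => h (.nodeL x) trivial) (fun e => h (.edgeL e) trivial)
    (fun x hx => h (.dvar x) hx) (fun x hx => by rw [hdeg x hx]) i

variable [DecidableEq Var] [Infinite Var] {P : Set (CHRRule TG.signature L Var)}

/-- The overlap of two matches in a graph encodes the union of their images. -/
theorem Peak.graphInvariant_overlap {Γ : TypedGraph TG} [DecidableEq (Γ.V ⊕ Γ.E)]
    {c a b : StateClass TG.signature Var CT} (p : Peak CT P (Γ.V ⊕ Γ.E) c a b) {q₁ q₂ : GTSRule TG}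
    {n₁ : RuleVar q₁ → Var} {n₂ : RuleVar q₂ → Var} (hn₁ : Function.Injective n₁)
    (hn₂ : Function.Injective n₂) (hdisj : ∀ z z', z.InHead → z'.InHead → n₁ z ≠ n₂ z')
    {m₁ : TypedHom q₁.L Γ} {m₂ : TypedHom q₂.L Γ} (hm₁ : Function.Injective (Sum.map m₁.onV m₁.onE))
    (hm₂ : Function.Injective (Sum.map m₂.onV m₂.onE))
    (hd₁ : ∀ x ∉ Set.range q₁.l.onV, Γ.deg (m₁.onV x) = q₁.L.deg x)
    (hd₂ : ∀ x ∉ Set.range q₂.l.onV, Γ.deg (m₂.onV x) = q₂.L.deg x)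
    (hg₁ : ∀ i, p.g₁ (Sum.map m₁.onV m₁.onE i) = q₁.headFamily CT n₁ i)
    (hg₂ : ∀ i, p.g₂ (Sum.map m₂.onV m₂.onE i) = q₂.headFamily CT n₂ i)
    (hs₁ : ∀ i, i ∈ p.s₁ ↔ ∃ k, Sum.map m₁.onV m₁.onE k = i)
    (hs₂ : ∀ i, i ∈ p.s₂ ↔ ∃ k, Sum.map m₂.onV m₂.onE k = i) (V : Finset Var) :
    GraphInvariant CT (p.overlap V) := by
  have : Nonempty CT.carrier := CT.nonempty_carrier
  set X : Set (Γ.V ⊕ Γ.E) := {i | i ∈ p.s₁ ∨ i ∈ p.s₂} with hXdef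
  have hmem₁ : ∀ i, Sum.map m₁.onV m₁.onE i ∈ X := fun i => Or.inl ((hs₁ _).2 ⟨i, rfl⟩)
  have hmem₂ : ∀ i, Sum.map m₂.onV m₂.onE i ∈ X := fun i => Or.inr ((hs₂ _).2 ⟨i, rfl⟩)
  -- Each image is closed under the ends of edges because matches are morphisms, so the union is a
  -- subgraph.
  have hX : ∀ e, Sum.inr e ∈ X → Sum.inl (Γ.src e) ∈ X ∧ Sum.inl (Γ.tgt e) ∈ X := by
    rintro e (he | he)
    · obtain ⟨k | k, hk⟩ := (hs₁ _).1 he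
      · cases hk
      · obtain rfl := Sum.inr_injective hk
        rw [← m₁.map_src, ← m₁.map_tgt]
        exact ⟨hmem₁ (Sum.inl _), hmem₁ (Sum.inl _)⟩
    · obtain ⟨k | k, hk⟩ := (hs₂ _).1 he
      · cases hk
      · obtain rfl := Sum.inr_injective hk
        rw [← m₂.map_src, ← m₂.map_tgt]
        exact ⟨hmem₂ (Sum.inl _), hmem₂ (Sum.inl _)⟩
  set Δ := Γ.restrict X hX with hΔ
  set ι : TypedHom Δ Γ := Γ.restrictIncl X hX with hι
  set k₁ : TypedHom q₁.L Δ := m₁.codRestrict X hX hmem₁ with hk₁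
  set k₂ : TypedHom q₂.L Δ := m₂.codRestrict X hX hmem₂ with hk₂
  set φ : Δ.V ⊕ Δ.E → Γ.V ⊕ Γ.E := Sum.map ι.onV ι.onE with hφ
  have hφinj : Function.Injective φ :=
    Function.Injective.sumMap Subtype.val_injective Subtype.val_injective
  have hφ₁ : ∀ i, φ (Sum.map k₁.onV k₁.onE i) = Sum.map m₁.onV m₁.onE i := by
    rintro (x | e) <;> rfl
  have hφ₂ : ∀ i, φ (Sum.map k₂.onV k₂.onE i) = Sum.map m₂.onV m₂.onE i := by
    rintro (x | e) <;> rfl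
  have hk₁inj : Function.Injective (Sum.map k₁.onV k₁.onE) := fun i j h => hm₁ (by
    rw [← hφ₁, ← hφ₁, h])
  have hk₂inj : Function.Injective (Sum.map k₂.onV k₂.onE) := fun i j h => hm₂ (by
    rw [← hφ₂, ← hφ₂, h])
  -- The degree in `Δ` is squeezed between those in `G` and in `Γ`, which are equal.
  have hdeg : ∀ {G : TypedGraph TG} (k : TypedHom G Δ), Function.Injective k.onE → ∀ x,
      Γ.deg (ι.onV (k.onV x)) = G.deg x → Δ.deg (k.onV x) = G.deg x := fun k hk x hx =>
    le_antisymm (hx ▸ ι.deg_le Subtype.val_injective _) (k.deg_le hk x)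
  have hk₁d : ∀ x ∉ Set.range q₁.l.onV, Δ.deg (k₁.onV x) = q₁.L.deg x := fun x hx =>
    hdeg k₁ (Sum.map_injective.1 hk₁inj).2 x (hd₁ x hx)
  have hk₂d : ∀ x ∉ Set.range q₂.l.onV, Δ.deg (k₂.onV x) = q₂.L.deg x := fun x hx =>
    hdeg k₂ (Sum.map_injective.1 hk₂inj).2 x (hd₂ x hx)
  have hφs₁ : ∀ i, φ i ∈ p.s₁ ↔ ∃ k, Sum.map k₁.onV k₁.onE k = i := fun i => by
    simp only [hs₁, ← hφ₁, hφinj.eq_iff]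
  have hφs₂ : ∀ i, φ i ∈ p.s₂ ↔ ∃ k, Sum.map k₂.onV k₂.onE k = i := fun i => by
    simp only [hs₂, ← hφ₂, hφinj.eq_iff]
  have hφX : ∀ i, i ∈ p.s₁ ∨ i ∈ p.s₂ ↔ ∃ j, φ j = i := by
    rintro (x | e)
    · constructor
      · exact fun h => ⟨Sum.inl ⟨x, h⟩, rfl⟩
      · rintro ⟨x' | e', h⟩
        · obtain rfl := Sum.inl_injective h
          exact x'.2
        · cases h
    · constructor
      · exact fun h => ⟨Sum.inr ⟨e, h⟩, rfl⟩
      · rintro ⟨x' | e', h⟩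
        · cases h
        · obtain rfl := Sum.inr_injective h
          exact e'.2
  set d : Δ.V → CT.carrier := fun x => (CT.num (Δ.deg x) : CT.carrier) with hd
  -- These are the added equations `X = c`: the degree variables of preserved nodes receive the
  -- degrees in `Δ`, not those in `Γ`.
  set D : Store L Var := degreeStore CT q₁ n₁ k₁ ++ degreeStore CT q₂ n₂ k₂ with hD
  set E : Store L Var := pairStore (p.pairs (p.s₁ ∩ p.s₂)) with hE
  have hcov : ∀ (ν : Var → CT.carrier) (w : Δ.V ⊕ Δ.E → CT.carrier),
      (∀ i, (q₁.headFamily CT n₁ i).inst ν = Δ.ground w d (Sum.map k₁.onV k₁.onE i)) →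
      (∀ i, (q₂.headFamily CT n₂ i).inst ν = Δ.ground w d (Sum.map k₂.onV k₂.onE i)) →
      ∀ i, (φ i ∈ p.s₁ → (p.g₁ (φ i)).inst ν = Δ.ground w d i) ∧
        (φ i ∈ p.s₂ → (p.g₂ (φ i)).inst ν = Δ.ground w d i) := by
    intro ν w h1 h2 i
    constructor
    · intro hi
      obtain ⟨k, rfl⟩ := (hφs₁ i).1 hi
      rw [hφ₁, hg₁, h1]
    · intro hi
      obtain ⟨k, rfl⟩ := (hφs₂ i).1 hi
      rw [hφ₂, hg₂, h2]
  -- A solution names every node and edge of `Δ` through the rule that covers it; where both rules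
  -- do, `E` forces the two names to agree.
  have hto : ∀ ν : Var → CT.carrier, E.Holds CT ν → D.Holds CT ν → ∃ w : Δ.V ⊕ Δ.E → CT.carrier,
      ∀ i, (φ i ∈ p.s₁ → (p.g₁ (φ i)).inst ν = Δ.ground w d i) ∧
        (φ i ∈ p.s₂ → (p.g₂ (φ i)).inst ν = Δ.ground w d i) := by
    intro ν hEν hDν
    rw [hE, Peak.holds_pairs] at hEν
    rw [hD, Store.holds_append, holds_degreeStore, holds_degreeStore] at hDν
    obtain ⟨w, hw₁, hw₂⟩ := exists_common_extension hk₁inj hk₂inj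
      (Sum.elim (fun x => ν (n₁ (.nodeL x))) fun e => ν (n₁ (.edgeL e)))
      (Sum.elim (fun x => ν (n₂ (.nodeL x))) fun e => ν (n₂ (.edgeL e))) (by
        intro i j hij
        have h := hEν (φ (Sum.map k₁.onV k₁.onE i)) (Finset.mem_inter.2
          ⟨(hφs₁ _).2 ⟨i, rfl⟩, (hφs₂ _).2 ⟨j, hij.symm⟩⟩)
        rw [hφ₁, hg₁, ← hφ₁, hij, hφ₂, hg₂] at h
        rcases i with x | e <;> rcases j with y | e' <;>
          simp only [GTSRule.headFamily, Sum.elim_inl, Sum.elim_inr, inst_nodeConstraint,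
            inst_edgeConstraint] at h ⊢
        · exact (groundNode_inj h).2.1
        · exact absurd h groundNode_ne_groundEdge
        · exact absurd h.symm groundNode_ne_groundEdge
        · exact (groundEdge_inj h).2.1)
    refine ⟨w, hcov ν w ?_ ?_⟩
    · exact q₁.inst_headFamily k₁ (fun x => (hw₁ (Sum.inl x)).symm) (fun e => (hw₁ (Sum.inr e)).symm)
        hDν.1 (fun x hx => by simp only [hd, hk₁d x hx])
    · exact q₂.inst_headFamily k₂ (fun x => (hw₂ (Sum.inl x)).symm) (fun e => (hw₂ (Sum.inr e)).symm)
        hDν.2 (fun x hx => by simp only [hd, hk₂d x hx])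
  -- Conversely any naming of `Δ` assigns values to the head variables of each rule separately,
  -- these being disjoint. Then `E` holds, since both constraints at a common position become the
  -- same ground constraint of `Δ`.
  have hfrom : ∀ w : Δ.V ⊕ Δ.E → CT.carrier, ∃ ν : Var → CT.carrier, E.Holds CT ν ∧ D.Holds CT ν ∧
      ∀ i, (φ i ∈ p.s₁ → (p.g₁ (φ i)).inst ν = Δ.ground w d i) ∧
        (φ i ∈ p.s₂ → (p.g₂ (φ i)).inst ν = Δ.ground w d i) := by
    intro w
    obtain ⟨ν, hν₁, hν₂⟩ := exists_common_extension
      (f := fun z : {z : RuleVar q₁ // z.InHead} => n₁ z) (g := fun z : {z : RuleVar q₂ // z.InHead} => n₂ z)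
      (hn₁.comp Subtype.val_injective) (hn₂.comp Subtype.val_injective) (fun z => headValue k₁ w z.1)
      (fun z => headValue k₂ w z.1) fun z z' h => absurd h (hdisj _ _ z.2 z'.2)
    have hall := hcov ν w
      (GTSRule.inst_headFamily_of_headValue hk₁d fun z hz => hν₁ ⟨z, hz⟩)
      (GTSRule.inst_headFamily_of_headValue hk₂d fun z hz => hν₂ ⟨z, hz⟩)
    refine ⟨ν, ?_, ?_, hall⟩
    · rw [hE, Peak.holds_pairs]
      intro i hi
      rw [Finset.mem_inter] at hi
      obtain ⟨j, rfl⟩ := (hφX i).1 (Or.inl hi.1)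
      rw [(hall j).1 hi.1, (hall j).2 hi.2]
    · rw [hD, Store.holds_append, holds_degreeStore, holds_degreeStore]
      exact ⟨fun x hx => hν₁ ⟨.dvar x, hx⟩, fun x hx => hν₂ ⟨.dvar x, hx⟩⟩
  have hEsat : E.Sat CT := by
    obtain ⟨ν, hν, -⟩ := hfrom fun _ => Classical.arbitrary _
    exact ⟨ν, hν⟩
  have hEatom : ∀ b ∈ E, ∃ s t, b = .eq s t ∧ IsAtomTerm CT s ∧ IsAtomTerm CT t := by
    intro b hb
    obtain ⟨q, hq, hbq⟩ := List.mem_flatMap.1 hb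
    have hsat : (q.1.equate q.2).Sat CT := by
      obtain ⟨ν, hν⟩ := hEsat
      exact ⟨ν, fun b hb => hν b (List.mem_flatMap.2 ⟨q, hq, hb⟩)⟩
    obtain ⟨i, j, rfl⟩ := UserConstraint.exists_args_of_mem_equate CT hbq hsat
    obtain ⟨k, hk, rfl⟩ := List.mem_map.1 hq
    rw [Finset.mem_toList, Finset.mem_inter] at hk
    have atom : ∀ {q : GTSRule TG} {n : RuleVar q → Var} {i} {c : UserConstraint TG.signature L Var},
        c = q.headFamily CT n i → ∀ k, IsAtomTerm CT (c.args k) := by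
      rintro q n i c rfl k
      exact q.isAtomTerm_args CT n i k
    refine ⟨_, _, rfl, ?_, ?_⟩
    · obtain ⟨l, rfl⟩ := (hs₁ k).1 hk.1
      exact atom (hg₁ l) i
    · obtain ⟨l, rfl⟩ := (hs₂ k).1 hk.2
      exact atom (hg₂ l) j
  obtain ⟨E', hE', hEE'⟩ := Store.exists_adjustments CT hEsat hEatom
  obtain ⟨nm, -⟩ := exists_embedding_avoiding (Δ.V ⊕ Δ.E) (F := (∅ : Set Var)) Set.finite_empty
  set g : Γ.V ⊕ Γ.E → UserConstraint TG.signature L Var :=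
    fun i => if i ∈ p.s₁ then p.g₁ i else p.g₂ i with hg
  have hgoal : (p.overlap V).goal = ofFamily (g ∘ φ) := by
    have hu : p.s₁ \ p.s₂ ∪ p.s₁ ∩ p.s₂ ∪ p.s₂ \ p.s₁ = Finset.univ.map ⟨φ, hφinj⟩ := by
      ext i
      have := hφX i
      simp only [Finset.mem_union, Finset.mem_sdiff, Finset.mem_inter, Finset.mem_map, Finset.mem_univ,
        true_and, Function.Embedding.coeFn_mk]
      rw [← this]
      tauto
    have e : ofFamily (g ∘ φ) = subfamily g (Finset.univ.map ⟨φ, hφinj⟩) := 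
      (subfamily_map g ⟨φ, hφinj⟩).symm
    rw [e, ← hu, subfamily_disjUnion, subfamily_disjUnion _ (Finset.disjoint_sdiff_inter _ _)]
    · simp only [Peak.overlap]
      rw [subfamily_congr (g := g) (g' := p.g₁) (s := p.s₁ \ p.s₂) fun i hi => if_pos (Finset.mem_sdiff.1 hi).1,
        subfamily_congr (g := g) (g' := p.g₁) (s := p.s₁ ∩ p.s₂) fun i hi => if_pos (Finset.mem_inter.1 hi).1,
        subfamily_congr (g := g) (g' := p.g₂) (s := p.s₂ \ p.s₁) fun i hi => if_neg (Finset.mem_sdiff.1 hi).2]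
    · rw [Finset.sdiff_union_inter]
      exact Finset.disjoint_sdiff
  have hginst : ∀ (ν : Var → CT.carrier) (w : Δ.V ⊕ Δ.E → CT.carrier),
      (∀ i, (φ i ∈ p.s₁ → (p.g₁ (φ i)).inst ν = Δ.ground w d i) ∧
        (φ i ∈ p.s₂ → (p.g₂ (φ i)).inst ν = Δ.ground w d i)) →
      ∀ i, ((g ∘ φ) i).inst ν = Δ.ground w d i := by
    intro ν w h i
    simp only [Function.comp, hg]
    split
    · next hi => exact (h i).1 hi
    · next hi => exact (h i).2 (((hφX _).2 ⟨i, rfl⟩).resolve_left hi)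
  -- The overlap's own store may contain equations between numerals or of the form `c = X`, so the
  -- invariant is verified with the rewritten `E'`.
  refine ⟨⟨(p.overlap V).goal, E', V⟩, StateEquiv.of_store fun ν => (hEE' ν).symm, hE', Δ, nm, D, ?_, ?_⟩
  · intro b hb
    rcases List.mem_append.1 hb with hb | hb
    exacts [isConstEq_of_mem_degreeStore hb, isConstEq_of_mem_degreeStore hb]
  · simp only [hgoal, ← ofFamily_chrGndFamily]
    refine (SemEquiv.of_simulation (fun ν hν => ?_) fun ν _ => ?_).stateEquiv
    · rw [Store.holds_append, hEE'] at hν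
      obtain ⟨w, hw⟩ := hto ν hν.1 hν.2
      refine ⟨Function.extend nm w fun _ => Classical.arbitrary _, Store.holds_nil, by simp, fun i => ?_⟩
      rw [inst_chrGndFamily, hginst ν w hw i, Function.extend_comp nm.injective]
    · obtain ⟨ν', h1, h2, h3⟩ := hfrom (ν ∘ nm)
      refine ⟨ν', Store.holds_append.2 ⟨(hEE' _).2 h1, h2⟩, by simp, fun i => ?_⟩
      rw [inst_chrGndFamily, hginst ν' _ h3 i]

end Overlaps

/-! ### From invariant states to critical pairs. -/

section Main

open FirstOrder.Language

variable {L : FirstOrder.Language.{u, v}} {Var : Type z} {CT : ConstraintTheory.{u, v, w} L}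

/-- A copy of a rule of a GTS-CHR program whose head is listed in the encoding of a graph. -/
theorem GTS.exists_match_of_isCopy {𝒮 : GTS} {nm : ∀ p : GTSRule 𝒮.TG, RuleVar p ↪ Var}
    {r₀ r : CHRRule 𝒮.TG.signature L Var} (h₀ : r₀ ∈ 𝒮.toCHR CT nm) (hr : r.IsCopy r₀)
    {Γ : TypedGraph 𝒮.TG} {g : Γ.V ⊕ Γ.E → UserConstraint 𝒮.TG.signature L Var} {s : Finset (Γ.V ⊕ Γ.E)}
    (hs : r.head = subfamily g s) {w : Γ.V ⊕ Γ.E → CT.carrier} (hw : Function.Injective w)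
    {ν : Var → CT.carrier}
    (hν : ∀ i, (g i).inst ν = Γ.ground w (fun x => (CT.num (Γ.deg x) : CT.carrier)) i) :
    ∃ (q : GTSRule 𝒮.TG) (n : RuleVar q → Var) (m : TypedHom q.L Γ), Function.Injective n ∧
      r.head = q.chrHead CT n ∧ Function.Injective (Sum.map m.onV m.onE) ∧
      (∀ x ∉ Set.range q.l.onV, Γ.deg (m.onV x) = q.L.deg x) ∧
      (∀ i, g (Sum.map m.onV m.onE i) = q.headFamily CT n i) ∧
      ∀ i, i ∈ s ↔ ∃ k, Sum.map m.onV m.onE k = i := by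
  obtain ⟨q, -, rfl⟩ := h₀
  obtain ⟨f, hf, rfl⟩ := hr
  have hhead : ((q.toCHR CT (nm q)).rename f).head = q.chrHead CT (f ∘ nm q) :=
    q.rename_chrHead CT (nm q) f
  rw [hhead, ← GTSRule.ofFamily_headFamily] at hs
  obtain ⟨e, he, hes⟩ := exists_embedding_of_subfamily_eq hs
  obtain ⟨m, hm, hmd⟩ := q.exists_match hw (j := e) fun i => by rw [← he, hν]
  refine ⟨q, f ∘ nm q, m, hf.comp (nm q).injective, hhead, hm ▸ e.injective, fun x hx => ?_, fun i => ?_, fun i => ?_⟩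
  · have h1 : ((Γ.deg (m.onV x) : ℕ) : ℤ) = (q.L.deg x : ℕ) := CT.num_injective (hmd x hx)
    exact_mod_cast h1
  · rw [← hm, he]
  · rw [← hm, hes]

variable [DecidableEq Var]

/-- A state with the graph invariant has an instance that encodes a graph with distinct names. -/
theorem GraphInvariant.exists_ground {TG : FGraph} {σ : CHRState TG.signature L Var}
    (h : GraphInvariant CT σ) : ∃ (Γ : TypedGraph TG) (g : Γ.V ⊕ Γ.E → UserConstraint TG.signature L Var)
      (w : Γ.V ⊕ Γ.E → CT.carrier) (μ : Var → CT.carrier), Function.Injective w ∧ ofFamily g = σ.goal ∧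
      Denotes CT g σ.store σ.globals μ (Γ.ground w fun x => (CT.num (Γ.deg x) : CT.carrier)) := by
  have : Nonempty CT.carrier := CT.nonempty_carrier
  obtain ⟨τ, hτ, -, Γ, nm, B, -, hΓ⟩ := h
  -- Nodes and edges are named by the numerals of their positions in an enumeration, which are
  -- distinct in every constraint theory.
  set w : Γ.V ⊕ Γ.E → CT.carrier := fun i => (CT.num (Fintype.equivFin _ i : ℕ) : CT.carrier) with hw
  have hwinj : Function.Injective w := fun i j hij => by
    have h1 := CT.num_injective hij
    have h2 : ((Fintype.equivFin _ i : ℕ) : ℤ) = (Fintype.equivFin _ j : ℕ) := h1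
    exact (Fintype.equivFin _).injective (Fin.ext (Int.ofNat_injective h2))
  obtain ⟨g, hg, hd⟩ := hΓ.semEquiv.symm.exists_family
    ⟨fun _ => Classical.arbitrary _, Store.holds_nil⟩ (ofFamily_chrGndFamily CT Γ nm)
  obtain ⟨μ, hμ, -, hi⟩ := (hd (fun _ => Classical.arbitrary _) (Γ.ground w _)).1
    ⟨Function.extend nm w fun _ => Classical.arbitrary _, Store.holds_nil, by simp, fun i => by
      rw [inst_chrGndFamily, Function.extend_comp nm.injective]⟩
  -- The solution `μ` was found with `B` added and no globals. It still solves the store without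
  -- `B`, and the globals are given the values it assigns to them.
  have hμτ : τ.store.Holds CT μ := (Store.holds_append.1 hμ).1
  obtain ⟨g', hg', hd'⟩ := hτ.semEquiv.symm.exists_family ⟨μ, hμτ⟩ hg
  exact ⟨Γ, g', w, μ, hwinj, hg', (hd' _ _).1 ⟨μ, hμτ, fun _ _ => rfl, hi⟩⟩

end Main

/-- A GTS-CHR program is locally confluent on the states satisfying the graph invariant if and only
if every critical pair whose overlap satisfies the graph invariant is joinable. -/
theorem mainTheorem7 {L : FirstOrder.Language.{u, v}} (CT : ConstraintTheory.{u, v, w} L)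
    {Var : Type z} [DecidableEq Var] [Infinite Var] (𝒮 : GTS)
    (nm : ∀ p : GTSRule 𝒮.TG, RuleVar p ↪ Var) :
    LocallyConfluentOn CT (𝒮.toCHR CT nm) (GraphInvariant CT) ↔
      ∀ σ σ₁ σ₂ : CHRState 𝒮.TG.signature L Var,
        IsCriticalPair CT (𝒮.toCHR CT nm) σ σ₁ σ₂ → GraphInvariant CT σ →
          CHRJoinable CT (𝒮.toCHR CT nm) (σ₁.cls CT) (σ₂.cls CT) := by
  classical
  constructor
  · intro h σ σ₁ σ₂ hcp hσ
    exact h σ hσ _ _ hcp.chrStep.1 hcp.chrStep.2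
  · intro h σ hσ a b ha hb
    obtain ⟨Γ, g, w, μ, hw, hg, hd⟩ := hσ.exists_ground
    obtain ⟨p, hp⟩ := exists_peak hg hd.sat ha hb
    by_cases hs : (p.s₁ ∩ p.s₂).Nonempty
    · have hd₁ := (hp _ _).1 hd
      -- The valuations `ν₁` and `ν₂` may differ, but both instantiate their listing to the encoding
      -- of the same `Γ`, so both heads are matched in one graph.
      obtain ⟨ν₁, hν₁, -, hi₁⟩ := id hd₁
      obtain ⟨ν₂, -, -, hi₂⟩ := (p.denotes _ _).1 hd₁
      obtain ⟨r₁, hr₁, hc₁⟩ := p.step₁.1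
      obtain ⟨r₂, hr₂, hc₂⟩ := p.step₂.1
      obtain ⟨q₁, n₁, m₁, hn₁, hh₁, hm₁, hdeg₁, hg₁, hs₁⟩ :=
        GTS.exists_match_of_isCopy hr₁ hc₁ p.head₁ hw hi₁
      obtain ⟨q₂, n₂, m₂, hn₂, hh₂, hm₂, hdeg₂, hg₂, hs₂⟩ :=
        GTS.exists_match_of_isCopy hr₂ hc₂ p.head₂ hw hi₂
      have hfin : (p.r₁.head.vars ∪ p.r₂.head.vars).Finite := (Goal.vars_finite _).union (Goal.vars_finite _)
      have hcp := p.isCriticalPair (V := hfin.toFinset) (by simp) hs ⟨ν₁, hν₁⟩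
      refine p.joinable_of_left_right (V := hfin.toFinset) (by simp) (h _ _ _ hcp ?_)
      refine p.graphInvariant_overlap hn₁ hn₂ (fun z z' hz hz' e => ?_) hm₁ hm₂ hdeg₁ hdeg₂ hg₁ hg₂ hs₁ hs₂ _
      have h1 : n₁ z ∈ p.r₁.vars := p.r₁.head_vars_subset (hh₁ ▸ hz.mem_vars CT)
      have h2 : n₁ z ∈ p.r₂.vars := p.r₂.head_vars_subset (hh₂ ▸ e ▸ hz'.mem_vars CT)
      exact (p.apart₂ _ (Or.inl h2) (p.step₂.2.1 _ h2)).2 (Or.inl h1)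
    · exact p.joinable_of_disjoint (Finset.not_nonempty_iff_eq_empty.1 hs)
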